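/- Let $P$ be a simple polygon in the plane with vertices $v_0,\dots,v_{n-1}$ in counterclockwise order (indices modulo $n$), and let $q$ be a point in the interior of $P$ such that no edge of $P$ lies on a line through $q$. A point $x$ is *visible* if the segment $qx$ is contained in the closed region $P$. For consecutive vertices $v_k,v_{k+1}$ write $v_k\prec v_{k+1}$ if the edge from $v_k$ to $v_{k+1}$ is traversed counterclockwise as seen from $q$ (the angle at $q$ increases), and $v_k\succ v_{k+1}$ if it is traversed clockwise. A vertex $v_c$ at which the boundary makes a clockwise turn is *critical-max* if $v_{c-1}\prec v_c\succ v_{c+1}$, *critical-min* if $v_{c-1}\succ v_c\prec v_{c+1}$, and *critical* if it is one of the two. Let $2\le m\le n$ and let $\Delta$ be the chain of the $m$ consecutive vertices $p=v_i,v_{i+1},\dots,v_{i+m-1}=p'$ of the boundary. Assume that the endpoints $p$ and $p'$ are visible critical vertices, that no other vertex of $\Delta$ is a visible critical vertex, and that $p$ and $p'$ lie in different directions from $q$. If $p$ is critical-max, let $A$ be the point nearest to $q$ among the intersections, other than $p$, of the ray from $q$ through $p$ with $\Delta$; otherwise let $A=p$. If $p'$ is critical-min, let $B$ be the point nearest to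 $q$ among the intersections, other than $p'$, of the ray from $q$ through $p'$ with $\Delta$; otherwise let $B=p'$. Then $A$ and $B$ exist, $A$ precedes $B$ on $\Delta$, and the set of the visible points of $\Delta$ consists of $p$, the part of $\Delta$ from $A$ to $B$, and $p'$. Moreover there is an algorithm (one fixed program for a random access machine with a read-only input array, a write-only output, a constant number of index registers and a constant number of number registers, and the operations $+,-,\times$ and comparison on numbers at unit cost) which, given only the vertices of $\Delta$ (with their number $m$) and $q$, writes in $O(m)$ steps the sequence $$p,\ A,\ \text{the vertices of } \Delta \text{ strictly between } A \text{ and } B,\ B,\ p'$$ (points being written in homogeneous coordinates). Its workspace is $O(1)$ words: the index registers always hold natural numbers of size $O(m)$, and if all input coordinates are integers of absolute value at most $U$, then the number registers always hold integers of absolute value at most $C(U+1)^d$ for absolute constants $C,d$; that is, all registers have $O(\log n)$ bits when the input coordinates have $O(\log n)$ bits. -/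

import Mathlib

/-! The plane is `ℂ` with its Euclidean norm.  A closed polygon with `n` vertices is a map
`v : ZMod n → ℂ`; its `k`-th edge is the segment from `v k` to `v (k + 1)`. -/

noncomputable section

namespace ChainVisibility

/-! ### Polygons -/

/-- Cross product (twice the signed area of the triangle `0, a, b`). -/
def cross (a b : ℂ) : ℝ := a.re * b.im - a.im * b.re

/-- The closed polygonal curve does not meet itself: a point of the curve lies on only one of the
half-open edges `[v k, v (k + 1))`, and there at only one position. -/
def IsSimplePolygon {n : ℕ} (v : ZMod n → ℂ) : Prop :=
  3 ≤ n ∧ ∀ k l : ZMod n, ∀ s ∈ Set.Ico (0 : ℝ) 1, ∀ t ∈ Set.Ico (0 : ℝ) 1,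
    AffineMap.lineMap (v k) (v (k + 1)) s = AffineMap.lineMap (v l) (v (l + 1)) t → k = l ∧ s = t

/-- The boundary of the polygon. -/
def boundary {n : ℕ} (v : ZMod n → ℂ) : Set ℂ := ⋃ k : ZMod n, segment ℝ (v k) (v (k + 1))

/-- The winding number of the polygon about a point `z` off its boundary: the sum of the signed
angles, in `(-π, π)`, under which the edges are seen from `z`, divided by `2π`. -/
def windingNumber {n : ℕ} [NeZero n] (v : ZMod n → ℂ) (z : ℂ) : ℝ :=
  (∑ k : ZMod n, Complex.arg ((v (k + 1) - z) / (v k - z))) / (2 * Real.pi)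

/-- The points inside a simple polygon whose vertices are listed in counterclockwise order.
(A clockwise polygon has winding numbers `0` and `-1` only, so the existence of such a point
says that the vertices are listed counterclockwise.) -/
def inside {n : ℕ} [NeZero n] (v : ZMod n → ℂ) : Set ℂ :=
  {z | z ∉ boundary v ∧ windingNumber v z = 1}

/-- The closed polygonal region. -/
def region {n : ℕ} [NeZero n] (v : ZMod n → ℂ) : Set ℂ := boundary v ∪ inside v

/-- `x` is visible from `q` in the polygon. -/
def Visible {n : ℕ} [NeZero n] (v : ZMod n → ℂ) (q x : ℂ) : Prop :=
  segment ℝ q x ⊆ region v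

/-- Seen from `q`, the angle increases along the edge from `x` to `y`. -/
def AngleLT (q x y : ℂ) : Prop := 0 < cross (x - q) (y - q)

/-- The turn at `y` on the way `x, y, z` is clockwise. -/
def ClockwiseTurn (x y z : ℂ) : Prop := cross (y - x) (z - y) < 0

/-- The boundary turns clockwise at `v c`, where the angle seen from `q` has a local maximum. -/
def CriticalMax {n : ℕ} (v : ZMod n → ℂ) (q : ℂ) (c : ZMod n) : Prop :=
  AngleLT q (v (c - 1)) (v c) ∧ AngleLT q (v (c + 1)) (v c) ∧
    ClockwiseTurn (v (c - 1)) (v c) (v (c + 1))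

/-- The boundary turns clockwise at `v c`, where the angle seen from `q` has a local minimum. -/
def CriticalMin {n : ℕ} (v : ZMod n → ℂ) (q : ℂ) (c : ZMod n) : Prop :=
  AngleLT q (v c) (v (c - 1)) ∧ AngleLT q (v c) (v (c + 1)) ∧
    ClockwiseTurn (v (c - 1)) (v c) (v (c + 1))

def VisibleCritical {n : ℕ} [NeZero n] (v : ZMod n → ℂ) (q : ℂ) (c : ZMod n) : Prop :=
  (CriticalMax v q c ∨ CriticalMin v q c) ∧ Visible v q (v c)

/-! ### Chains -/

/-- The boundary, parametrized counterclockwise from `v i`; the vertex `v (i + k)` is at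
parameter `k`. -/
def curve {n : ℕ} (v : ZMod n → ℂ) (i : ZMod n) (t : ℝ) : ℂ :=
  AffineMap.lineMap (v (i + ⌊t⌋₊)) (v (i + ⌊t⌋₊ + 1)) (t - ⌊t⌋₊)

/-- The chain with the `m` vertices `v i, v (i + 1), …, v (i + (m - 1))`, as a set. -/
def chain {n : ℕ} (v : ZMod n → ℂ) (i : ZMod n) (m : ℕ) : Set ℂ :=
  curve v i '' Set.Icc 0 ((m - 1 : ℕ) : ℝ)

/-- The last vertex of the chain. -/
def chainEnd {n : ℕ} (i : ZMod n) (m : ℕ) : ZMod n := i + ((m - 1 : ℕ) : ZMod n)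

/-- The two endpoints of the chain are its only visible critical vertices, and they are seen from
`q` in different directions. -/
def IsVisibleCriticalChain {n : ℕ} [NeZero n] (v : ZMod n → ℂ) (q : ℂ) (i : ZMod n) (m : ℕ) :
    Prop :=
  2 ≤ m ∧ m ≤ n ∧
  VisibleCritical v q i ∧ VisibleCritical v q (chainEnd i m) ∧
  (∀ k : ℕ, 0 < k → k < m - 1 → ¬ VisibleCritical v q (i + k)) ∧
  ¬ SameRay ℝ (v i - q) (v (chainEnd i m) - q)

/-- The ray from `q` through `w`. -/
def ray (q w : ℂ) : Set ℂ := {x | ∃ s : ℝ, 0 ≤ s ∧ x = q + s * (w - q)}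

/-- The chain at parameter `t` is the point nearest to `q` among the intersections, other than `w`
itself, of the chain with the ray from `q` through `w`. -/
def IsNearestHit {n : ℕ} (v : ZMod n → ℂ) (q : ℂ) (i : ZMod n) (m : ℕ) (w : ℂ) (t : ℝ) : Prop :=
  t ∈ Set.Icc 0 ((m - 1 : ℕ) : ℝ) ∧ curve v i t ∈ ray q w \ {w} ∧
    ∀ x ∈ chain v i m, x ∈ ray q w \ {w} → dist q (curve v i t) ≤ dist q x

/-- The parameter of the point `A`. -/
def IsFirstCut {n : ℕ} (v : ZMod n → ℂ) (q : ℂ) (i : ZMod n) (m : ℕ) (a : ℝ) : Prop :=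
  (CriticalMax v q i → IsNearestHit v q i m (v i) a) ∧ (¬ CriticalMax v q i → a = 0)

/-- The parameter of the point `B`. -/
def IsLastCut {n : ℕ} (v : ZMod n → ℂ) (q : ℂ) (i : ZMod n) (m : ℕ) (b : ℝ) : Prop :=
  (CriticalMin v q (chainEnd i m) → IsNearestHit v q i m (v (chainEnd i m)) b) ∧
    (¬ CriticalMin v q (chainEnd i m) → b = ((m - 1 : ℕ) : ℝ))

open Classical in
/-- The list: first endpoint, `A`, the vertices strictly between `A` and `B`, `B`, last endpoint. -/
def outputPoints {n : ℕ} (v : ZMod n → ℂ) (i : ZMod n) (m : ℕ) (a b : ℝ) : List ℂ :=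
  [v i, curve v i a] ++
    ((List.range m).filter (fun k : ℕ => a < (k : ℝ) ∧ (k : ℝ) < b)).map
      (fun k : ℕ => v (i + (k : ZMod n))) ++
    [curve v i b, v (chainEnd i m)]

/-! ### The machine

A random access machine with a read-only input (an array of `m` points and a query point), a
write-only output, and as its workspace `α` registers for indices and `β` registers for numbers. -/

/-- The read-only input. -/
structure Input where
  len : ℕ
  pts : Fin len → ℂ
  query : ℂ

/-- Random access to the array; reading beyond its end gives `0`. -/
def Input.read (I : Input) (k : ℕ) : ℂ := if h : k < I.len then I.pts ⟨k, h⟩ else 0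

inductive Instr (α β : ℕ) : Type
  /-- index register `x ← c` -/
  | idxConst (x : Fin α) (c : ℕ)
  /-- `x ←` length of the array -/
  | idxLen (x : Fin α)
  /-- `x ← y` -/
  | idxCopy (x y : Fin α)
  /-- `x ← x + 1` -/
  | idxSucc (x : Fin α)
  /-- `x ← x - 1`, truncated at `0` -/
  | idxPred (x : Fin α)
  /-- number register `r ← c` -/
  | numConst (r : Fin β) (c : ℤ)
  /-- `r ←` first coordinate of the array element with index `x` -/
  | readX (r : Fin β) (x : Fin α)
  /-- `r ←` second coordinate of the array element with index `x` -/
  | readY (r : Fin β) (x : Fin α)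
  /-- `r ←` first coordinate of the query point -/
  | queryX (r : Fin β)
  /-- `r ←` second coordinate of the query point -/
  | queryY (r : Fin β)
  /-- `r ← s + t` -/
  | add (r s t : Fin β)
  /-- `r ← s - t` -/
  | sub (r s t : Fin β)
  /-- `r ← s * t` -/
  | mul (r s t : Fin β)
  /-- jump to line `l` -/
  | jump (l : ℕ)
  /-- jump to line `l` if `x < y` -/
  | jumpIdxLT (x y : Fin α) (l : ℕ)
  /-- jump to line `l` if `r < s` -/
  | jumpNumLT (r s : Fin β) (l : ℕ)
  /-- append the words in `r, s, t` to the output -/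
  | write (r s t : Fin β)

/-- A configuration: program counter, workspace, and the output written so far. -/
structure Config (α β : ℕ) where
  pc : ℕ
  idx : Fin α → ℕ
  num : Fin β → ℝ
  out : List (ℝ × ℝ × ℝ)

def Config.init (α β : ℕ) : Config α β := ⟨0, fun _ => 0, fun _ => 0, []⟩

open Classical in
/-- The effect of one instruction. -/
def Instr.exec {α β : ℕ} (I : Input) (c : Config α β) : Instr α β → Config α β
  | .idxConst x k => { c with pc := c.pc + 1, idx := Function.update c.idx x k }
  | .idxLen x => { c with pc := c.pc + 1, idx := Function.update c.idx x I.len }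
  | .idxCopy x y => { c with pc := c.pc + 1, idx := Function.update c.idx x (c.idx y) }
  | .idxSucc x => { c with pc := c.pc + 1, idx := Function.update c.idx x (c.idx x + 1) }
  | .idxPred x => { c with pc := c.pc + 1, idx := Function.update c.idx x (c.idx x - 1) }
  | .numConst r z => { c with pc := c.pc + 1, num := Function.update c.num r (z : ℝ) }
  | .readX r x => { c with pc := c.pc + 1, num := Function.update c.num r (I.read (c.idx x)).re }
  | .readY r x => { c with pc := c.pc + 1, num := Function.update c.num r (I.read (c.idx x)).im }
  | .queryX r => { c with pc := c.pc + 1, num := Function.update c.num r I.query.re }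
  | .queryY r => { c with pc := c.pc + 1, num := Function.update c.num r I.query.im }
  | .add r s t => { c with pc := c.pc + 1, num := Function.update c.num r (c.num s + c.num t) }
  | .sub r s t => { c with pc := c.pc + 1, num := Function.update c.num r (c.num s - c.num t) }
  | .mul r s t => { c with pc := c.pc + 1, num := Function.update c.num r (c.num s * c.num t) }
  | .jump l => { c with pc := l }
  | .jumpIdxLT x y l => { c with pc := if c.idx x < c.idx y then l else c.pc + 1 }
  | .jumpNumLT r s l => { c with pc := if c.num r < c.num s then l else c.pc + 1 }
  | .write r s t => { c with pc := c.pc + 1, out := c.out ++ [(c.num r, c.num s, c.num t)] }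

/-- The machine has halted when the program counter has left the program. -/
def Halted {α β : ℕ} (prog : List (Instr α β)) (c : Config α β) : Prop := prog.length ≤ c.pc

/-- One step, at unit cost; a halted configuration does not change any more. -/
def step {α β : ℕ} (prog : List (Instr α β)) (I : Input) (c : Config α β) : Config α β :=
  match prog[c.pc]? with
  | some ins => ins.exec I c
  | none => c

/-- The configuration after `T` steps. -/
def run {α β : ℕ} (prog : List (Instr α β)) (I : Input) (T : ℕ) : Config α β :=
  (step prog I)^[T] (Config.init α β)

/-- The machine writes points in homogeneous coordinates: the words `x, y, w` with `w ≠ 0` stand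
for the point `(x / w, y / w)`. -/
def Represents (out : List (ℝ × ℝ × ℝ)) (L : List ℂ) : Prop :=
  List.Forall₂ (fun o z => o.2.2 ≠ 0 ∧ z.re = o.1 / o.2.2 ∧ z.im = o.2.1 / o.2.2) out L

/-- The input that consists of the chain and the viewpoint alone. -/
def chainInput {n : ℕ} (v : ZMod n → ℂ) (q : ℂ) (i : ZMod n) (m : ℕ) : Input where
  len := m
  pts := fun k => v (i + ((k : ℕ) : ZMod n))
  query := q

/-- The real number `x` is an integer of absolute value at most `U`. -/
def IsIntBounded (U : ℕ) (x : ℝ) : Prop := ∃ z : ℤ, x = z ∧ |z| ≤ U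

/-- All coordinates in the input are integers of absolute value at most `U`. -/
def Input.IntBounded (I : Input) (U : ℕ) : Prop :=
  (∀ k, IsIntBounded U (I.pts k).re ∧ IsIntBounded U (I.pts k).im) ∧
    IsIntBounded U I.query.re ∧ IsIntBounded U I.query.im

end ChainVisibility

end

open ChainVisibility

/-! Around `q` the boundary is a periodic curve `t ↦ (θ t, ρ t)` in logarithmic polar coordinates,
and `θ` gains `2π` in each period, since `q` has winding number one. Looking at how the winding
number jumps across an edge shows that the segment from `q` to a visible point can meet the
boundary before its end only in a vertex at which `θ` turns back; turning the chord between two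
points of the curve continuously shows that the boundary turns clockwise there, so that this
vertex is critical. Hence, between two consecutive visible critical vertices, the visible points
come in the order of their angles, and they fill up a single interval of parameters: a gap would
leave directions in which nothing is visible. Its ends lie in the directions of the two endpoints
of the chain, which makes them the cut points `A` and `B`.

At `A` the angle increases, so `A` lies on the edge whose crossing with the ray through `p` is
nearest to `q` among those edges that leave the ray counterclockwise. One scan of the chain that
compares crossings by cross-multiplication finds this edge, another one finds that of `B`, and the
vertices in between are then copied to the output. -/

namespace ChainVisibility

open Complex Filter Topology Set

/-! ### The winding number off the boundary -/

theorem eq_of_continuousOn_of_mem_range_intCast {X : Type*} [TopologicalSpace X] {S : Set X}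
    (hS : IsPreconnected S) {f : X → ℝ} (hf : ContinuousOn f S)
    (hint : MapsTo f S (range ((↑) : ℤ → ℝ))) {x y : X} (hx : x ∈ S) (hy : y ∈ S) : f x = f y :=
  have : DiscreteTopology (range ((↑) : ℤ → ℝ)) :=
    Int.isClosedEmbedding_coe_real.isEmbedding.toHomeomorph.symm.isEmbedding.discreteTopology
  hS.constant_of_mapsTo ⟨this⟩ hf hint hx hy

theorem isCompact_segment {E : Type*} [AddCommGroup E] [Module ℝ E] [TopologicalSpace E]
    [ContinuousAdd E] [ContinuousSMul ℝ E] (a b : E) : IsCompact (segment ℝ a b) := by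
  rw [segment_eq_image]
  exact isCompact_Icc.image (by fun_prop)

theorem mem_segment_iff_exists {a b z : ℂ} :
    z ∈ segment ℝ a b ↔ ∃ s ∈ Icc (0 : ℝ) 1, z = a + s * (b - a) := by
  simp only [segment_eq_image', mem_image, real_smul, eq_comm]

theorem lineMap_eq_add_mul (a b : ℂ) (s : ℝ) :
    AffineMap.lineMap a b s = a + s * (b - a) := by
  rw [AffineMap.lineMap_apply, vsub_eq_sub, vadd_eq_add, real_smul, add_comm]

theorem ne_of_notMem_segment {a b z : ℂ} (h : z ∉ segment ℝ a b) : a - z ≠ 0 :=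
  sub_ne_zero.2 fun haz => h (haz ▸ left_mem_segment ℝ a b)

theorem div_mem_slitPlane_of_notMem_segment {a b z : ℂ} (h : z ∉ segment ℝ a b) :
    (b - z) / (a - z) ∈ slitPlane := by
  have haz := ne_of_notMem_segment h
  refine mem_slitPlane_iff_arg.2 ⟨fun harg => h ?_, div_ne_zero ?_ haz⟩
  · obtain ⟨hre, him⟩ := arg_eq_pi_iff.1 harg
    rw [mem_segment_iff_sameRay, SameRay.sameRay_comm, sameRay_iff_arg_div_eq_zero,
      ← neg_sub a z, div_neg, arg_eq_zero_iff, neg_re, neg_im]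
    exact ⟨by linarith, by linarith⟩
  · exact ne_of_notMem_segment (segment_symm ℝ a b ▸ h)

/-- The angle under which the segment from `a` to `b` is seen from `z`; the winding number adds
these angles up over the edges. -/
noncomputable def edgeArg (a b z : ℂ) : ℝ := arg ((b - z) / (a - z))

theorem continuousAt_edgeArg {a b z : ℂ} (h : z ∉ segment ℝ a b) :
    ContinuousAt (edgeArg a b) z :=
  (continuousAt_arg (div_mem_slitPlane_of_notMem_segment h)).comp
    (f := fun z => (b - z) / (a - z))
    (ContinuousAt.div (by fun_prop) (by fun_prop) (ne_of_notMem_segment h))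

theorem exp_edgeArg_mul_I {a b z : ℂ} (ha : a - z ≠ 0) (hb : b - z ≠ 0) :
    exp (edgeArg a b z * I) = ((b - z) / (a - z)) / (‖(b - z) / (a - z)‖ : ℝ) := by
  have hnorm : ((‖(b - z) / (a - z)‖ : ℝ) : ℂ) ≠ 0 := by simp [ha, hb]
  rw [eq_div_iff hnorm, mul_comm, edgeArg, norm_mul_exp_arg_mul_I]

section Winding

variable {n : ℕ} {v : ZMod n → ℂ}

theorem notMem_segment_of_notMem_boundary {z : ℂ} (hz : z ∉ boundary v) (k : ZMod n) :
    z ∉ segment ℝ (v k) (v (k + 1)) :=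
  fun h => hz (mem_iUnion.2 ⟨k, h⟩)

variable [NeZero n]

theorem isCompact_boundary (v : ZMod n → ℂ) : IsCompact (boundary v) :=
  isCompact_iUnion fun _ => isCompact_segment _ _

theorem continuousAt_windingNumber {z : ℂ} (hz : z ∉ boundary v) :
    ContinuousAt (windingNumber v) z :=
  ContinuousAt.div_const (tendsto_finsetSum _ fun k _ =>
    continuousAt_edgeArg (notMem_segment_of_notMem_boundary hz k)) _

theorem windingNumber_mem_range_intCast {z : ℂ} (hz : z ∉ boundary v) :
    windingNumber v z ∈ range ((↑) : ℤ → ℝ) := by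
  have hne : ∀ k, v k - z ≠ 0 := fun k =>
    ne_of_notMem_segment (notMem_segment_of_notMem_boundary hz k)
  have hshift : ∏ k : ZMod n, (v (k + 1) - z) = ∏ k : ZMod n, (v k - z) :=
    Equiv.prod_comp (Equiv.addRight 1) fun k => v k - z
  have hprod : ∏ k : ZMod n, (v (k + 1) - z) / (v k - z) = 1 := by
    rw [Finset.prod_div_distrib, hshift, div_self (Finset.prod_ne_zero_iff.2 fun k _ => hne k)]
  have hexp : exp ((∑ k : ZMod n, edgeArg (v k) (v (k + 1)) z : ℝ) * I) = 1 := by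
    rw [ofReal_sum, Finset.sum_mul, exp_sum]
    simp_rw [exp_edgeArg_mul_I (hne _) (hne _)]
    rw [Finset.prod_div_distrib, hprod, ← ofReal_prod, ← norm_prod, hprod]
    simp
  obtain ⟨k, hk⟩ := Complex.exp_eq_one_iff.1 hexp
  refine ⟨k, ?_⟩
  rw [windingNumber, eq_div_iff (by positivity)]
  simpa [edgeArg] using (congrArg Complex.im hk).symm

theorem windingNumber_eq_of_isPreconnected {S : Set ℂ} (hS : IsPreconnected S)
    (hb : ∀ z ∈ S, z ∉ boundary v) {x y : ℂ} (hx : x ∈ S) (hy : y ∈ S) :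
    windingNumber v x = windingNumber v y :=
  eq_of_continuousOn_of_mem_range_intCast hS
    (fun z hz => (continuousAt_windingNumber (hb z hz)).continuousWithinAt)
    (fun z hz => windingNumber_mem_range_intCast (hb z hz)) hx hy

theorem isClosed_region (v : ZMod n → ℂ) : IsClosed (region v) := by
  rw [← isOpen_compl_iff, isOpen_iff_mem_nhds]
  intro z hz
  have hzb : z ∉ boundary v := fun h => hz (Or.inl h)
  have hzw : windingNumber v z ≠ 1 := fun h => hz (Or.inr ⟨hzb, h⟩)
  filter_upwards [(isCompact_boundary v).isClosed.isOpen_compl.mem_nhds hzb,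
    (continuousAt_windingNumber hzb).eventually_ne hzw] with y hyb hyw
  exact fun hy => hy.elim hyb fun h => hyw h.2

theorem visible_iff {q x : ℂ} :
    Visible v q x ↔ ∀ s ∈ Icc (0 : ℝ) 1, q + s * (x - q) ∈ region v := by
  simp only [Visible, segment_eq_image', subset_def, forall_mem_image, real_smul]

theorem isClosed_setOf_visible (v : ZMod n → ℂ) (q : ℂ) : IsClosed {x | Visible v q x} := by
  simp_rw [visible_iff, ofPred_forall]
  exact isClosed_iInter fun s => isClosed_iInter fun _ =>
    (isClosed_region v).preimage (f := fun x => q + s * (x - q)) (by fun_prop)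

theorem Visible.of_mem_segment {q x y : ℂ} (h : Visible v q x) (hy : y ∈ segment ℝ q x) :
    Visible v q y :=
  ((convex_segment q x).segment_subset (left_mem_segment ℝ q x) hy).trans h

theorem visible_of_forall_notMem_boundary {q x : ℂ} (hq : q ∈ inside v) (hx : x ∈ boundary v)
    (h : ∀ s ∈ Ico (0 : ℝ) 1, q + s * (x - q) ∉ boundary v) : Visible v q x := by
  have hpre : IsPreconnected ((fun s : ℝ => q + s * (x - q)) '' Ico 0 1) :=
    isPreconnected_Ico.image _ (by fun_prop)
  rw [visible_iff]
  intro s hs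
  rcases hs.2.lt_or_eq with hs1 | rfl
  · refine Or.inr ⟨h s ⟨hs.1, hs1⟩, ?_⟩
    rw [← hq.2]
    exact windingNumber_eq_of_isPreconnected hpre (forall_mem_image.2 h) ⟨s, ⟨hs.1, hs1⟩, rfl⟩
      ⟨0, by simp, by simp⟩
  · exact Or.inl (by simpa using hx)

end Winding

/-! ### Crossing an edge -/

theorem cross_self_add (a b : ℂ) : cross a (a + b) = cross a b := by
  simp only [cross, add_re, add_im]; ring

theorem cross_neg_left (a b : ℂ) : cross (-a) b = -cross a b := by
  simp only [cross, neg_re, neg_im]; ring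

theorem cross_swap (a b : ℂ) : cross b a = -cross a b := by
  simp only [cross]; ring

theorem ne_zero_of_cross_ne_zero {a b : ℂ} (h : cross a b ≠ 0) : a ≠ 0 ∧ b ≠ 0 := by
  constructor <;> (rintro rfl; simp [cross] at h)

theorem im_div_eq_cross_div (a b : ℂ) : (b / a).im = cross a b / normSq a := by
  rw [div_im, cross]; ring

theorem sign_im_div (a b : ℂ) : SignType.sign (b / a).im = SignType.sign (cross a b) := by
  rcases eq_or_ne a 0 with rfl | ha
  · simp [cross]
  · rw [im_div_eq_cross_div, div_eq_mul_inv, sign_mul, sign_pos (inv_pos.2 (normSq_pos.2 ha)),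
      mul_one]

theorem im_div_pos_iff {a b : ℂ} : 0 < (b / a).im ↔ 0 < cross a b := by
  rw [← sign_eq_one_iff, sign_im_div, sign_eq_one_iff]

theorem im_div_neg_iff {a b : ℂ} : (b / a).im < 0 ↔ cross a b < 0 := by
  rw [← sign_eq_neg_one_iff, sign_im_div, sign_eq_neg_one_iff]

theorem im_div_eq_zero_iff {a b : ℂ} : (b / a).im = 0 ↔ cross a b = 0 := by
  rw [← sign_eq_zero_iff, sign_im_div, sign_eq_zero_iff]

theorem cross_eq_mul_cross_of_mem {a b q d : ℂ} {s c : ℝ}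
    (h : a + s * (b - a) = q + c * d) : cross (a - q) (b - q) = c * cross d (b - a) := by
  have ha : a - q = c * d - s * (b - a) := by linear_combination h
  have hb : b - q = (a - q) + (b - a) := by ring
  rw [hb, cross_self_add, ha]
  simp [cross]; ring

theorem sign_cross_sub_eq_of_mem {a b q d : ℂ} {s c : ℝ} (hc : 0 < c)
    (hne : cross (a - q) (b - q) ≠ 0) (h : a + s * (b - a) = q + c * d) :
    cross d (b - a) ≠ 0 ∧
      SignType.sign (cross d (b - a)) = SignType.sign (cross (a - q) (b - q)) := by
  have hcross := cross_eq_mul_cross_of_mem h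
  refine ⟨fun h0 => hne (by rw [hcross, h0, mul_zero]), ?_⟩
  rw [hcross, sign_mul, sign_pos hc, one_mul]

theorem tendsto_add_ofReal_mul (z d : ℂ) :
    Tendsto (fun ε : ℝ => z + ε * d) (𝓝[>] 0) (𝓝 z) := by
  have : Tendsto (fun ε : ℝ => z + ε * d) (𝓝 0) (𝓝 (z + (0 : ℝ) * d)) :=
    Continuous.tendsto (by fun_prop) _
  simpa using this.mono_left nhdsWithin_le_nhds

/-- `f` jumps by `J` at `z` in the direction `d`: this is the difference of its values just behind
and just in front of `z`, the value at `z` itself being irrelevant. -/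
def HasJump (f : ℂ → ℝ) (z d : ℂ) (J : ℝ) : Prop :=
  Tendsto (fun ε : ℝ => f (z + ε * d) - f (z + ε * -d)) (𝓝[>] 0) (𝓝 J)

theorem hasJump_of_tendsto {f : ℂ → ℝ} {z d : ℂ} {x y : ℝ}
    (hx : Tendsto (fun ε : ℝ => f (z + ε * d)) (𝓝[>] 0) (𝓝 x))
    (hy : Tendsto (fun ε : ℝ => f (z + ε * -d)) (𝓝[>] 0) (𝓝 y)) : HasJump f z d (x - y) :=
  hx.sub hy

theorem hasJump_zero_of_continuousAt {f : ℂ → ℝ} {z : ℂ} (hf : ContinuousAt f z) (d : ℂ) :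
    HasJump f z d 0 := by
  rw [← sub_self (f z)]
  exact hasJump_of_tendsto (hf.tendsto.comp (tendsto_add_ofReal_mul z d))
    (hf.tendsto.comp (tendsto_add_ofReal_mul z (-d)))

theorem HasJump.sum {ι : Type*} {s : Finset ι} {f : ι → ℂ → ℝ} {z d : ℂ} {J : ι → ℝ}
    (h : ∀ l ∈ s, HasJump (f l) z d (J l)) :
    HasJump (fun w => ∑ l ∈ s, f l w) z d (∑ l ∈ s, J l) := by
  simpa only [HasJump, ← Finset.sum_sub_distrib] using tendsto_finsetSum s h

theorem arg_neg_sub_arg {y : ℂ} (hy : y.im ≠ 0) :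
    arg (-y) - arg y = -(Real.pi * SignType.sign y.im) := by
  rcases hy.lt_or_gt with h | h
  · rw [arg_neg_eq_arg_add_pi_of_im_neg h, sign_neg h]; simp
  · rw [arg_neg_eq_arg_sub_pi_of_im_pos h, sign_pos h]; simp

theorem tendsto_edgeArg_left {a b d : ℂ} (hd : cross d (b - a) ≠ 0) :
    Tendsto (fun ε : ℝ => edgeArg a b (a + ε * d)) (𝓝[>] 0) (𝓝 (arg (-((b - a) / d)))) := by
  have hmem : -((b - a) / d) ∈ slitPlane :=
    Or.inr (by rwa [neg_im, neg_ne_zero, Ne, im_div_eq_zero_iff])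
  have hlim : Tendsto (fun ε : ℝ => -((b - (a + ε * d)) / d)) (𝓝[>] 0) (𝓝 (-((b - a) / d))) :=
    ((tendsto_const_nhds.sub (tendsto_add_ofReal_mul a d)).div_const d).neg
  refine ((continuousAt_arg hmem).tendsto.comp hlim).congr' ?_
  filter_upwards [self_mem_nhdsWithin] with ε (hε : 0 < ε)
  have hscale : (b - (a + ε * d)) / (a - (a + ε * d)) =
      ((ε⁻¹ : ℝ) : ℂ) * -((b - (a + ε * d)) / d) := by
    rw [sub_add_cancel_left, div_neg, mul_neg, mul_comm (ε : ℂ) d, ← div_div, ofReal_inv,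
      inv_mul_eq_div]
  rw [edgeArg, hscale, arg_real_mul _ (inv_pos.2 hε), Function.comp_apply]

theorem hasJump_edgeArg_left {a b d : ℂ} (hd : cross d (b - a) ≠ 0) :
    HasJump (edgeArg a b) a d (-(Real.pi * SignType.sign (cross d (b - a)))) := by
  have hd' : cross (-d) (b - a) ≠ 0 := by rwa [cross_neg_left, neg_ne_zero]
  have him : ((b - a) / d).im ≠ 0 := im_div_eq_zero_iff.not.2 hd
  rw [← sign_im_div, ← arg_neg_sub_arg him]
  simpa [div_neg] using hasJump_of_tendsto (tendsto_edgeArg_left hd) (tendsto_edgeArg_left hd')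

theorem edgeArg_swap {a b z : ℂ} (h : z ∉ segment ℝ a b) : edgeArg b a z = -edgeArg a b z := by
  have hpi := (mem_slitPlane_iff_arg.1 (div_mem_slitPlane_of_notMem_segment h)).1
  rw [edgeArg, ← inv_div, arg_inv, if_neg hpi, edgeArg]

theorem eventually_notMem_segment {a b q d : ℂ} {c : ℝ} (hq : cross (a - q) (b - q) ≠ 0) :
    ∀ᶠ ε : ℝ in 𝓝[>] 0, q + c * d + ε * d ∉ segment ℝ a b := by
  by_cases hz : q + c * d ∈ segment ℝ a b
  · obtain ⟨s, -, hs⟩ := mem_segment_iff_exists.1 hz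
    filter_upwards [self_mem_nhdsWithin] with ε (hε : 0 < ε) hmem
    obtain ⟨t, -, ht⟩ := mem_segment_iff_exists.1 hmem
    have hcross := cross_eq_mul_cross_of_mem hs.symm
    have hcross' := cross_eq_mul_cross_of_mem (c := c + ε) (d := d) (q := q) (s := t)
      (by rw [← ht]; push_cast; ring)
    have : ε * cross d (b - a) = 0 := by linear_combination hcross - hcross'
    exact hq (by rw [hcross, (mul_eq_zero.1 this).resolve_left hε.ne', mul_zero])
  · exact (tendsto_add_ofReal_mul _ d).eventually
      ((isCompact_segment a b).isClosed.isOpen_compl.mem_nhds hz)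

theorem HasJump.neg_congr {f g : ℂ → ℝ} {z d : ℂ} {J : ℝ} (h : HasJump f z d J)
    (hpos : ∀ᶠ ε : ℝ in 𝓝[>] 0, g (z + ε * d) = -f (z + ε * d))
    (hneg : ∀ᶠ ε : ℝ in 𝓝[>] 0, g (z + ε * -d) = -f (z + ε * -d)) : HasJump g z d (-J) := by
  refine h.neg.congr' ?_
  filter_upwards [hpos, hneg] with ε h₁ h₂
  rw [h₁, h₂]; ring

theorem hasJump_edgeArg_right {a b d : ℂ} (hd : cross d (b - a) ≠ 0) :
    HasJump (edgeArg a b) b d (-(Real.pi * SignType.sign (cross d (b - a)))) := by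
  have hswap : cross d (a - b) = -cross d (b - a) := by
    rw [← neg_sub, cross_swap, cross_neg_left, ← cross_swap]
  have hoff : ∀ e : ℂ, cross e (b - a) ≠ 0 →
      ∀ᶠ ε : ℝ in 𝓝[>] 0, edgeArg a b (b + ε * e) = -edgeArg b a (b + ε * e) := by
    intro e he
    have hb : cross (b - (b - e)) (a - (b - e)) ≠ 0 := by
      rw [cross_eq_mul_cross_of_mem (s := 0) (c := 1) (d := e) (by simp)]
      rwa [← neg_sub, cross_swap, cross_neg_left, ← cross_swap, one_mul, neg_ne_zero]
    filter_upwards [eventually_notMem_segment (c := 1) (d := e) hb] with ε hε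
    exact edgeArg_swap (by simpa using hε)
  have hjump := hasJump_edgeArg_left (a := b) (b := a) (d := d) (by rwa [hswap, neg_ne_zero])
  rw [hswap, Left.sign_neg] at hjump
  simpa using hjump.neg_congr (hoff d hd) (hoff (-d) (by rwa [cross_neg_left, neg_ne_zero]))

theorem tendsto_edgeArg_of_mem_Ioo {a b d : ℂ} {s : ℝ} (hs : s ∈ Ioo (0 : ℝ) 1)
    (hd : cross d (b - a) ≠ 0) :
    Tendsto (fun ε : ℝ => edgeArg a b (a + s * (b - a) + ε * d)) (𝓝[>] 0)
      (𝓝 (-(Real.pi * SignType.sign (cross d (b - a))))) := by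
  set z := a + s * (b - a) with hz
  have hs0 : (s : ℂ) ≠ 0 := ofReal_ne_zero.2 hs.1.ne'
  have hba := (ne_zero_of_cross_ne_zero hd).2
  have hne : a - z ≠ 0 := by rw [hz, sub_add_cancel_left, neg_ne_zero]; exact mul_ne_zero hs0 hba
  have hquot : (b - z) / (a - z) = ((-(1 - s) / s : ℝ) : ℂ) := by
    rw [div_eq_iff hne, hz]; push_cast; field_simp; ring
  have hre : ((b - z) / (a - z)).re < 0 := by
    rw [hquot, ofReal_re]; exact div_neg_of_neg_of_pos (by linarith [hs.2]) hs.1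
  have him : ((b - z) / (a - z)).im = 0 := by rw [hquot, ofReal_im]
  have hlim : Tendsto (fun ε : ℝ => (b - (z + ε * d)) / (a - (z + ε * d))) (𝓝[>] 0)
      (𝓝 ((b - z) / (a - z))) :=
    have hr := tendsto_add_ofReal_mul z d
    (tendsto_const_nhds.sub hr).div (tendsto_const_nhds.sub hr) hne
  have hcross (ε : ℝ) : cross (a - (z + ε * d)) (b - (z + ε * d)) = -(ε * cross d (b - a)) := by
    rw [hz]; simp [cross]; ring
  rcases hd.lt_or_gt with h | h
  · rw [sign_neg h]
    simpa [Function.comp_def, edgeArg] using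
      (tendsto_arg_nhdsWithin_im_nonneg_of_re_neg_of_im_zero hre him).comp <|
      tendsto_nhdsWithin_iff.2 ⟨hlim, by
        filter_upwards [self_mem_nhdsWithin] with ε hε
        refine (im_div_pos_iff.2 ?_).le
        rw [hcross, neg_pos]
        exact mul_neg_of_pos_of_neg hε h⟩
  · rw [sign_pos h]
    simpa [Function.comp_def, edgeArg] using
      (tendsto_arg_nhdsWithin_im_neg_of_re_neg_of_im_zero hre him).comp <|
      tendsto_nhdsWithin_iff.2 ⟨hlim, by
        filter_upwards [self_mem_nhdsWithin] with ε hε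
        refine im_div_neg_iff.2 ?_
        rw [hcross, neg_lt_zero]
        exact mul_pos hε h⟩

theorem hasJump_edgeArg_of_mem_Ioo {a b d : ℂ} {s : ℝ} (hs : s ∈ Ioo (0 : ℝ) 1)
    (hd : cross d (b - a) ≠ 0) :
    HasJump (edgeArg a b) (a + s * (b - a)) d
      (-(2 * Real.pi * SignType.sign (cross d (b - a)))) := by
  have hd' : cross (-d) (b - a) ≠ 0 := by rwa [cross_neg_left, neg_ne_zero]
  convert hasJump_of_tendsto (tendsto_edgeArg_of_mem_Ioo hs hd)
    (tendsto_edgeArg_of_mem_Ioo hs hd') using 1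
  rw [cross_neg_left, Left.sign_neg]
  push_cast; ring

/-! ### What a visible point can hide behind -/

section Crossing

variable {n : ℕ} {v : ZMod n → ℂ} {q y : ℂ} {c s : ℝ} {k : ZMod n}

theorem IsSimplePolygon.notMem_segment (hv : IsSimplePolygon v) (hs : s ∈ Ico (0 : ℝ) 1)
    {l : ZMod n} (hl : l ≠ k) (hl' : s = 0 → l ≠ k - 1) :
    v k + s * (v (k + 1) - v k) ∉ segment ℝ (v l) (v (l + 1)) := by
  intro hmem
  obtain ⟨t, ht, heq⟩ := mem_segment_iff_exists.1 hmem
  rcases ht.2.lt_or_eq with ht1 | rfl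
  · exact hl (hv.2 l k t ⟨ht.1, ht1⟩ s hs (by rw [lineMap_eq_add_mul, lineMap_eq_add_mul, heq])).1
  · obtain ⟨hlk, hs0⟩ := hv.2 (l + 1) k 0 (by simp) s hs
      (by rw [lineMap_eq_add_mul, lineMap_eq_add_mul, heq]; simp)
    exact hl' hs0.symm (eq_sub_of_add_eq hlk)

variable [NeZero n]

theorem eventually_sum_edgeArg_eq {d : ℂ} (hq : ∀ k : ZMod n, cross (v k - q) (v (k + 1) - q) ≠ 0)
    (hd : ∀ᶠ ε : ℝ in 𝓝[>] 0, q + c * d + ε * d ∈ region v) :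
    ∀ᶠ ε : ℝ in 𝓝[>] 0,
      ∑ l : ZMod n, edgeArg (v l) (v (l + 1)) (q + c * d + ε * d) = 2 * Real.pi := by
  filter_upwards [hd, eventually_all.2 fun l => eventually_notMem_segment (c := c) (d := d) (hq l)]
    with ε hreg hoff
  have hin := (hreg.resolve_left (by simpa [boundary] using hoff)).2
  rwa [windingNumber, div_eq_one_iff_eq (by positivity)] at hin

theorem Visible.hasJump_sum_edgeArg (hq : ∀ k : ZMod n, cross (v k - q) (v (k + 1) - q) ≠ 0)
    (hy : Visible v q y) (hc : c ∈ Ioo (0 : ℝ) 1) :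
    HasJump (fun z => ∑ l : ZMod n, edgeArg (v l) (v (l + 1)) z) (q + c * (y - q)) (y - q) 0 := by
  have hsmall : ∀ᶠ ε : ℝ in 𝓝[>] 0, ε < min c (1 - c) :=
    nhdsWithin_le_nhds (eventually_lt_nhds (lt_min hc.1 (by linarith [hc.2])))
  rw [visible_iff] at hy
  have hpos := eventually_sum_edgeArg_eq (c := c) (d := y - q) hq (by
    filter_upwards [hsmall, self_mem_nhdsWithin] with ε hε (h0 : 0 < ε)
    convert hy (c + ε) ⟨by linarith [hc.1], by linarith [min_le_right c (1 - c)]⟩ using 1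
    push_cast; ring)
  have hneg := eventually_sum_edgeArg_eq (c := -c) (d := -(y - q)) hq (by
    filter_upwards [hsmall, self_mem_nhdsWithin] with ε hε (h0 : 0 < ε)
    convert hy (c - ε) ⟨by linarith [min_le_left c (1 - c)], by linarith [hc.2]⟩ using 1
    push_cast; ring)
  refine tendsto_const_nhds.congr' ?_
  filter_upwards [hpos, hneg] with ε h₁ h₂
  rw [ofReal_neg, neg_mul_neg] at h₂
  rw [h₁, h₂, sub_self]

theorem sum_jump_edgeArg_eq_zero (hq : ∀ k : ZMod n, cross (v k - q) (v (k + 1) - q) ≠ 0)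
    (hy : Visible v q y) (hc : c ∈ Ioo (0 : ℝ) 1) {J : ZMod n → ℝ}
    (hJ : ∀ l, HasJump (edgeArg (v l) (v (l + 1))) (q + c * (y - q)) (y - q) (J l)) :
    ∑ l, J l = 0 :=
  tendsto_nhds_unique (HasJump.sum fun l _ => hJ l) (hy.hasJump_sum_edgeArg hq hc)

theorem mul_neg_of_sign_add_sign_eq_zero {x y : ℝ} (hx : x ≠ 0)
    (h : (SignType.sign x : ℝ) + SignType.sign y = 0) : x * y < 0 := by
  rcases hx.lt_or_gt with hx | hx <;> rcases lt_trichotomy y 0 with hy | rfl | hy <;>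
    simp_all [sign_neg, sign_pos, mul_neg_of_neg_of_pos, mul_neg_of_pos_of_neg]

theorem Visible.eq_zero_of_edge_eq (hv : IsSimplePolygon v)
    (hq : ∀ k : ZMod n, cross (v k - q) (v (k + 1) - q) ≠ 0) (hy : Visible v q y)
    (hc : c ∈ Ioo (0 : ℝ) 1) (hs : s ∈ Ico (0 : ℝ) 1)
    (hx : v k + s * (v (k + 1) - v k) = q + c * (y - q)) : s = 0 := by
  by_contra hs0
  have hsum := sum_jump_edgeArg_eq_zero hq hy hc
    (J := Pi.single k (-(2 * Real.pi * SignType.sign (cross (v k - q) (v (k + 1) - q))))) (by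
    intro l
    rcases eq_or_ne l k with rfl | hl
    · obtain ⟨hne, hsign⟩ := sign_cross_sub_eq_of_mem hc.1 (hq l) hx
      simpa [hx, hsign] using hasJump_edgeArg_of_mem_Ioo ⟨hs.1.lt_of_ne' hs0, hs.2⟩ hne
    · have hoff := hv.notMem_segment hs hl fun h => absurd h hs0
      simpa [hl] using hasJump_zero_of_continuousAt (continuousAt_edgeArg (hx ▸ hoff)) _)
  simp only [Finset.sum_pi_single', Finset.mem_univ, if_true] at hsum
  have hneg := mul_neg_of_sign_add_sign_eq_zero (hq k) (y := cross (v k - q) (v (k + 1) - q))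
    ((mul_eq_zero.1 (by linear_combination -hsum)).resolve_left Real.pi_ne_zero)
  exact (mul_self_nonneg _).not_gt hneg

theorem Visible.cross_mul_cross_neg (hv : IsSimplePolygon v)
    (hq : ∀ k : ZMod n, cross (v k - q) (v (k + 1) - q) ≠ 0) (hy : Visible v q y)
    (hc : c ∈ Ioo (0 : ℝ) 1) (hx : v k = q + c * (y - q)) :
    cross (v (k - 1) - q) (v k - q) * cross (v k - q) (v (k + 1) - q) < 0 := by
  have hn : Fact (1 < n) := ⟨by linarith [hv.1]⟩
  have hkk : k ≠ k - 1 := fun h => one_ne_zero (sub_eq_self.1 h.symm)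
  obtain ⟨hne, hsign⟩ := sign_cross_sub_eq_of_mem (s := 0) hc.1 (hq k) (by simpa using hx)
  obtain ⟨hne', hsign'⟩ :=
    sign_cross_sub_eq_of_mem (s := 1) hc.1 (hq (k - 1)) (by simpa using hx)
  have hsum := sum_jump_edgeArg_eq_zero hq hy hc
    (J := Pi.single k (-(Real.pi * SignType.sign (cross (v k - q) (v (k + 1) - q)))) +
      Pi.single (k - 1)
        (-(Real.pi * SignType.sign (cross (v (k - 1) - q) (v (k - 1 + 1) - q))))) (by
    intro l
    rw [← hx]
    rcases eq_or_ne l k with rfl | hl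
    · simpa [hkk, hsign] using hasJump_edgeArg_left hne
    rcases eq_or_ne l (k - 1) with rfl | hl'
    · rw [← hsign']
      simpa [hl] using hasJump_edgeArg_right hne'
    · have hoff := hv.notMem_segment (s := 0) (by simp) hl fun _ => hl'
      simpa [hl, hl'] using
        hasJump_zero_of_continuousAt (continuousAt_edgeArg (by simpa using hoff)) (y - q))
  simp only [Pi.add_apply, Finset.sum_add_distrib, Finset.sum_pi_single', Finset.mem_univ,
    if_true, sub_add_cancel] at hsum
  have hprev := hq (k - 1)
  rw [sub_add_cancel] at hprev
  exact mul_neg_of_sign_add_sign_eq_zero hprev <|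
    (mul_eq_zero.1 (by linear_combination -hsum)).resolve_left Real.pi_ne_zero

end Crossing

/-! ### The boundary as a periodic curve, in polar coordinates -/

section Boundary

variable {n : ℕ}

/-- The periodic extension of `curve` to all real parameters. It makes the whole boundary a single
curve on the line, on which the angle seen from `q` lifts to a real function. -/
noncomputable def loop (v : ZMod n → ℂ) (i : ZMod n) (t : ℝ) : ℂ :=
  v (i + (⌊t⌋ : ℤ)) + Int.fract t * (v (i + (⌊t⌋ : ℤ) + 1) - v (i + (⌊t⌋ : ℤ)))

theorem loop_of_mem (v : ZMod n → ℂ) (i : ZMod n) {k : ℤ} {t : ℝ} (ht : t ∈ Icc (k : ℝ) (k + 1)) :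
    loop v i t = v (i + k) + (t - k : ℝ) * (v (i + k + 1) - v (i + k)) := by
  rcases ht.2.lt_or_eq with h | rfl
  · rw [loop, Int.fract, Int.floor_eq_iff.2 ⟨ht.1, h⟩]
  · have hfloor : ⌊(k : ℝ) + 1⌋ = k + 1 := by simp
    rw [loop, Int.fract, hfloor]; push_cast; simp [add_assoc]

theorem loop_int (v : ZMod n → ℂ) (i : ZMod n) (k : ℤ) : loop v i k = v (i + k) := by
  simp [loop]

theorem curve_eq_loop (v : ZMod n → ℂ) (i : ZMod n) {t : ℝ} (ht : 0 ≤ t) :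
    curve v i t = loop v i t := by
  have hfloor := Int.natCast_floor_eq_floor ht
  have hz : ((⌊t⌋₊ : ℕ) : ZMod n) = ((⌊t⌋ : ℤ) : ZMod n) := by rw [← hfloor, Int.cast_natCast]
  have hr : ((⌊t⌋₊ : ℕ) : ℝ) = ((⌊t⌋ : ℤ) : ℝ) := by rw [← hfloor, Int.cast_natCast]
  rw [curve, lineMap_eq_add_mul, loop, hz, hr, Int.fract]

theorem locallyFinite_Icc_intCast : LocallyFinite fun k : ℤ => Icc (k : ℝ) (k + 1) := by
  refine fun t => ⟨Ioo (t - 1) (t + 1), Ioo_mem_nhds (by linarith) (by linarith),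
    (finite_Icc (⌊t⌋ - 2) (⌈t⌉ + 2)).subset ?_⟩
  rintro k ⟨s, hs, hs'⟩
  have hlow : ((⌊t⌋ - 2 : ℤ) : ℝ) ≤ k := by
    push_cast; linarith [Int.floor_le t, hs.2, hs'.1]
  have hup : (k : ℝ) ≤ ((⌈t⌉ + 2 : ℤ) : ℝ) := by
    push_cast; linarith [Int.le_ceil t, hs.1, hs'.2]
  exact ⟨Int.cast_le.1 hlow, Int.cast_le.1 hup⟩

theorem continuous_loop (v : ZMod n → ℂ) (i : ZMod n) : Continuous (loop v i) :=
  locallyFinite_Icc_intCast.continuous (iUnion_Icc_intCast ℝ) (fun _ => isClosed_Icc) fun k =>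
    ContinuousOn.congr
      (f := fun t : ℝ => v (i + k) + (t - k : ℝ) * (v (i + k + 1) - v (i + k)))
      (by fun_prop) fun _ ht => loop_of_mem v i ht

theorem loop_mem_segment (v : ZMod n → ℂ) (i : ZMod n) {k : ℤ} {t : ℝ}
    (ht : t ∈ Icc (k : ℝ) (k + 1)) : loop v i t ∈ segment ℝ (v (i + k)) (v (i + k + 1)) :=
  mem_segment_iff_exists.2
    ⟨t - k, ⟨by linarith [ht.1], by linarith [ht.2]⟩, loop_of_mem v i ht⟩

theorem loop_mem_boundary (v : ZMod n → ℂ) (i : ZMod n) (t : ℝ) : loop v i t ∈ boundary v :=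
  mem_iUnion.2 ⟨_, loop_mem_segment v i ⟨Int.floor_le t, (Int.lt_floor_add_one t).le⟩⟩

theorem exists_loop_eq_of_mem_boundary {v : ZMod n → ℂ} (i : ZMod n) {z : ℂ}
    (hz : z ∈ boundary v) : ∃ t : ℝ, loop v i t = z := by
  obtain ⟨k, hk⟩ := mem_iUnion.1 hz
  obtain ⟨s, hs, rfl⟩ := mem_segment_iff_exists.1 hk
  obtain ⟨j, hj⟩ := ZMod.intCast_surjective (k - i)
  refine ⟨j + s, ?_⟩
  rw [loop_of_mem v i (k := j) ⟨by linarith [hs.1], by linarith [hs.2]⟩, hj]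
  simp

theorem loop_add_int_mul (v : ZMod n → ℂ) (i : ZMod n) (t : ℝ) (j : ℤ) :
    loop v i (t + j * n) = loop v i t := by
  have hshift : t + j * n = t + ((j * n : ℤ) : ℝ) := by push_cast; ring
  rw [hshift, loop, loop, Int.floor_add_intCast, Int.fract_add_intCast]
  simp

theorem exists_int_of_loop_eq {v : ZMod n → ℂ} (hs : IsSimplePolygon v) (i : ZMod n)
    {s t : ℝ} (h : loop v i s = loop v i t) : ∃ j : ℤ, t = s + j * n := by
  obtain ⟨hfloor, hfract⟩ := hs.2 (i + (⌊s⌋ : ℤ)) (i + (⌊t⌋ : ℤ))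
    (Int.fract s) ⟨Int.fract_nonneg _, Int.fract_lt_one _⟩
    (Int.fract t) ⟨Int.fract_nonneg _, Int.fract_lt_one _⟩
    (by rw [lineMap_eq_add_mul, lineMap_eq_add_mul]; exact h)
  obtain ⟨j, hj⟩ := (ZMod.intCast_eq_intCast_iff_dvd_sub _ _ _).1 (add_left_cancel hfloor)
  have hj' : (⌊t⌋ : ℝ) - ⌊s⌋ = n * j := by exact_mod_cast hj
  refine ⟨j, ?_⟩
  rw [← Int.floor_add_fract s, ← Int.floor_add_fract t, hfract]
  linear_combination hj'

/-- `cross` of the `k`-th edge of the boundary, counted from `v i`: its sign tells whether the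
angle seen from `q` increases along the edge. -/
noncomputable def edgeCross (v : ZMod n → ℂ) (q : ℂ) (i : ZMod n) (k : ℤ) : ℝ :=
  cross (v (i + k) - q) (v (i + k + 1) - q)

theorem edgeCross_sub_one (v : ZMod n → ℂ) (q : ℂ) (i : ZMod n) (k : ℤ) :
    edgeCross v q i (k - 1) = cross (v (i + k - 1) - q) (v (i + k) - q) := by
  rw [edgeCross, Int.cast_sub, Int.cast_one, ← add_sub_assoc, sub_add_cancel]

theorem cross_loop {v : ZMod n → ℂ} {q : ℂ} {i : ZMod n} {k : ℤ} {s t : ℝ}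
    (hs : s ∈ Icc (k : ℝ) (k + 1)) (ht : t ∈ Icc (k : ℝ) (k + 1)) :
    cross (loop v i s - q) (loop v i t - q) = (t - s) * edgeCross v q i k := by
  rw [loop_of_mem v i hs, loop_of_mem v i ht]
  simp [edgeCross, cross]; ring

theorem exists_first_boundary_point [NeZero n] {v : ZMod n → ℂ} {q x : ℂ} (hq : q ∈ inside v)
    (hx : x ∈ boundary v) :
    ∃ r ∈ Ioc (0 : ℝ) 1, q + r * (x - q) ∈ boundary v ∧ Visible v q (q + r * (x - q)) ∧
      ∀ u ∈ Icc (0 : ℝ) 1, q + u * (x - q) ∈ boundary v → r ≤ u := by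
  have hcomp : IsCompact {r : ℝ | r ∈ Icc (0 : ℝ) 1 ∧ q + r * (x - q) ∈ boundary v} :=
    isCompact_Icc.inter_right <|
      (isCompact_boundary v).isClosed.preimage (f := fun r : ℝ => q + r * (x - q)) (by fun_prop)
  obtain ⟨r, ⟨hr, hrb⟩, hmin⟩ := hcomp.exists_isLeast ⟨1, by simp, by simpa using hx⟩
  have hr0 : r ≠ 0 := by
    rintro rfl
    exact hq.1 (by simpa using hrb)
  refine ⟨r, ⟨hr.1.lt_of_ne' hr0, hr.2⟩, hrb, visible_of_forall_notMem_boundary hq hrb ?_,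
    fun u hu hub => hmin ⟨hu, hub⟩⟩
  intro u hu hub
  have hur : r ≤ u * r := by
    refine hmin ⟨⟨mul_nonneg hu.1 hr.1, mul_le_one₀ hu.2.le hr.1 hr.2⟩, ?_⟩
    convert hub using 1; push_cast; ring
  exact absurd hu.2 (not_lt.2 (one_le_of_le_mul_right₀ (hr.1.lt_of_ne' hr0) hur))

/-- Polar coordinates `(exp ρ, θ)` about `q` of the boundary of a simple polygon around `q`, none of
whose edges points to `q`. All angular arguments are carried out on the real functions `θ`, `ρ`. -/
structure PolarView [NeZero n] (v : ZMod n → ℂ) (q : ℂ) (i : ZMod n) (θ ρ : ℝ → ℝ) : Prop where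
  simple : IsSimplePolygon v
  inside : q ∈ inside v
  transversal : ∀ k : ZMod n, cross (v k - q) (v (k + 1) - q) ≠ 0
  cont_angle : Continuous θ
  cont_radius : Continuous ρ
  loop_sub : ∀ t, loop v i t - q = exp (ρ t + θ t * I)

variable [NeZero n] {v : ZMod n → ℂ} {q : ℂ} {i : ZMod n} {θ ρ : ℝ → ℝ}

theorem exists_polarView (i : ZMod n) (hs : IsSimplePolygon v) (hq : q ∈ inside v)
    (hw : ∀ k : ZMod n, cross (v k - q) (v (k + 1) - q) ≠ 0) :
    ∃ θ ρ : ℝ → ℝ, PolarView v q i θ ρ := by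
  have hne (t : ℝ) : loop v i t - q ≠ 0 :=
    sub_ne_zero.2 fun h => hq.1 (h ▸ loop_mem_boundary v i t)
  obtain ⟨f, ⟨-, hf⟩, -⟩ := isCoveringMapOn_exp.existsUnique_continuousMap_lifts
    ⟨fun t => loop v i t - q, (continuous_loop v i).sub continuous_const⟩ (exp_log (hne 0)) hne
  refine ⟨fun t => (f t).im, fun t => (f t).re, hs, hq, hw, by fun_prop, by fun_prop, fun t => ?_⟩
  rw [re_add_im]
  exact (congrFun hf t).symm

namespace PolarView

theorem loop_ne (h : PolarView v q i θ ρ) (t : ℝ) : loop v i t - q ≠ 0 := by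
  rw [h.loop_sub]; exact exp_ne_zero _

theorem edgeCross_ne (h : PolarView v q i θ ρ) (k : ℤ) : edgeCross v q i k ≠ 0 :=
  h.transversal _

theorem loop_eq_of_angle_eq (h : PolarView v q i θ ρ) {s t : ℝ} {j : ℤ}
    (hst : θ s = θ t + j * (2 * Real.pi)) :
    loop v i s = q + Real.exp (ρ s - ρ t) * (loop v i t - q) := by
  rw [← sub_eq_iff_eq_add', h.loop_sub, h.loop_sub, ofReal_exp, ← exp_add]
  refine exp_eq_exp_iff_exists_int.2 ⟨j, ?_⟩
  rw [hst]; push_cast; ring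

theorem polar_eq_of_loop_eq (h : PolarView v q i θ ρ) {s t c : ℝ} (hc : 0 < c)
    (hst : loop v i s = q + c * (loop v i t - q)) :
    ρ s = Real.log c + ρ t ∧ ∃ j : ℤ, θ s = θ t + j * (2 * Real.pi) := by
  have hexp : loop v i s - q = c * (loop v i t - q) := by rw [hst]; ring
  have hlog : exp (Real.log c : ℂ) = c := by rw [← ofReal_exp, Real.exp_log hc]
  rw [h.loop_sub, h.loop_sub, ← hlog, ← exp_add] at hexp
  obtain ⟨j, hj⟩ := exp_eq_exp_iff_exists_int.1 hexp
  exact ⟨by simpa using congrArg Complex.re hj, j, by simpa using congrArg Complex.im hj⟩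

theorem notMem_segment (h : PolarView v q i θ ρ) {k : ℤ} {s t : ℝ}
    (hs : s ∈ Icc (k : ℝ) (k + 1)) (ht : t ∈ Icc (k : ℝ) (k + 1)) :
    q ∉ segment ℝ (loop v i s) (loop v i t) := fun hmem =>
  h.inside.1 <| mem_iUnion.2 ⟨_, (convex_segment _ _).segment_subset (loop_mem_segment v i hs)
    (loop_mem_segment v i ht) hmem⟩

theorem angle_sub (h : PolarView v q i θ ρ) {k : ℤ} {s t : ℝ}
    (hs : s ∈ Icc (k : ℝ) (k + 1)) (ht : t ∈ Icc (k : ℝ) (k + 1)) :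
    θ t - θ s = edgeArg (loop v i s) (loop v i t) q := by
  have hangle := h.cont_angle
  have hradius := h.cont_radius
  have hloop := continuous_loop v i
  have hlift := isCoveringMap_exp.eqOn_of_comp_eqOn (s := Icc (k : ℝ) (k + 1)) isPreconnected_Icc
    (g₁ := fun t : ℝ => (ρ t + θ t * I) - (ρ s + θ s * I))
    (g₂ := fun t : ℝ => log ((loop v i t - q) / (loop v i s - q)))
    (by fun_prop)
    (fun x hx => (((hloop.sub continuous_const).div_const _).continuousAt.clog
      (div_mem_slitPlane_of_notMem_segment (h.notMem_segment hs hx))).continuousWithinAt)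
    (fun x _ => Subtype.ext (by
      simp only [Function.comp_apply]
      rw [exp_sub, ← h.loop_sub, ← h.loop_sub, exp_log (div_ne_zero (h.loop_ne _) (h.loop_ne _))]))
    hs (by simp [div_self (h.loop_ne s)]) ht
  simpa [log_im, edgeArg] using congrArg Complex.im hlift

theorem strictMonoOn_angle (h : PolarView v q i θ ρ) {k : ℤ} (hk : 0 < edgeCross v q i k) :
    StrictMonoOn θ (Icc (k : ℝ) (k + 1)) := by
  intro s hs t ht hst
  have him : 0 < ((loop v i t - q) / (loop v i s - q)).im := by
    rw [im_div_pos_iff, cross_loop hs ht]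
    exact mul_pos (sub_pos.2 hst) hk
  rw [← sub_pos, h.angle_sub hs ht, edgeArg]
  exact (arg_nonneg_iff.2 him.le).lt_of_ne' fun h0 => him.ne' (arg_eq_zero_iff.1 h0).2

theorem strictAntiOn_angle (h : PolarView v q i θ ρ) {k : ℤ} (hk : edgeCross v q i k < 0) :
    StrictAntiOn θ (Icc (k : ℝ) (k + 1)) := by
  intro s hs t ht hst
  rw [← sub_neg, h.angle_sub hs ht, edgeArg, arg_neg_iff, im_div_neg_iff, cross_loop hs ht]
  exact mul_neg_of_pos_of_neg (sub_pos.2 hst) hk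

theorem strictMonoOn_angle_left (h : PolarView v q i θ ρ) {k : ℤ}
    (hk : 0 < edgeCross v q i (k - 1)) : StrictMonoOn θ (Icc (k - 1) k) := by
  simpa using h.strictMonoOn_angle hk

theorem strictAntiOn_angle_left (h : PolarView v q i θ ρ) {k : ℤ}
    (hk : edgeCross v q i (k - 1) < 0) : StrictAntiOn θ (Icc (k - 1) k) := by
  simpa using h.strictAntiOn_angle hk

theorem angle_natCast_sub (h : PolarView v q i θ ρ) (j : ℕ) :
    θ j - θ 0 = ∑ l ∈ Finset.range j, edgeArg (v (i + l)) (v (i + l + 1)) q := by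
  induction j with
  | zero => simp
  | succ j ih =>
    have hedge := h.angle_sub (k := j) (s := j) (t := j + 1) (by simp) (by simp)
    have hleft : loop v i j = v (i + j) := by simpa using loop_int v i j
    have hright : loop v i (j + 1) = v (i + j + 1) := by
      simpa [add_assoc] using loop_int v i (j + 1)
    rw [hleft, hright] at hedge
    rw [Finset.sum_range_succ, ← ih, ← hedge]
    push_cast; ring

theorem angle_natCast_sub_eq_two_pi (h : PolarView v q i θ ρ) : θ n - θ 0 = 2 * Real.pi := by
  have hwind := h.inside.2
  rw [windingNumber, div_eq_one_iff_eq (by positivity)] at hwind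
  rw [h.angle_natCast_sub, ← hwind, ← Equiv.sum_comp (Equiv.addLeft i)]
  refine Finset.sum_bij' (fun (l : ℕ) _ => (l : ZMod n)) (fun x _ => x.val) (by simp)
    (fun x _ => by simpa using ZMod.val_lt x)
    (fun l hl => ZMod.val_cast_of_lt (by simpa using hl)) (by simp) (fun l _ => rfl)

theorem polar_add_period (h : PolarView v q i θ ρ) (t : ℝ) :
    ρ (t + n) = ρ t ∧ ∃ j : ℤ, θ (t + n) = θ t + j * (2 * Real.pi) := by
  have hloop : loop v i (t + n) = q + (1 : ℝ) * (loop v i t - q) := by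
    simpa using loop_add_int_mul v i t 1
  simpa using h.polar_eq_of_loop_eq one_pos hloop

theorem angle_add_period (h : PolarView v q i θ ρ) (t : ℝ) : θ (t + n) = θ t + 2 * Real.pi := by
  have hangle := h.cont_angle
  have hpi := Real.two_pi_pos.ne'
  have hconst := eq_of_continuousOn_of_mem_range_intCast isPreconnected_univ
    (f := fun t => (θ (t + n) - θ t) / (2 * Real.pi)) (by fun_prop)
    (fun x _ => by
      obtain ⟨j, hj⟩ := (h.polar_add_period x).2
      exact ⟨j, by simp [hj, hpi]⟩) (mem_univ t) (mem_univ 0)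
  simp only [zero_add, h.angle_natCast_sub_eq_two_pi, div_self hpi] at hconst
  linarith [(div_eq_one_iff_eq hpi).1 hconst]

theorem radius_add_int_mul (h : PolarView v q i θ ρ) (t : ℝ) (j : ℤ) : ρ (t + j * n) = ρ t :=
  Function.Periodic.int_mul (fun t => (h.polar_add_period t).1) j t

theorem periodic_angle_sub (h : PolarView v q i θ ρ) :
    Function.Periodic (fun t => θ t - t * (2 * Real.pi / n)) n := by
  intro t
  simp only [h.angle_add_period]
  have hn : (n : ℝ) ≠ 0 := NeZero.ne _
  field_simp; ring

theorem angle_add_int_mul (h : PolarView v q i θ ρ) (t : ℝ) (j : ℤ) :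
    θ (t + j * n) = θ t + j * (2 * Real.pi) := by
  have hn : (n : ℝ) ≠ 0 := NeZero.ne _
  have hj := h.periodic_angle_sub.int_mul j t
  field_simp at hj
  exact mul_left_cancel₀ hn (by linear_combination hj)

theorem eq_of_polar_eq (h : PolarView v q i θ ρ) {s t : ℝ} (hθ : θ s = θ t) (hρ : ρ s = ρ t) :
    s = t := by
  obtain ⟨j, rfl⟩ := exists_int_of_loop_eq h.simple i (s := s) (t := t) (by
    simpa [hρ] using h.loop_eq_of_angle_eq (s := s) (t := t) (j := 0) (by simp [hθ]))
  have hj : (j : ℝ) = 0 := by simpa [h.angle_add_int_mul, Real.pi_ne_zero] using hθ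
  rw [hj, zero_mul, add_zero]

theorem surjective_angle (h : PolarView v q i θ ρ) : Function.Surjective θ := by
  intro φ
  obtain ⟨j, ⟨hj, hj'⟩, -⟩ := existsUnique_add_zsmul_mem_Ico Real.two_pi_pos (θ 0) φ
  rw [zsmul_eq_mul] at hj hj'
  refine mem_range_of_exists_le_of_exists_ge h.cont_angle ⟨0 + (j - 1 : ℤ) * n, ?_⟩
    ⟨0 + j * n, hj.trans (h.angle_add_int_mul 0 j).ge⟩
  rw [h.angle_add_int_mul]
  push_cast; linarith

theorem exists_firstHit (h : PolarView v q i θ ρ) (φ : ℝ) :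
    ∃ s, Visible v q (loop v i s) ∧ θ s = φ ∧ ∀ t, θ t = φ → ρ s ≤ ρ t := by
  obtain ⟨t₀, rfl⟩ := h.surjective_angle φ
  obtain ⟨r, hr, hrb, hvis, hmin⟩ :=
    exists_first_boundary_point h.inside (loop_mem_boundary v i t₀)
  obtain ⟨s, hs⟩ := exists_loop_eq_of_mem_boundary i hrb
  obtain ⟨hρ, j, hj⟩ := h.polar_eq_of_loop_eq hr.1 hs
  refine ⟨s + (-j : ℤ) * n, ?_, ?_, fun t ht => ?_⟩
  · rwa [loop_add_int_mul, hs]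
  · rw [h.angle_add_int_mul, hj]; push_cast; ring
  · rw [h.radius_add_int_mul, hρ]
    by_contra! hlt
    have hexp : Real.exp (ρ t - ρ t₀) < r := by
      rw [← Real.lt_log_iff_exp_lt hr.1]; linarith
    refine (hmin _ ⟨(Real.exp_pos _).le, hexp.le.trans hr.2⟩ ?_).not_gt hexp
    rw [← h.loop_eq_of_angle_eq (j := 0) (by simp [ht])]
    exact loop_mem_boundary v i t

theorem visible_of_angle_eq (h : PolarView v q i θ ρ) {s t : ℝ} (hs : Visible v q (loop v i s))
    {j : ℤ} (hθ : θ t = θ s + j * (2 * Real.pi)) (hρ : ρ t ≤ ρ s) : Visible v q (loop v i t) :=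
  hs.of_mem_segment <| mem_segment_iff_exists.2 ⟨Real.exp (ρ t - ρ s),
    ⟨(Real.exp_pos _).le, Real.exp_le_one_iff.2 (sub_nonpos.2 hρ)⟩, h.loop_eq_of_angle_eq hθ⟩

theorem exists_vertex_of_visible (h : PolarView v q i θ ρ) {s t : ℝ}
    (hs : Visible v q (loop v i s)) (hθ : θ t = θ s) (hρ : ρ t < ρ s) :
    ∃ k : ℤ, t = k ∧ edgeCross v q i (k - 1) * edgeCross v q i k < 0 := by
  have hc : Real.exp (ρ t - ρ s) ∈ Ioo (0 : ℝ) 1 :=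
    ⟨Real.exp_pos _, Real.exp_lt_one_iff.2 (sub_neg.2 hρ)⟩
  have hloop := h.loop_eq_of_angle_eq (j := 0) (s := t) (t := s) (by simp [hθ])
  have hfract : Int.fract t = 0 := hs.eq_zero_of_edge_eq h.simple h.transversal hc
    ⟨Int.fract_nonneg t, Int.fract_lt_one t⟩ hloop
  obtain ⟨k, rfl⟩ := Int.fract_eq_zero_iff.1 hfract
  refine ⟨k, rfl, edgeCross_sub_one v q i k ▸ ?_⟩
  exact hs.cross_mul_cross_neg h.simple h.transversal hc (loop_int v i k ▸ hloop)

end PolarView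

end Boundary

/-! ### Chords of a curve that advances in angle -/

theorem mul_nonneg_of_touching {X : Type*} [TopologicalSpace X] {S : Set X} {g : X → ℝ} {c : ℝ}
    (hS : IsPreconnected S) (hSo : IsOpen S) (hg : ContinuousOn g S)
    (hside : ∀ x ∈ S, g x = c → (∀ᶠ y in 𝓝 x, c ≤ g y) ∨ (∀ᶠ y in 𝓝 x, g y ≤ c))
    (hne : ∀ x ∈ S, ∃ᶠ y in 𝓝 x, g y ≠ c) {x₀ x₁ : X} (hx₀ : x₀ ∈ S) (hx₁ : x₁ ∈ S) :
    0 ≤ (g x₀ - c) * (g x₁ - c) := by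
  set L := {x | ∀ᶠ y in 𝓝 x, g y ≤ c}
  set U := {x | ∀ᶠ y in 𝓝 x, c ≤ g y}
  have hlt : ∀ x ∈ S, g x < c → x ∈ L := fun x hx h =>
    ((hg.continuousAt (hSo.mem_nhds hx)).eventually_lt_const h).mono fun _ => le_of_lt
  have hgt : ∀ x ∈ S, c < g x → x ∈ U := fun x hx h =>
    ((hg.continuousAt (hSo.mem_nhds hx)).eventually_const_lt h).mono fun _ => le_of_lt
  have hcover : S ⊆ L ∪ U := fun x hx => by
    rcases lt_trichotomy (g x) c with h | h | h
    exacts [Or.inl (hlt x hx h), (hside x hx h).symm, Or.inr (hgt x hx h)]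
  have hdisj : ¬(S ∩ (L ∩ U)).Nonempty := fun ⟨x, hx, hxL, hxU⟩ =>
    hne x hx <| by filter_upwards [hxL, hxU] with y h₁ h₂ using not_not.2 (le_antisymm h₁ h₂)
  have hmeet := hS L U isOpen_setOfPred_eventually_nhds isOpen_setOfPred_eventually_nhds hcover
  by_contra! hneg
  rcases mul_neg_iff.1 hneg with ⟨h₀, h₁⟩ | ⟨h₀, h₁⟩
  · exact hdisj (hmeet ⟨x₁, hx₁, hlt x₁ hx₁ (sub_neg.1 h₁)⟩ ⟨x₀, hx₀, hgt x₀ hx₀ (sub_pos.1 h₀)⟩)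
  · exact hdisj (hmeet ⟨x₀, hx₀, hlt x₀ hx₀ (sub_neg.1 h₀)⟩ ⟨x₁, hx₁, hgt x₁ hx₁ (sub_pos.1 h₁)⟩)

theorem exists_continuousOn_arg_of_re_pos {E : Type*} [NormedAddCommGroup E] [NormedSpace ℝ E]
    {U F : Set E} (hU : Convex ℝ U) (hUo : IsOpen U) (hFU : F ⊆ U) (hF : IsPreconnected F)
    (hFne : F.Nonempty) {g : E → ℂ} (hg : ContinuousOn g U) (hg0 : ∀ p ∈ U, g p ≠ 0)
    (hpos : ∀ p ∈ F, 0 < (g p).re) :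
    ∃ α : E → ℝ, ContinuousOn α U ∧ (∀ p ∈ U, g p = ‖g p‖ * exp (α p * I)) ∧
      ∀ p ∈ F, |α p| < Real.pi / 2 := by
  have hcontr := hU.contractibleSpace (hFne.mono hFU)
  obtain ⟨f, hf, hfg⟩ := exists_continuousOn_eqOn_exp_comp
    (SimplyConnectedSpace.ofContractible U) hUo hg (fun ⟨p, hp, h0⟩ => hg0 p hp h0)
  have hint : ∀ p ∈ U, ∃ k : ℤ, (f p).im = arg (g p) + k * (2 * Real.pi) := by
    intro p hp
    obtain ⟨k, hk⟩ := exp_eq_exp_iff_exists_int.1 ((hfg hp).trans (exp_log (hg0 p hp)).symm)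
    exact ⟨k, by simpa [log_im] using congrArg Complex.im hk⟩
  obtain ⟨p₀, hp₀⟩ := hFne
  obtain ⟨k, hk⟩ := hint p₀ (hFU hp₀)
  have hF_arg : ∀ p ∈ F, (f p).im - k * (2 * Real.pi) = arg (g p) := by
    intro p hp
    have hcont : ContinuousOn (fun p => ((f p).im - arg (g p)) / (2 * Real.pi)) F := by
      refine ((continuous_im.comp_continuousOn (hf.mono hFU)).sub ?_).div_const _
      exact fun p hp => ((continuousAt_arg (Or.inl (hpos p hp))).comp
        (hg.continuousAt (hUo.mem_nhds (hFU hp)))).continuousWithinAt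
    have heq := eq_of_continuousOn_of_mem_range_intCast hF hcont (fun p hp => by
      obtain ⟨j, hj⟩ := hint p (hFU hp)
      exact ⟨j, by simp [hj, Real.pi_ne_zero]⟩) hp hp₀
    rw [hk, add_sub_cancel_left, mul_div_cancel_right₀ _ Real.two_pi_pos.ne',
      div_eq_iff Real.two_pi_pos.ne'] at heq
    linarith
  refine ⟨fun p => (f p).im - k * (2 * Real.pi),
    (continuous_im.comp_continuousOn hf).sub continuousOn_const, fun p hp => ?_, fun p hp => ?_⟩
  · have hexp : exp (f p) = g p := hfg hp
    have hper : exp (((f p).im - k * (2 * Real.pi) : ℝ) * I) = exp ((f p).im * I) :=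
      exp_eq_exp_iff_exists_int.2 ⟨-k, by push_cast; ring⟩
    rw [hper, ← hexp, norm_exp, ofReal_exp, ← exp_add, re_add_im]
  · simp only [hF_arg p hp]
    exact abs_arg_lt_pi_div_two_iff.2 (Or.inl (hpos p hp))

/-- A simple curve in the `(θ, ρ)`-plane whose coordinate `θ` has grown whenever enough time has
passed, such as the boundary of a polygon in polar coordinates about an inner point. -/
structure IsAdvancing (θ ρ : ℝ → ℝ) : Prop where
  cont_angle : Continuous θ
  cont_radius : Continuous ρ
  injective : ∀ s t, θ s = θ t → ρ s = ρ t → s = t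
  angle_lt_of_far : ∃ N > 0, ∀ u t : ℝ, N ≤ t - u → θ u < θ t

/-- The curve only touches, and never crosses, the vertical ray below its point at parameter `s`.
This is what visibility from `q` means in polar coordinates. -/
def Exposed (θ ρ : ℝ → ℝ) (s : ℝ) : Prop :=
  ∀ t, θ t = θ s → ρ t < ρ s →
    (∀ᶠ y in 𝓝[≠] t, θ s < θ y) ∨ (∀ᶠ y in 𝓝[≠] t, θ y < θ s)

/-- `α (u, t)` is a continuous choice of the direction of the chord from the point at parameter `u`
to that at a later parameter `t`, normalised to point to the right when `t` is far from `u`. -/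
structure IsChordAngle (θ ρ : ℝ → ℝ) (α : ℝ × ℝ → ℝ) : Prop where
  cont : ContinuousOn α {p | p.1 < p.2}
  chord : ∀ u t : ℝ, u < t → ∃ R > 0,
    θ t - θ u = R * Real.cos (α (u, t)) ∧ ρ t - ρ u = R * Real.sin (α (u, t))
  abs_lt_of_far : ∃ N > 0, ∀ u t : ℝ, N ≤ t - u → |α (u, t)| < Real.pi / 2

section Curve

variable {θ ρ : ℝ → ℝ} {s t u : ℝ} {α : ℝ × ℝ → ℝ}

theorem Exposed.reflect (hs : Exposed θ ρ s) :
    Exposed (fun t => -θ (-t)) (fun t => ρ (-t)) (-s) := by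
  intro t hθ hρ
  simp only [neg_neg, neg_inj, neg_lt_neg_iff] at hθ hρ ⊢
  have hneg : Tendsto Neg.neg (𝓝[≠] t) (𝓝[≠] (-t)) :=
    ((Homeomorph.neg ℝ).map_punctured_nhds_eq t).le
  exact (hs (-t) hθ hρ).symm.imp hneg.eventually hneg.eventually

theorem IsAdvancing.exists_isChordAngle (h : IsAdvancing θ ρ) : ∃ α, IsChordAngle θ ρ α := by
  obtain ⟨N, hN, hfar⟩ := h.angle_lt_of_far
  have hθ := h.cont_angle
  have hρ := h.cont_radius
  have hlin : IsLinearMap ℝ (fun p : ℝ × ℝ => p.2 - p.1) :=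
    (LinearMap.snd ℝ ℝ ℝ - LinearMap.fst ℝ ℝ ℝ).isLinear
  have hU : Convex ℝ {p : ℝ × ℝ | p.1 < p.2} := by simpa using convex_halfSpace_gt hlin 0
  set g : ℝ × ℝ → ℂ := fun p => ⟨θ p.2 - θ p.1, ρ p.2 - ρ p.1⟩
  have hg : Continuous g := equivRealProdCLM.symm.continuous.comp
    (by fun_prop : Continuous fun p : ℝ × ℝ => (θ p.2 - θ p.1, ρ p.2 - ρ p.1))
  have hg0 : ∀ p : ℝ × ℝ, p.1 < p.2 → g p ≠ 0 := fun p hp h0 =>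
    hp.ne' (h.injective _ _ (sub_eq_zero.1 (congrArg Complex.re h0))
      (sub_eq_zero.1 (congrArg Complex.im h0)))
  obtain ⟨α, hα, hpolar, hbound⟩ := exists_continuousOn_arg_of_re_pos
    (F := {p : ℝ × ℝ | N ≤ p.2 - p.1})
    hU (isOpen_lt continuous_fst continuous_snd) (fun p hp => sub_pos.1 (hN.trans_le hp))
    (convex_halfSpace_ge hlin N).isPreconnected ⟨(0, N), by simp⟩ hg.continuousOn hg0
    (fun p (hp : N ≤ p.2 - p.1) => sub_pos.2 (hfar _ _ hp))
  refine ⟨α, hα, fun u t hut => ?_, N, hN, fun u t hut => hbound (u, t) hut⟩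
  have hchord := hpolar (u, t) hut
  refine ⟨_, norm_pos_iff.2 (hg0 (u, t) hut), ?_, ?_⟩
  · simpa only [re_ofReal_mul, exp_ofReal_mul_I_re] using congrArg Complex.re hchord
  · simpa only [im_ofReal_mul, exp_ofReal_mul_I_im] using congrArg Complex.im hchord

theorem Exposed.mul_nonneg (hs : Exposed θ ρ s) {S : Set ℝ} (hS : IsPreconnected S)
    (hSo : IsOpen S) {g : ℝ → ℝ} {c : ℝ} (hg : ContinuousOn g S)
    (hchord : ∀ y ∈ S, ∃ R > 0, θ y - θ s = R * Real.sin (g y - c) ∧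
      ρ y - ρ s = -(R * Real.cos (g y - c))) {x₀ x₁ : ℝ} (hx₀ : x₀ ∈ S) (hx₁ : x₁ ∈ S) :
    0 ≤ (g x₀ - c) * (g x₁ - c) := by
  have hbelow : ∀ x ∈ S, g x = c → θ x = θ s ∧ ρ x < ρ s := by
    intro x hx hxc
    obtain ⟨R, hR, hθ, hρ⟩ := hchord x hx
    simp only [hxc, sub_self, Real.sin_zero, Real.cos_zero, mul_zero, mul_one] at hθ hρ
    constructor <;> linarith
  have hside : ∀ x ∈ S, g x = c → ∀ᶠ y in 𝓝 x,
      (θ s < θ y → c ≤ g y) ∧ (θ y < θ s → g y ≤ c) := by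
    intro x hx hxc
    have hnear := (hg.continuousAt (hSo.mem_nhds hx)).eventually
      (Metric.ball_mem_nhds _ Real.pi_pos)
    filter_upwards [hSo.mem_nhds hx, hnear] with y hy hdist
    obtain ⟨R, hR, hθ, -⟩ := hchord y hy
    rw [hxc, Real.dist_eq, abs_lt] at hdist
    constructor <;> intro hlt <;> by_contra! hcon
    · nlinarith [Real.sin_neg_of_neg_of_neg_pi_lt (sub_neg.2 hcon) hdist.1]
    · nlinarith [Real.sin_pos_of_pos_of_lt_pi (sub_pos.2 hcon) hdist.2]
  refine mul_nonneg_of_touching hS hSo hg (fun x hx hxc => ?_) (fun x hx hconst => ?_) hx₀ hx₁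
  · obtain ⟨hθ, hρ⟩ := hbelow x hx hxc
    refine (hs x hθ hρ).imp (fun h => ?_) fun h => ?_ <;>
      filter_upwards [hside x hx hxc, eventually_nhdsWithin_iff.1 h] with y hy hyx <;>
      rcases eq_or_ne y x with rfl | hne
    exacts [hxc.ge, hy.1 (hyx hne), hxc.le, hy.2 (hyx hne)]
  · simp only [not_not] at hconst
    obtain ⟨hθ, hρ⟩ := hbelow x hx hconst.self_of_nhds
    have hθ_const : ∀ᶠ y in 𝓝[≠] x, θ y = θ s := by
      filter_upwards [hconst.filter_mono nhdsWithin_le_nhds,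
        mem_nhdsWithin_of_mem_nhds (hSo.mem_nhds hx)] with y hyc hy using (hbelow y hy hyc).1
    rcases hs x hθ hρ with h | h <;> obtain ⟨y, hlt, heq⟩ := (h.and hθ_const).exists
    exacts [hlt.ne' heq, hlt.ne heq]

namespace IsChordAngle

theorem reflect (h : IsChordAngle θ ρ α) :
    IsChordAngle (fun t => -θ (-t)) (fun t => ρ (-t)) (fun p => -α (-p.2, -p.1)) where
  cont := by
    refine (h.cont.comp (f := fun p : ℝ × ℝ => (-p.2, -p.1)) (by fun_prop) ?_).neg
    exact fun p (hp : p.1 < p.2) => show -p.2 < -p.1 from neg_lt_neg hp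
  chord u t hut := by
    obtain ⟨R, hR, hθ, hρ⟩ := h.chord (-t) (-u) (neg_lt_neg hut)
    refine ⟨R, hR, ?_, ?_⟩
    · rw [Real.cos_neg, ← hθ]; ring
    · rw [Real.sin_neg, mul_neg, ← hρ]; ring
  abs_lt_of_far := by
    obtain ⟨N, hN, hfar⟩ := h.abs_lt_of_far
    exact ⟨N, hN, fun u t hut => by
      simpa only [abs_neg] using hfar (-t) (-u) (by linarith)⟩

theorem continuousOn_left (h : IsChordAngle θ ρ α) (t : ℝ) :
    ContinuousOn (fun y => α (y, t)) (Iio t) :=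
  h.cont.comp (by fun_prop) fun _ hy => hy

theorem continuousOn_right (h : IsChordAngle θ ρ α) (u : ℝ) :
    ContinuousOn (fun y => α (u, y)) (Ioi u) :=
  h.cont.comp (by fun_prop) fun _ hy => hy

theorem cos_pos_iff (h : IsChordAngle θ ρ α) (hut : u < t) :
    0 < Real.cos (α (u, t)) ↔ θ u < θ t := by
  obtain ⟨R, hR, hθ, -⟩ := h.chord u t hut
  rw [← sub_pos (b := θ u), hθ, mul_pos_iff_of_pos_left hR]

theorem cos_neg_iff (h : IsChordAngle θ ρ α) (hut : u < t) :
    Real.cos (α (u, t)) < 0 ↔ θ t < θ u := by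
  obtain ⟨R, hR, hθ, -⟩ := h.chord u t hut
  rw [← sub_neg (a := θ t), hθ]
  exact ⟨mul_neg_of_pos_of_neg hR, fun hneg => neg_of_mul_neg_right hneg hR.le⟩

theorem sin_pos_iff (h : IsChordAngle θ ρ α) (hut : u < t) :
    0 < Real.sin (α (u, t)) ↔ ρ u < ρ t := by
  obtain ⟨R, hR, -, hρ⟩ := h.chord u t hut
  rw [← sub_pos (b := ρ u), hρ, mul_pos_iff_of_pos_left hR]

-- As `t` grows, the direction of the chord ends up pointing to the right, and on its way it cannot
-- pass through the vertical direction downwards.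
theorem mem_Icc_of_exposed_left (h : IsChordAngle θ ρ α) (hs : Exposed θ ρ s) (hst : s < t) :
    α (s, t) ∈ Icc (-(Real.pi / 2)) (3 * Real.pi / 2) := by
  obtain ⟨N, hN, hfar⟩ := h.abs_lt_of_far
  have hright := abs_lt.1 (hfar s (s + N) (by linarith))
  have hmul : ∀ c, (∀ x, Real.sin (x - c) = Real.cos x) → (∀ x, Real.cos (x - c) = -Real.sin x) →
      0 ≤ (α (s, t) - c) * (α (s, s + N) - c) := by
    intro c hsin hcos
    refine hs.mul_nonneg isPreconnected_Ioi isOpen_Ioi (h.continuousOn_right s) (fun y hy => ?_)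
      hst (lt_add_of_pos_right s hN)
    simpa only [hsin, hcos, mul_neg, neg_neg] using h.chord s y hy
  have hlower := hmul (-(Real.pi / 2)) (fun x => by rw [sub_neg_eq_add, Real.sin_add_pi_div_two])
    fun x => by rw [sub_neg_eq_add, Real.cos_add_pi_div_two]
  have hshift : ∀ x, x - 3 * Real.pi / 2 = x + Real.pi / 2 - 2 * Real.pi := fun x => by ring
  have hupper := hmul (3 * Real.pi / 2)
    (fun x => by rw [hshift, Real.sin_sub_two_pi, Real.sin_add_pi_div_two])
    fun x => by rw [hshift, Real.cos_sub_two_pi, Real.cos_add_pi_div_two]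
  constructor <;> nlinarith

theorem mem_Icc_of_exposed_right (h : IsChordAngle θ ρ α) (hs : Exposed θ ρ s) (hus : u < s) :
    α (u, s) ∈ Icc (-(3 * Real.pi / 2)) (Real.pi / 2) := by
  have hmem := h.reflect.mem_Icc_of_exposed_left hs.reflect (neg_lt_neg hus)
  simp only [neg_neg] at hmem
  exact ⟨neg_le.1 hmem.2, neg_le_neg_iff.1 hmem.1⟩

theorem angle_le_of_exposed (h : IsChordAngle θ ρ α) (hst : s < t) (hs : Exposed θ ρ s)
    (ht : Exposed θ ρ t) : θ s ≤ θ t := by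
  rw [← not_lt, ← h.cos_neg_iff hst, not_lt]
  exact Real.cos_nonneg_of_mem_Icc
    ⟨(h.mem_Icc_of_exposed_left hs hst).1, (h.mem_Icc_of_exposed_right ht hst).2⟩

-- Moving one end of the chord from `s` to `t`, or from `s` to `u`, while the other end stays at `u`
-- or at `t`, keeps the chord from pointing left, or from pointing right. Hence it points upwards.
theorem radius_lt_of_max (h : IsChordAngle θ ρ α) (hus : u < s) (hst : s < t)
    (hs : Exposed θ ρ s) (hlt : θ u < θ s) (hut : θ u = θ t)
    (hleft : ∀ y ∈ Icc u s, θ u ≤ θ y) (hright : ∀ y ∈ Icc s t, θ t ≤ θ y) : ρ u < ρ t := by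
  have hpi := Real.pi_pos
  have hα_us : α (u, s) < Real.pi / 2 := by
    refine (h.mem_Icc_of_exposed_right hs hus).2.lt_of_ne fun heq => ?_
    simpa [heq] using (h.cos_pos_iff hus).2 hlt
  have hα_st : Real.pi / 2 < α (s, t) := by
    by_contra! hle
    refine (Real.cos_nonneg_of_mem_Icc ⟨(h.mem_Icc_of_exposed_left hs hst).1, hle⟩).not_gt ?_
    exact (h.cos_neg_iff hst).2 (hut ▸ hlt)
  have hpos : 0 < α (u, t) := by
    by_contra! hle
    obtain ⟨y, hy, hy0⟩ := intermediate_value_Icc hus.le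
      ((h.continuousOn_left t).mono fun y hy => hy.2.trans_lt hst) ⟨hle, by linarith⟩
    refine (hleft y hy).not_gt (hut ▸ (h.cos_pos_iff (hy.2.trans_lt hst)).1 ?_)
    simp only at hy0
    simp [hy0]
  have hle : α (u, t) ≤ Real.pi / 2 := by
    by_contra! hgt
    obtain ⟨y, hy, hy0⟩ := intermediate_value_Icc hst.le
      ((h.continuousOn_right u).mono fun y hy => hus.trans_le hy.1)
      (show min (α (u, t)) Real.pi ∈ _ from ⟨le_min (by linarith) (by linarith), min_le_left _ _⟩)
    refine (hright y hy).not_gt (hut ▸ (h.cos_neg_iff (hus.trans_le hy.1)).1 ?_)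
    simp only at hy0
    rw [hy0]
    exact Real.cos_neg_of_pi_div_two_lt_of_lt (lt_min hgt (by linarith))
      ((min_le_right _ _).trans_lt (by linarith))
  exact (h.sin_pos_iff (hus.trans hst)).1 (Real.sin_pos_of_pos_of_lt_pi hpos (by linarith))

theorem radius_lt_of_min (h : IsChordAngle θ ρ α) (hus : u < s) (hst : s < t)
    (hs : Exposed θ ρ s) (hlt : θ s < θ u) (hut : θ u = θ t)
    (hleft : ∀ y ∈ Icc u s, θ y ≤ θ u) (hright : ∀ y ∈ Icc s t, θ y ≤ θ t) : ρ t < ρ u := by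
  simpa only [neg_neg] using h.reflect.radius_lt_of_max (neg_lt_neg hst) (neg_lt_neg hus) hs.reflect
    (by simpa [← hut] using hlt) (by simp [hut])
    (fun y hy => by simpa using hright (-y) ⟨le_neg.1 hy.2, neg_le.1 hy.1⟩)
    (fun y hy => by simpa using hleft (-y) ⟨le_neg.1 hy.2, neg_le.1 hy.1⟩)

end IsChordAngle

end Curve

theorem lt_of_strictMonoOn_of_strictAntiOn {f : ℝ → ℝ} {a b c : ℝ}
    (hmono : StrictMonoOn f (Icc a b)) (hanti : StrictAntiOn f (Icc b c)) {y : ℝ}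
    (hy : y ∈ Icc a c) (hne : y ≠ b) : f y < f b := by
  rcases hne.lt_or_gt with hlt | hgt
  · exact hmono ⟨hy.1, hlt.le⟩ ⟨hy.1.trans hlt.le, le_rfl⟩ hlt
  · exact hanti ⟨le_rfl, hgt.le.trans hy.2⟩ ⟨hgt.le, hy.2⟩ hgt

theorem exists_eq_of_strictMonoOn_of_strictAntiOn {f : ℝ → ℝ} {a b c : ℝ} (hab : a < b)
    (hbc : b < c) (hf : ContinuousOn f (Icc a c)) (hmono : StrictMonoOn f (Icc a b))
    (hanti : StrictAntiOn f (Icc b c)) :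
    ∃ u ∈ Ico a b, ∃ t ∈ Ioc b c, f u = f t ∧ f u < f b ∧
      (∀ y ∈ Icc u b, f u ≤ f y) ∧ ∀ y ∈ Icc b t, f t ≤ f y := by
  have hmax : max (f a) (f c) < f b :=
    max_lt (hmono (left_mem_Icc.2 hab.le) (right_mem_Icc.2 hab.le) hab)
      (hanti (left_mem_Icc.2 hbc.le) (right_mem_Icc.2 hbc.le) hbc)
  obtain ⟨u, hu, hfu⟩ := intermediate_value_Icc hab.le (hf.mono (Icc_subset_Icc_right hbc.le))
    ⟨le_max_left _ _, hmax.le⟩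
  obtain ⟨t, ht, hft⟩ := intermediate_value_Icc' hbc.le (hf.mono (Icc_subset_Icc_left hab.le))
    ⟨le_max_right _ _, hmax.le⟩
  refine ⟨u, ⟨hu.1, hu.2.lt_of_ne fun h => ?_⟩, t, ⟨ht.1.lt_of_ne' fun h => ?_, ht.2⟩,
    hfu.trans hft.symm, hfu ▸ hmax, fun y hy => ?_, fun y hy => ?_⟩
  · exact hmax.ne (by rw [← hfu, h])
  · exact hmax.ne (by rw [← hft, h])
  · exact hmono.monotoneOn hu ⟨hu.1.trans hy.1, hy.2⟩ hy.1
  · exact hanti.antitoneOn ⟨hy.1, hy.2.trans ht.2⟩ ht hy.2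

namespace PolarView

variable {n : ℕ} [NeZero n] {v : ZMod n → ℂ} {q : ℂ} {i : ZMod n} {θ ρ : ℝ → ℝ} {s t u : ℝ}

theorem isAdvancing (h : PolarView v q i θ ρ) : IsAdvancing θ ρ where
  cont_angle := h.cont_angle
  cont_radius := h.cont_radius
  injective _ _ := h.eq_of_polar_eq
  angle_lt_of_far := by
    have hn : (0 : ℝ) < n := Nat.cast_pos.2 (NeZero.pos n)
    have hangle := h.cont_angle
    obtain ⟨B, hB⟩ := (h.periodic_angle_sub.compact_of_continuous hn.ne'
      (by fun_prop)).isBounded.exists_norm_le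
    have hbound : ∀ t, |θ t - t * (2 * Real.pi / n)| ≤ B := fun t => hB _ ⟨t, rfl⟩
    have hB0 : 0 ≤ B := (abs_nonneg _).trans (hbound 0)
    refine ⟨n * (B / Real.pi + 1), by positivity, fun u t hut => ?_⟩
    have hslope : (n * (B / Real.pi + 1)) * (2 * Real.pi / n) ≤ (t - u) * (2 * Real.pi / n) := by
      gcongr
    have hvalue : (n * (B / Real.pi + 1)) * (2 * Real.pi / n) = 2 * B + 2 * Real.pi := by
      field_simp
    linarith [abs_le.1 (hbound u), abs_le.1 (hbound t), Real.pi_pos]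

theorem exposed_of_visible (h : PolarView v q i θ ρ) (hs : Visible v q (loop v i s)) :
    Exposed θ ρ s := by
  intro t hθ hρ
  obtain ⟨k, rfl, hk⟩ := h.exists_vertex_of_visible hs hθ hρ
  have hnear : ∀ᶠ y in 𝓝[≠] (k : ℝ), y ∈ Icc (k - 1 : ℝ) (k + 1) ∧ y ≠ k := by
    filter_upwards [mem_nhdsWithin_of_mem_nhds (Icc_mem_nhds (sub_one_lt (k : ℝ)) (lt_add_one _)),
      self_mem_nhdsWithin] with y hy hne using ⟨hy, hne⟩
  rw [← hθ]
  rcases mul_neg_iff.1 hk with ⟨hleft, hright⟩ | ⟨hleft, hright⟩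
  · refine Or.inr (hnear.mono fun y hy => ?_)
    exact lt_of_strictMonoOn_of_strictAntiOn (h.strictMonoOn_angle_left hleft)
      (h.strictAntiOn_angle hright) hy.1 hy.2
  · refine Or.inl (hnear.mono fun y hy => neg_lt_neg_iff.1 ?_)
    exact lt_of_strictMonoOn_of_strictAntiOn (h.strictAntiOn_angle_left hleft).neg
      (h.strictMonoOn_angle hright).neg hy.1 hy.2

theorem angle_le_of_visible (h : PolarView v q i θ ρ) (hst : s < t)
    (hs : Visible v q (loop v i s)) (ht : Visible v q (loop v i t)) : θ s ≤ θ t := by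
  obtain ⟨α, hα⟩ := h.isAdvancing.exists_isChordAngle
  exact hα.angle_le_of_exposed hst (h.exposed_of_visible hs) (h.exposed_of_visible ht)

theorem clockwiseTurn_of_angle_eq (h : PolarView v q i θ ρ) {k : ℤ} (hu : u ∈ Ico (k - 1 : ℝ) k)
    (ht : t ∈ Ioc (k : ℝ) (k + 1)) (hut : θ u = θ t)
    (hneg : (1 - Real.exp (ρ t - ρ u)) * edgeCross v q i (k - 1) < 0) :
    ClockwiseTurn (v (i + k - 1)) (v (i + k)) (v (i + k + 1)) := by
  set c := Real.exp (ρ t - ρ u)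
  have hu' : u ∈ Icc ((k - 1 : ℤ) : ℝ) ((k - 1 : ℤ) + 1) := by
    push_cast
    exact ⟨hu.1, by linarith [hu.2]⟩
  have hpred : i + ((k - 1 : ℤ) : ZMod n) = i + k - 1 := by push_cast; ring
  have hloop_u := loop_of_mem v i hu'
  have hloop_t := loop_of_mem v i (k := k) ⟨ht.1.le, ht.2⟩
  have hloop_tu := h.loop_eq_of_angle_eq (s := t) (t := u) (j := 0) (by simp [hut])
  have hcross := cross_loop (v := v) (q := q) (i := i) hu' (t := k) (by simp)
  rw [hpred, sub_add_cancel] at hloop_u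
  rw [loop_int] at hcross
  have hback : ((k - u : ℝ) : ℂ) * (v (i + k) - v (i + k - 1)) =
      (v (i + k) - q) - (loop v i u - q) := by
    rw [hloop_u]; push_cast; ring
  have hforth : ((t - k : ℝ) : ℂ) * (v (i + k + 1) - v (i + k)) =
      c * (loop v i u - q) - (v (i + k) - q) := by
    linear_combination hloop_tu - hloop_t
  have hturn : (k - u) * (t - k) * cross (v (i + k) - v (i + k - 1)) (v (i + k + 1) - v (i + k)) =
      (k - u) * ((1 - c) * edgeCross v q i (k - 1)) := by
    calc _ = cross (((k - u : ℝ) : ℂ) * (v (i + k) - v (i + k - 1)))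
          (((t - k : ℝ) : ℂ) * (v (i + k + 1) - v (i + k))) := by simp [cross]; ring
      _ = (1 - c) * cross (loop v i u - q) (v (i + k) - q) := by
          rw [hback, hforth]; simp [cross]; ring
      _ = _ := by rw [hcross]; ring
  have hku : 0 < k - u := sub_pos.2 hu.2
  have htk : 0 < t - k := sub_pos.2 ht.1
  exact neg_of_mul_neg_right (hturn.trans_lt (mul_neg_of_pos_of_neg hku hneg)) (mul_pos hku htk).le

theorem visibleCritical_of_visible (h : PolarView v q i θ ρ) {k : ℤ}
    (hs : Visible v q (loop v i k)) (hk : edgeCross v q i (k - 1) * edgeCross v q i k < 0) :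
    VisibleCritical v q (i + k) := by
  obtain ⟨α, hα⟩ := h.isAdvancing.exists_isChordAngle
  have hexp := h.exposed_of_visible hs
  refine ⟨?_, by rwa [← loop_int v i k]⟩
  rcases mul_neg_iff.1 hk with ⟨hleft, hright⟩ | ⟨hleft, hright⟩
  · obtain ⟨u, hu, t, ht, hut, hlt, hul, htr⟩ := exists_eq_of_strictMonoOn_of_strictAntiOn
      (sub_one_lt (k : ℝ)) (lt_add_one (k : ℝ)) h.cont_angle.continuousOn
      (h.strictMonoOn_angle_left hleft) (h.strictAntiOn_angle hright)
    have hρ := hα.radius_lt_of_max hu.2 ht.1 hexp hlt hut hul htr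
    refine Or.inl ⟨?_, ?_, h.clockwiseTurn_of_angle_eq hu ht hut ?_⟩
    · rwa [AngleLT, ← edgeCross_sub_one]
    · rwa [AngleLT, cross_swap, neg_pos]
    · exact mul_neg_of_neg_of_pos (sub_neg.2 (Real.one_lt_exp_iff.2 (sub_pos.2 hρ))) hleft
  · obtain ⟨u, hu, t, ht, hut, hlt, hul, htr⟩ := exists_eq_of_strictMonoOn_of_strictAntiOn
      (sub_one_lt (k : ℝ)) (lt_add_one (k : ℝ)) h.cont_angle.neg.continuousOn
      (h.strictAntiOn_angle_left hleft).neg (h.strictMonoOn_angle hright).neg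
    simp only [Pi.neg_apply, neg_inj, neg_lt_neg_iff, neg_le_neg_iff] at hut hlt hul htr
    have hρ := hα.radius_lt_of_min hu.2 ht.1 hexp hlt hut hul htr
    refine Or.inr ⟨?_, hright, h.clockwiseTurn_of_angle_eq hu ht hut ?_⟩
    · rwa [AngleLT, cross_swap, ← edgeCross_sub_one, neg_pos]
    · exact mul_neg_of_pos_of_neg (sub_pos.2 (Real.exp_lt_one_iff.2 (sub_neg.2 hρ))) hleft

theorem exists_visibleCritical (h : PolarView v q i θ ρ) (hs : Visible v q (loop v i s))
    (hθ : θ t = θ s) (hρ : ρ t < ρ s) : ∃ k : ℤ, t = k ∧ VisibleCritical v q (i + k) := by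
  obtain ⟨k, rfl, hk⟩ := h.exists_vertex_of_visible hs hθ hρ
  exact ⟨k, rfl, h.visibleCritical_of_visible
    (h.visible_of_angle_eq (j := 0) hs (by simp [hθ]) hρ.le) hk⟩

end PolarView

/-! ### The visible points between two directions -/

/-- What the visible parameters `V` of a boundary curve in polar coordinates (angle `θ`, log-radius
`ρ`) satisfy between two of them, `L` and `R`: they occur in angular order, they contain the first
point of every direction, and strictly between `L` and `R` the curve never passes in front of
them. -/
structure IsVisibleWindow (θ ρ : ℝ → ℝ) (V : Set ℝ) (L R : ℝ) : Prop where
  cont_angle : Continuous θ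
  cont_radius : Continuous ρ
  injective : ∀ s t, θ s = θ t → ρ s = ρ t → s = t
  isClosed : IsClosed V
  mono : MonotoneOn θ V
  exists_first : ∀ φ, ∃ s ∈ V, θ s = φ ∧ ∀ t, θ t = φ → ρ s ≤ ρ t
  notMem_Ioo : ∀ s ∈ V, ∀ t, θ t = θ s → ρ t < ρ s → t ∉ Ioo L R
  left_mem : L ∈ V
  right_mem : R ∈ V
  angle_lt : θ L < θ R

/-- The parameters in `V` whose direction lies strictly between those of `L` and `R`. -/
def interiorPart (θ : ℝ → ℝ) (V : Set ℝ) (L R : ℝ) : Set ℝ := V ∩ θ ⁻¹' Ioo (θ L) (θ R)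

/-- The parameters in `V` between `L` and `R` are those in `[a, b]`, together with `L` and `R`; the
curve goes from the direction of `L` to that of `R` on `[a, b]`, without leaving this range. -/
structure IsVisiblePart (θ : ℝ → ℝ) (V : Set ℝ) (L R a b : ℝ) : Prop where
  left_le : L ≤ a
  lt : a < b
  le_right : b ≤ R
  angle_left : θ a = θ L
  angle_right : θ b = θ R
  Icc_subset : Icc a b ⊆ V
  Ioo_subset : Ioo a b ⊆ interiorPart θ V L R
  eq_or_mem_or_eq : ∀ t ∈ V ∩ Icc L R, t = L ∨ t ∈ Icc a b ∨ t = R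
  left_eq : (∀ᶠ t in 𝓝[>] L, θ L < θ t) → a = L
  right_eq : (∀ᶠ t in 𝓝[<] R, θ t < θ R) → b = R

namespace IsVisibleWindow

variable {θ ρ : ℝ → ℝ} {V : Set ℝ} {L R a b s t : ℝ}

theorem reflect (h : IsVisibleWindow θ ρ V L R) :
    IsVisibleWindow (fun t => -θ (-t)) (fun t => ρ (-t)) (-V) (-R) (-L) where
  cont_angle := by have := h.cont_angle; fun_prop
  cont_radius := by have := h.cont_radius; fun_prop
  injective s t hθ hρ := neg_injective (h.injective _ _ (neg_injective hθ) hρ)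
  isClosed := h.isClosed.neg
  mono s hs t ht hst := neg_le_neg (h.mono ht hs (neg_le_neg hst))
  exists_first φ := by
    obtain ⟨s, hs, hφ, hmin⟩ := h.exists_first (-φ)
    exact ⟨-s, by simpa using hs, by simp [hφ],
      fun t ht => by simpa using hmin (-t) (by simp [← ht])⟩
  notMem_Ioo s hs t hθ hρ ht :=
    h.notMem_Ioo (-s) hs (-t) (neg_injective hθ) hρ ⟨lt_neg.1 ht.2, neg_lt.1 ht.1⟩
  left_mem := by simpa using h.right_mem
  right_mem := by simpa using h.left_mem
  angle_lt := by simpa using h.angle_lt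

theorem interiorPart_reflect :
    interiorPart (fun t => -θ (-t)) (-V) (-R) (-L) = -interiorPart θ V L R := by
  ext t
  simp [interiorPart, and_comm]

theorem interiorPart_subset_Ioo (h : IsVisibleWindow θ ρ V L R) :
    interiorPart θ V L R ⊆ Ioo L R := fun _ hs =>
  ⟨h.mono.reflect_lt h.left_mem hs.1 hs.2.1, h.mono.reflect_lt hs.1 h.right_mem hs.2.2⟩

theorem eq_of_angle_eq (h : IsVisibleWindow θ ρ V L R) (hs : s ∈ interiorPart θ V L R)
    (ht : t ∈ interiorPart θ V L R) (hst : θ s = θ t) : s = t := by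
  rcases lt_trichotomy (ρ s) (ρ t) with hlt | heq | hgt
  · exact absurd (h.interiorPart_subset_Ioo hs) (h.notMem_Ioo t ht.1 s hst hlt)
  · exact h.injective s t hst heq
  · exact absurd (h.interiorPart_subset_Ioo ht) (h.notMem_Ioo s hs.1 t hst.symm hgt)

theorem strictMonoOn_interiorPart (h : IsVisibleWindow θ ρ V L R) :
    StrictMonoOn θ (interiorPart θ V L R) :=
  (h.mono.mono inter_subset_left).strictMonoOn_of_injOn fun _ hs _ ht => h.eq_of_angle_eq hs ht

theorem exists_mem_interiorPart {φ : ℝ} (h : IsVisibleWindow θ ρ V L R)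
    (hφ : φ ∈ Ioo (θ L) (θ R)) :
    ∃ s ∈ interiorPart θ V L R, θ s = φ ∧ ∀ t, θ t = φ → ρ s ≤ ρ t := by
  obtain ⟨s, hs, rfl, hmin⟩ := h.exists_first φ
  exact ⟨s, ⟨hs, hφ⟩, rfl, hmin⟩

theorem nonempty_interiorPart (h : IsVisibleWindow θ ρ V L R) :
    (interiorPart θ V L R).Nonempty := by
  obtain ⟨φ, hφ⟩ := exists_between h.angle_lt
  obtain ⟨s, hs, -⟩ := h.exists_mem_interiorPart hφ
  exact ⟨s, hs⟩

theorem radius_le_of_mem_interiorPart (h : IsVisibleWindow θ ρ V L R)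
    (hs : s ∈ interiorPart θ V L R) (ht : θ t = θ s) : ρ s ≤ ρ t := by
  obtain ⟨r, hr, hrs, hmin⟩ := h.exists_mem_interiorPart hs.2
  exact h.eq_of_angle_eq hr hs hrs ▸ hmin t ht

-- A gap of `V` inside the interior part would be jumped over by the angle, but every direction
-- between its ends has a first point.
theorem ordConnected_interiorPart (h : IsVisibleWindow θ ρ V L R) :
    (interiorPart θ V L R).OrdConnected := by
  refine ⟨fun s hs t ht x hx => ?_⟩
  have hangle : ∀ y ∈ V ∩ Icc s t, y ∈ interiorPart θ V L R := fun y hy =>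
    ⟨hy.1, hs.2.1.trans_le (h.mono hs.1 hy.1 hy.2.1), (h.mono hy.1 ht.1 hy.2.2).trans_lt ht.2.2⟩
  by_contra hxW
  have hxV : x ∉ V := fun hxV => hxW (hangle x ⟨hxV, hx⟩)
  obtain ⟨y, ⟨hyV, hy⟩, hymax⟩ :=
    (isCompact_Icc.inter_left h.isClosed).exists_isGreatest ⟨s, hs.1, le_rfl, hx.1⟩
  obtain ⟨z, ⟨hzV, hz⟩, hzmin⟩ :=
    (isCompact_Icc.inter_left h.isClosed).exists_isLeast ⟨t, ht.1, hx.2, le_rfl⟩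
  have hyx : y < x := hy.2.lt_of_ne fun e => hxV (e ▸ hyV)
  have hxz : x < z := hz.1.lt_of_ne fun e => hxV (e ▸ hzV)
  have hyW := hangle y ⟨hyV, hy.1, hy.2.trans hx.2⟩
  have hzW := hangle z ⟨hzV, hx.1.trans hz.1, hz.2⟩
  obtain ⟨φ, hφ⟩ := exists_between (h.strictMonoOn_interiorPart hyW hzW (hyx.trans hxz))
  obtain ⟨r, hr, rfl, -⟩ :=
    h.exists_mem_interiorPart ⟨hyW.2.1.trans hφ.1, hφ.2.trans hzW.2.2⟩
  have hyr : y < r := h.mono.reflect_lt hyV hr.1 hφ.1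
  have hrz : r < z := h.mono.reflect_lt hr.1 hzV hφ.2
  rcases le_total r x with hrx | hxr
  · exact hyr.not_ge (hymax ⟨hr.1, hy.1.trans hyr.le, hrx⟩)
  · exact hrz.not_ge (hzmin ⟨hr.1, hxr, hrz.le.trans hz.2⟩)

theorem exists_isGLB (h : IsVisibleWindow θ ρ V L R) :
    ∃ a ∈ V, L ≤ a ∧ θ a = θ L ∧ IsGLB (interiorPart θ V L R) a := by
  have hlower : L ∈ lowerBounds (interiorPart θ V L R) :=
    fun s hs => (h.interiorPart_subset_Ioo hs).1.le
  have hglb := isGLB_csInf h.nonempty_interiorPart ⟨L, hlower⟩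
  have hmem : sInf (interiorPart θ V L R) ∈ V := h.isClosed.closure_subset_iff.2 inter_subset_left
    (hglb.mem_closure h.nonempty_interiorPart)
  have hle : L ≤ sInf (interiorPart θ V L R) := hglb.2 hlower
  refine ⟨sInf (interiorPart θ V L R), hmem, hle, (h.mono h.left_mem hmem hle).antisymm' ?_, hglb⟩
  by_contra! hlt
  obtain ⟨φ, hφ⟩ := exists_between (lt_min hlt h.angle_lt)
  obtain ⟨s, hs, rfl, -⟩ := h.exists_mem_interiorPart ⟨hφ.1, hφ.2.trans_le (min_le_right _ _)⟩
  exact (h.mono.reflect_lt hs.1 hmem (hφ.2.trans_le (min_le_left _ _))).not_ge (hglb.1 hs)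

theorem exists_isLUB (h : IsVisibleWindow θ ρ V L R) :
    ∃ b ∈ V, b ≤ R ∧ θ b = θ R ∧ IsLUB (interiorPart θ V L R) b := by
  obtain ⟨a, haV, hle, hangle, hglb⟩ := h.reflect.exists_isGLB
  rw [interiorPart_reflect, isGLB_neg] at hglb
  exact ⟨-a, haV, neg_le.1 hle, by simpa using hangle, hglb⟩

theorem eq_or_eq_of_angle_eq_left (h : IsVisibleWindow θ ρ V L R) (haV : a ∈ V) (hLa : L ≤ a)
    (hθa : θ a = θ L) (ha : IsGLB (interiorPart θ V L R) a) (ht : t ∈ V) (hLt : L ≤ t)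
    (hθt : θ t = θ L) : t = L ∨ t = a := by
  have hlt_right : ∀ x ∈ V, θ x = θ L → x < R := fun x hx hθ =>
    h.mono.reflect_lt hx h.right_mem (hθ ▸ h.angle_lt)
  rcases lt_trichotomy (ρ t) (ρ a) with hlt | heq | hgt
  · by_contra! hne
    exact h.notMem_Ioo a haV t (hθt.trans hθa.symm) hlt
      ⟨hLt.lt_of_ne' hne.1, hlt_right t ht hθt⟩
  · exact Or.inr (h.injective t a (hθt.trans hθa.symm) heq)
  · have haL : a = L := by
      by_contra hne
      exact h.notMem_Ioo t ht a (hθa.trans hθt.symm) hgt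
        ⟨hLa.lt_of_ne' hne, hlt_right a haV hθa⟩
    have hta : t ≤ a := ha.2 fun s hs => (h.mono.reflect_lt ht hs.1 (hθt ▸ hs.2.1)).le
    exact Or.inr (hta.antisymm (haL ▸ hLt))

theorem eq_or_eq_of_angle_eq_right (h : IsVisibleWindow θ ρ V L R) (hbV : b ∈ V) (hbR : b ≤ R)
    (hθb : θ b = θ R) (hb : IsLUB (interiorPart θ V L R) b) (ht : t ∈ V) (htR : t ≤ R)
    (hθt : θ t = θ R) : t = R ∨ t = b := by
  have := h.reflect.eq_or_eq_of_angle_eq_left (a := -b) (t := -t) (by simpa using hbV)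
    (neg_le_neg hbR) (by simp [hθb]) (by rw [interiorPart_reflect]; exact hb.neg)
    (by simpa using ht) (neg_le_neg htR) (by simp [hθt])
  simpa only [neg_inj] using this

-- If `a` lay behind `L`, points of the interior part near `a` would be hidden behind the part of
-- the curve near `L`.
theorem left_eq_of_eventually_lt (h : IsVisibleWindow θ ρ V L R) (haV : a ∈ V) (hLa : L ≤ a)
    (hθa : θ a = θ L) (ha : IsGLB (interiorPart θ V L R) a)
    (hL : ∀ᶠ t in 𝓝[>] L, θ L < θ t) : a = L := by
  by_contra hne
  have haR : a < R := h.mono.reflect_lt haV h.right_mem (hθa ▸ h.angle_lt)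
  have hρ : ρ L < ρ a := by
    by_contra! hle
    exact h.notMem_Ioo L h.left_mem a hθa (hle.lt_of_ne fun e => hne (h.injective a L hθa e))
      ⟨hLa.lt_of_ne' hne, haR⟩
  obtain ⟨r, hLr, hra⟩ := exists_between hρ
  obtain ⟨u₀, hu₀, hnear⟩ := mem_nhdsGE_iff_exists_Icc_subset.1
    (mem_nhdsWithin_of_mem_nhds (h.cont_radius.continuousAt.eventually_lt_const hLr))
  obtain ⟨u, hθu, hu⟩ := (hL.and (Ioo_mem_nhdsGT hu₀)).exists
  obtain ⟨s, hs, hrs, hsu⟩ := ((ha.frequently_nhds_mem h.nonempty_interiorPart).and_eventually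
    ((h.cont_radius.continuousAt.eventually_const_lt hra).and
      (h.cont_angle.continuousAt.eventually_lt_const (hθa ▸ hθu)))).exists
  obtain ⟨t, ht, hts⟩ := intermediate_value_Icc hu.1.le h.cont_angle.continuousOn
    ⟨hs.2.1.le, hsu.le⟩
  have htr : ρ t < r := hnear ⟨ht.1, ht.2.trans hu.2.le⟩
  exact (hrs.trans_le (h.radius_le_of_mem_interiorPart hs hts)).not_gt htr

theorem right_eq_of_eventually_lt (h : IsVisibleWindow θ ρ V L R) (hbV : b ∈ V) (hbR : b ≤ R)
    (hθb : θ b = θ R) (hb : IsLUB (interiorPart θ V L R) b)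
    (hR : ∀ᶠ t in 𝓝[<] R, θ t < θ R) : b = R := by
  have hneg : Tendsto Neg.neg (𝓝[>] (-R)) (𝓝[<] R) := by
    simpa only [neg_neg] using tendsto_neg_nhdsGT (a := -R)
  have := h.reflect.left_eq_of_eventually_lt (a := -b) (by simpa using hbV)
    (neg_le_neg hbR) (by simp [hθb]) (by rw [interiorPart_reflect]; exact hb.neg)
    ((hneg.eventually hR).mono fun t ht => by simpa using ht)
  exact neg_injective this

theorem exists_isVisiblePart (h : IsVisibleWindow θ ρ V L R) :
    ∃ a b, IsVisiblePart θ V L R a b := by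
  obtain ⟨a, haV, hLa, hθa, ha⟩ := h.exists_isGLB
  obtain ⟨b, hbV, hbR, hθb, hb⟩ := h.exists_isLUB
  have hIoo : Ioo a b ⊆ interiorPart θ V L R := fun t ht => by
    obtain ⟨s, hs, -, hst⟩ := ha.exists_between ht.1
    obtain ⟨u, hu, htu, -⟩ := hb.exists_between ht.2
    exact h.ordConnected_interiorPart.out hs hu ⟨hst.le, htu.le⟩
  refine ⟨a, b, hLa, h.mono.reflect_lt haV hbV (by rw [hθa, hθb]; exact h.angle_lt), hbR, hθa,
    hθb, fun t ht => ?_, hIoo, fun t ⟨htV, htL, htR⟩ => ?_,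
    h.left_eq_of_eventually_lt haV hLa hθa ha, h.right_eq_of_eventually_lt hbV hbR hθb hb⟩
  · rcases ht.1.eq_or_lt with rfl | hat
    · exact haV
    · rcases ht.2.eq_or_lt with rfl | htb
      · exact hbV
      · exact (hIoo ⟨hat, htb⟩).1
  · have hab : a ≤ b := (ha.1 h.nonempty_interiorPart.some_mem).trans
      (hb.1 h.nonempty_interiorPart.some_mem)
    rcases (h.mono h.left_mem htV htL).eq_or_lt with hθL | hθL
    · exact (h.eq_or_eq_of_angle_eq_left haV hLa hθa ha htV htL hθL.symm).imp_right
        fun hta => Or.inl ⟨hta.ge, hta.trans_le hab⟩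
    · rcases (h.mono htV h.right_mem htR).eq_or_lt with hθR | hθR
      · rcases h.eq_or_eq_of_angle_eq_right hbV hbR hθb hb htV htR hθR with htR | htb
        · exact Or.inr (Or.inr htR)
        · exact Or.inr (Or.inl ⟨hab.trans htb.ge, htb.le⟩)
      · exact Or.inr (Or.inl ⟨ha.1 ⟨htV, hθL, hθR⟩, hb.1 ⟨htV, hθL, hθR⟩⟩)

end IsVisibleWindow

/-! ### Edges crossing a ray -/

/-- `edgeNum p q k / edgeDen p q d k` is the position, in multiples of `d`, at which the `k`-th edge
of the chain `p` meets the line through `q` in direction `d`. -/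
noncomputable def edgeNum (p : ℕ → ℂ) (q : ℂ) (k : ℕ) : ℝ := cross (p k - q) (p (k + 1) - q)

/-- The denominator that belongs to `edgeNum`. Keeping the two apart lets the machine compare
positions without division. -/
noncomputable def edgeDen (p : ℕ → ℂ) (q d : ℂ) (k : ℕ) : ℝ :=
  cross d (p (k + 1) - q) - cross d (p k - q)

/-- The `k`-th edge passes the ray in direction `d` counterclockwise and does not end on it. -/
def LeavesRay (p : ℕ → ℂ) (q d : ℂ) (k : ℕ) : Prop :=
  0 < edgeNum p q k ∧ cross d (p k - q) ≤ 0 ∧ 0 < cross d (p (k + 1) - q)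

/-- The `k`-th edge passes the ray in direction `d` counterclockwise and does not start on it. -/
def ReachesRay (p : ℕ → ℂ) (q d : ℂ) (k : ℕ) : Prop :=
  0 < edgeNum p q k ∧ cross d (p k - q) < 0 ∧ 0 ≤ cross d (p (k + 1) - q)

/-- Among the edges with property `cand` of a chain with `m` vertices, the `k`-th one is the only
one that meets the ray nearest to `q`. -/
def IsNearestEdge (p : ℕ → ℂ) (q d : ℂ) (m : ℕ) (cand : ℕ → Prop) (k : ℕ) : Prop :=
  k + 1 < m ∧ cand k ∧ ∀ j, j + 1 < m → cand j → j ≠ k →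
    edgeNum p q k * edgeDen p q d j < edgeNum p q j * edgeDen p q d k

section Ray

variable {p : ℕ → ℂ} {q d : ℂ} {k : ℕ} {s τ : ℝ}

theorem LeavesRay.edgeDen_pos (h : LeavesRay p q d k) : 0 < edgeDen p q d k := by
  unfold edgeDen; linarith [h.2.1, h.2.2]

theorem ReachesRay.edgeDen_pos (h : ReachesRay p q d k) : 0 < edgeDen p q d k := by
  unfold edgeDen; linarith [h.2.1, h.2.2]

theorem edge_eq_of_edgeDen_ne_zero (hD : edgeDen p q d k ≠ 0) :
    p k + (-cross d (p k - q) / edgeDen p q d k : ℝ) * (p (k + 1) - p k) =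
      q + (edgeNum p q k / edgeDen p q d k : ℝ) * d := by
  have hD' : (edgeDen p q d k : ℂ) ≠ 0 := ofReal_ne_zero.2 hD
  have hcramer : (edgeDen p q d k : ℂ) * (p k - q) - cross d (p k - q) * (p (k + 1) - p k) =
      edgeNum p q k * d := by
    apply Complex.ext <;> simp [edgeDen, edgeNum, cross] <;> ring
  push_cast
  field_simp
  linear_combination hcramer

theorem LeavesRay.exists_edge_eq (h : LeavesRay p q d k) : ∃ τ ∈ Ico (0 : ℝ) 1,
    p k + τ * (p (k + 1) - p k) = q + (edgeNum p q k / edgeDen p q d k : ℝ) * d := by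
  have hD := h.edgeDen_pos
  refine ⟨_, ⟨div_nonneg (neg_nonneg.2 h.2.1) hD.le, (div_lt_one hD).2 ?_⟩,
    edge_eq_of_edgeDen_ne_zero hD.ne'⟩
  unfold edgeDen; linarith [h.2.2]

theorem ReachesRay.exists_edge_eq (h : ReachesRay p q d k) : ∃ τ ∈ Ioc (0 : ℝ) 1,
    p k + τ * (p (k + 1) - p k) = q + (edgeNum p q k / edgeDen p q d k : ℝ) * d := by
  have hD := h.edgeDen_pos
  refine ⟨_, ⟨div_pos (neg_pos.2 h.2.1) hD, (div_le_one hD).2 ?_⟩,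
    edge_eq_of_edgeDen_ne_zero hD.ne'⟩
  unfold edgeDen; linarith [h.2.2]

theorem mul_cross_left_of_edge_eq (h : p k + τ * (p (k + 1) - p k) = q + s * d) :
    s * cross d (p k - q) = -(τ * edgeNum p q k) := by
  have hd : (s : ℂ) * d = p k - q + τ * (p (k + 1) - p k) := by linear_combination -h
  have hmul : s * cross d (p k - q) = cross (s * d) (p k - q) := by simp [cross]; ring
  rw [hmul, hd]
  simp [edgeNum, cross]; ring

theorem mul_cross_right_of_edge_eq (h : p k + τ * (p (k + 1) - p k) = q + s * d) :
    s * cross d (p (k + 1) - q) = (1 - τ) * edgeNum p q k := by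
  have hd : (s : ℂ) * d = p k - q + τ * (p (k + 1) - p k) := by linear_combination -h
  have hmul : s * cross d (p (k + 1) - q) = cross (s * d) (p (k + 1) - q) := by
    simp [cross]; ring
  rw [hmul, hd]
  simp [edgeNum, cross]; ring

theorem edgeNum_eq_mul_edgeDen (h : p k + τ * (p (k + 1) - p k) = q + s * d) :
    edgeNum p q k = s * edgeDen p q d k := by
  rw [edgeDen, mul_sub, mul_cross_left_of_edge_eq h, mul_cross_right_of_edge_eq h]
  ring

theorem leavesRay_of_edge_eq (hs : 0 < s) (hτ : τ ∈ Ico (0 : ℝ) 1) (hnum : 0 < edgeNum p q k)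
    (h : p k + τ * (p (k + 1) - p k) = q + s * d) : LeavesRay p q d k := by
  refine ⟨hnum, nonpos_of_mul_nonpos_right ?_ hs, pos_of_mul_pos_right ?_ hs.le⟩
  · rw [mul_cross_left_of_edge_eq h]
    exact neg_nonpos.2 (mul_nonneg hτ.1 hnum.le)
  · rw [mul_cross_right_of_edge_eq h]
    exact mul_pos (sub_pos.2 hτ.2) hnum

theorem reachesRay_of_edge_eq (hs : 0 < s) (hτ : τ ∈ Ioc (0 : ℝ) 1) (hnum : 0 < edgeNum p q k)
    (h : p k + τ * (p (k + 1) - p k) = q + s * d) : ReachesRay p q d k := by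
  refine ⟨hnum, neg_of_mul_neg_right ?_ hs.le, nonneg_of_mul_nonneg_right ?_ hs⟩
  · rw [mul_cross_left_of_edge_eq h]
    exact neg_neg_of_pos (mul_pos hτ.1 hnum)
  · rw [mul_cross_right_of_edge_eq h]
    exact mul_nonneg (sub_nonneg.2 hτ.2) hnum.le

theorem isNearestEdge_of_forall_le {m : ℕ} {cand : ℕ → Prop} (hk : k + 1 < m) (hcand : cand k)
    (hpos : ∀ j, cand j → 0 < edgeDen p q d j)
    (hs : edgeNum p q k = s * edgeDen p q d k)
    (hle : ∀ j, j + 1 < m → cand j → edgeNum p q j / edgeDen p q d j ≤ s → j = k) :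
    IsNearestEdge p q d m cand k := by
  refine ⟨hk, hcand, fun j hj hjc hjk => ?_⟩
  have hlt : s * edgeDen p q d j < edgeNum p q j :=
    (lt_div_iff₀ (hpos j hjc)).1 (not_le.1 fun h => hjk (hle j hj hjc h))
  rw [hs, mul_right_comm]
  exact mul_lt_mul_of_pos_right hlt (hpos k hcand)

end Ray

/-! ### The visible part of a chain -/

section Chain

variable {n : ℕ} {v : ZMod n → ℂ} {q : ℂ} {i : ZMod n} {k m : ℕ} {s t x y : ℝ}

theorem loop_natCast (v : ZMod n → ℂ) (i : ZMod n) (k : ℕ) : loop v i k = v (i + k) := by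
  simpa using loop_int v i k

theorem loop_zero (v : ZMod n → ℂ) (i : ZMod n) : loop v i 0 = v i := by
  simpa using loop_int v i 0

theorem read_chainInput (v : ZMod n → ℂ) (q : ℂ) (i : ZMod n) (hk : k < m) :
    (chainInput v q i m).read k = v (i + k) :=
  dif_pos hk

theorem loop_eq_edge (v : ZMod n → ℂ) (q : ℂ) (i : ZMod n) (hk : k + 1 < m)
    (ht : t ∈ Icc (k : ℝ) (k + 1)) :
    loop v i t = (chainInput v q i m).read k +
      (t - k : ℝ) * ((chainInput v q i m).read (k + 1) - (chainInput v q i m).read k) := by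
  rw [loop_of_mem v i (k := k) (by simpa using ht), read_chainInput v q i hk,
    read_chainInput v q i (by omega)]
  push_cast
  rw [add_assoc]

theorem edgeNum_read_chainInput (v : ZMod n → ℂ) (q : ℂ) (i : ZMod n) (hk : k + 1 < m) :
    edgeNum (chainInput v q i m).read q k = edgeCross v q i k := by
  rw [edgeNum, read_chainInput v q i hk, read_chainInput v q i (by omega), edgeCross]
  push_cast
  rw [add_assoc]

theorem CriticalMax.edgeCross_neg {k : ℤ} (h : CriticalMax v q (i + k)) :
    edgeCross v q i k < 0 := by
  rw [edgeCross, cross_swap]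
  exact neg_neg_of_pos h.2.1

theorem CriticalMin.edgeCross_pos {k : ℤ} (h : CriticalMin v q (i + k)) :
    0 < edgeCross v q i k :=
  h.2.1

theorem CriticalMax.edgeCross_sub_one_pos {k : ℤ} (h : CriticalMax v q (i + k)) :
    0 < edgeCross v q i (k - 1) := by
  rw [edgeCross_sub_one]
  exact h.1

theorem CriticalMin.edgeCross_sub_one_neg {k : ℤ} (h : CriticalMin v q (i + k)) :
    edgeCross v q i (k - 1) < 0 := by
  rw [edgeCross_sub_one, cross_swap]
  exact neg_neg_of_pos h.1

theorem loop_injOn [NeZero n] (hs : IsSimplePolygon v) (i : ZMod n) (hm : m ≤ n) :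
    InjOn (loop v i) (Icc 0 ((m - 1 : ℕ) : ℝ)) := by
  intro s hs' t ht hst
  obtain ⟨j, rfl⟩ := exists_int_of_loop_eq hs i hst
  have hn : (0 : ℝ) < n := Nat.cast_pos.2 (NeZero.pos n)
  have hR : ((m - 1 : ℕ) : ℝ) < n := Nat.cast_lt.2 (by have := NeZero.pos n; omega)
  have hlow : (-1 : ℝ) < j := by nlinarith [hn, hs'.2, ht.1]
  have hup : (j : ℝ) < 1 := by nlinarith [hn, hs'.1, ht.2]
  obtain rfl : j = 0 := by
    have hlow' : -1 < j := by exact_mod_cast hlow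
    have hup' : j < 1 := by exact_mod_cast hup
    omega
  simp

/-- Among the points of the chain on the ray from `q` through the point with parameter `y`, only
that point itself can come before the one with parameter `x`, which is at distance `s` when measured
in multiples of the distance of `y`. -/
structure IsFrontHit (v : ZMod n → ℂ) (q : ℂ) (i : ZMod n) (m : ℕ) (y x s : ℝ) : Prop where
  mem : x ∈ Icc 0 ((m - 1 : ℕ) : ℝ)
  pos : 0 < s
  loop_eq : loop v i x = q + s * (loop v i y - q)
  eq_or_eq : ∀ t ∈ Icc 0 ((m - 1 : ℕ) : ℝ), ∀ c : ℝ, 0 < c → c ≤ s →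
    loop v i t = q + c * (loop v i y - q) → t = y ∨ t = x

namespace IsFrontHit

theorem isNearestHit (h : IsFrontHit v q i m y x s) (hq : ∀ t, loop v i t ≠ q)
    (hxy : loop v i x ≠ loop v i y) : IsNearestHit v q i m (loop v i y) x := by
  refine ⟨h.mem, ⟨⟨s, h.pos.le, ?_⟩, ?_⟩, ?_⟩
  · rw [curve_eq_loop v i h.mem.1, h.loop_eq]
  · rwa [curve_eq_loop v i h.mem.1]
  · rintro _ ⟨t, ht, rfl⟩ ⟨⟨c, hc, hct⟩, hty⟩
    rw [curve_eq_loop v i ht.1] at hct hty ⊢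
    rw [curve_eq_loop v i h.mem.1]
    have hc0 : 0 < c := hc.lt_of_ne' fun hc0 => hq t (by simpa [hc0] using hct)
    rcases le_total c s with hcs | hsc
    · rcases h.eq_or_eq t ht c hc0 hcs hct with rfl | rfl
      · exact absurd rfl hty
      · rfl
    · rw [hct, h.loop_eq, dist_self_add_right, dist_self_add_right, norm_mul, norm_mul,
        norm_real, norm_real, Real.norm_of_nonneg hc, Real.norm_of_nonneg h.pos.le]
      exact mul_le_mul_of_nonneg_right hsc (norm_nonneg _)

theorem eq_div (h : IsFrontHit v q i m y x s) (hk : k + 1 < m) (hx : x ∈ Icc (k : ℝ) (k + 1))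
    (hD : 0 < edgeDen (chainInput v q i m).read q (loop v i y - q) k) :
    s = edgeNum (chainInput v q i m).read q k /
      edgeDen (chainInput v q i m).read q (loop v i y - q) k := by
  rw [eq_div_iff hD.ne', ← edgeNum_eq_mul_edgeDen ((loop_eq_edge v q i hk hx).symm.trans h.loop_eq)]

theorem eq_of_edge_eq (h : IsFrontHit v q i m y x s) {J : ℕ → Set ℝ}
    (hJ : ∀ j, J j ⊆ Icc (j : ℝ) (j + 1))
    (hy : ∀ j, j + 1 < m → 0 < edgeNum (chainInput v q i m).read q j → y ∈ J j → y = x)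
    {j : ℕ} (hj : j + 1 < m) (hnum : 0 < edgeNum (chainInput v q i m).read q j) (ht : t ∈ J j)
    {c : ℝ} (hc : 0 < c) (hcs : c ≤ s) (htc : loop v i t = q + c * (loop v i y - q)) : t = x := by
  have hjm : (j : ℝ) + 1 ≤ (m - 1 : ℕ) := by exact_mod_cast (by omega : j + 1 ≤ m - 1)
  have htI : t ∈ Icc 0 ((m - 1 : ℕ) : ℝ) :=
    ⟨(Nat.cast_nonneg j).trans (hJ j ht).1, (hJ j ht).2.trans hjm⟩
  rcases h.eq_or_eq t htI c hc hcs htc with rfl | rfl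
  · exact hy j hj hnum ht
  · rfl

theorem isNearestEdge_leavesRay (h : IsFrontHit v q i m y x s) (hk : k + 1 < m)
    (hx : x ∈ Ico (k : ℝ) (k + 1)) (hnum : 0 < edgeNum (chainInput v q i m).read q k)
    (hy : ∀ j : ℕ, j + 1 < m → 0 < edgeNum (chainInput v q i m).read q j →
      y ∈ Ico (j : ℝ) (j + 1) → y = x) :
    IsNearestEdge (chainInput v q i m).read q (loop v i y - q) m
      (LeavesRay (chainInput v q i m).read q (loop v i y - q)) k := by
  have hedge := (loop_eq_edge v q i hk (Ico_subset_Icc_self hx)).symm.trans h.loop_eq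
  have hleaves := leavesRay_of_edge_eq h.pos
    ⟨sub_nonneg.2 hx.1, sub_lt_iff_lt_add'.2 hx.2⟩ hnum hedge
  refine isNearestEdge_of_forall_le hk hleaves (fun _ hj => hj.edgeDen_pos)
    (edgeNum_eq_mul_edgeDen hedge) fun j hj hcand hle => ?_
  obtain ⟨τ, hτ, hτe⟩ := hcand.exists_edge_eq
  have ht : (j : ℝ) + τ ∈ Ico (j : ℝ) (j + 1) := ⟨by linarith [hτ.1], by linarith [hτ.2]⟩
  have hjx := h.eq_of_edge_eq (fun j => Ico_subset_Icc_self) hy hj hcand.1 ht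
    (div_pos hcand.1 hcand.edgeDen_pos) hle
    (by rw [loop_eq_edge v q i hj (Ico_subset_Icc_self ht), add_sub_cancel_left, hτe])
  rw [hjx] at ht
  rw [← (Nat.floor_eq_iff h.mem.1).2 hx, (Nat.floor_eq_iff h.mem.1).2 ht]

theorem isNearestEdge_reachesRay (h : IsFrontHit v q i m y x s) (hk : k + 1 < m)
    (hx : x ∈ Ioc (k : ℝ) (k + 1)) (hnum : 0 < edgeNum (chainInput v q i m).read q k)
    (hy : ∀ j : ℕ, j + 1 < m → 0 < edgeNum (chainInput v q i m).read q j →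
      y ∈ Ioc (j : ℝ) (j + 1) → y = x) :
    IsNearestEdge (chainInput v q i m).read q (loop v i y - q) m
      (ReachesRay (chainInput v q i m).read q (loop v i y - q)) k := by
  have hedge := (loop_eq_edge v q i hk (Ioc_subset_Icc_self hx)).symm.trans h.loop_eq
  have hreaches := reachesRay_of_edge_eq h.pos
    ⟨sub_pos.2 hx.1, sub_le_iff_le_add'.2 hx.2⟩ hnum hedge
  refine isNearestEdge_of_forall_le hk hreaches (fun _ hj => hj.edgeDen_pos)
    (edgeNum_eq_mul_edgeDen hedge) fun j hj hcand hle => ?_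
  obtain ⟨τ, hτ, hτe⟩ := hcand.exists_edge_eq
  have ht : (j : ℝ) + τ ∈ Ioc (j : ℝ) (j + 1) := ⟨by linarith [hτ.1], by linarith [hτ.2]⟩
  have hjx := h.eq_of_edge_eq (fun j => Ioc_subset_Icc_self) hy hj hcand.1 ht
    (div_pos hcand.1 hcand.edgeDen_pos) hle
    (by rw [loop_eq_edge v q i hj (Ioc_subset_Icc_self ht), add_sub_cancel_left, hτe])
  rw [hjx] at ht
  have hjk : j < k + 1 := by exact_mod_cast ht.1.trans_le hx.2
  have hkj : k < j + 1 := by exact_mod_cast hx.1.trans_le ht.2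
  omega

end IsFrontHit

end Chain

section Cuts

variable {n : ℕ} [NeZero n] {v : ZMod n → ℂ} {q : ℂ} {i : ZMod n} {m k : ℕ} {θ ρ : ℝ → ℝ}
  {a b t : ℝ}

namespace PolarView

theorem angle_ne_of_not_sameRay (h : PolarView v q i θ ρ) {s t : ℝ}
    (hray : ¬ SameRay ℝ (loop v i s - q) (loop v i t - q)) (j : ℤ) :
    θ t ≠ θ s + j * (2 * Real.pi) := by
  intro hj
  refine hray ?_
  rw [h.loop_eq_of_angle_eq hj, add_sub_cancel_left, ← real_smul]
  exact SameRay.sameRay_pos_smul_right _ (Real.exp_pos _)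

theorem angle_mem_Ioo (h : PolarView v q i θ ρ) (hc : IsVisibleCriticalChain v q i m) :
    θ ((m - 1 : ℕ) : ℝ) ∈ Ioo (θ 0) (θ 0 + 2 * Real.pi) := by
  obtain ⟨hm, hmn, hleft, hright, -, hray⟩ := hc
  rw [← loop_zero v i, chainEnd, ← loop_natCast v i] at hray
  have hvis₀ : Visible v q (loop v i 0) := by rw [loop_zero]; exact hleft.2
  have hvisR : Visible v q (loop v i (m - 1 : ℕ)) := by rw [loop_natCast]; exact hright.2
  have hvisn : Visible v q (loop v i (0 + n)) := by
    have hperiod : loop v i (0 + n) = loop v i 0 := by simpa using loop_add_int_mul v i 0 1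
    rwa [hperiod]
  have hR : (0 : ℝ) < (m - 1 : ℕ) := by exact_mod_cast (by omega : 0 < m - 1)
  have hRn : ((m - 1 : ℕ) : ℝ) < 0 + n := by rw [zero_add]; exact_mod_cast (by omega : m - 1 < n)
  refine ⟨(h.angle_le_of_visible hR hvis₀ hvisR).lt_of_ne' fun heq => ?_,
    (h.angle_add_period 0 ▸ h.angle_le_of_visible hRn hvisR hvisn).lt_of_ne fun heq => ?_⟩
  · exact h.angle_ne_of_not_sameRay hray 0 (by simpa using heq)
  · exact h.angle_ne_of_not_sameRay hray 1 (by simpa using heq)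

theorem isVisibleWindow (h : PolarView v q i θ ρ) (hc : IsVisibleCriticalChain v q i m) :
    IsVisibleWindow θ ρ {t | Visible v q (loop v i t)} 0 ((m - 1 : ℕ) : ℝ) where
  cont_angle := h.cont_angle
  cont_radius := h.cont_radius
  injective _ _ := h.eq_of_polar_eq
  isClosed := (isClosed_setOf_visible v q).preimage (continuous_loop v i)
  mono _ hs _ ht hst := hst.eq_or_lt.elim (fun heq => heq ▸ le_rfl)
    fun hlt => h.angle_le_of_visible hlt hs ht
  exists_first := h.exists_firstHit
  notMem_Ioo s hs t hθ hρ ht := by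
    obtain ⟨k, rfl, hk⟩ := h.exists_visibleCritical hs hθ hρ
    lift k to ℕ using by exact_mod_cast ht.1.le
    exact hc.2.2.2.2.1 k (by exact_mod_cast ht.1) (by exact_mod_cast ht.2) (by simpa using hk)
  left_mem := by rw [mem_ofPred_eq, loop_zero]; exact hc.2.2.1.2
  right_mem := by rw [mem_ofPred_eq, loop_natCast]; exact hc.2.2.2.1.2
  angle_lt := (h.angle_mem_Ioo hc).1

theorem edgeCross_pos_of_angle_gt (h : PolarView v q i θ ρ) {k : ℤ}
    (ha : a ∈ Ico (k : ℝ) (k + 1)) (hab : a < b) (hlt : ∀ t ∈ Ioo a b, θ a < θ t) :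
    0 < edgeCross v q i k := by
  refine (h.edgeCross_ne k).lt_of_le' (not_lt.1 fun hneg => ?_)
  obtain ⟨t, hat, ht⟩ := exists_between (lt_min ha.2 hab)
  obtain ⟨htk, htb⟩ := lt_min_iff.1 ht
  exact (hlt t ⟨hat, htb⟩).not_gt <|
    h.strictAntiOn_angle hneg (Ico_subset_Icc_self ha) ⟨ha.1.trans hat.le, htk.le⟩ hat

theorem edgeCross_pos_of_angle_lt (h : PolarView v q i θ ρ) {k : ℤ}
    (hb : b ∈ Ioc (k : ℝ) (k + 1)) (hab : a < b) (hlt : ∀ t ∈ Ioo a b, θ t < θ b) :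
    0 < edgeCross v q i k := by
  refine (h.edgeCross_ne k).lt_of_le' (not_lt.1 fun hneg => ?_)
  obtain ⟨t, ht, htb⟩ := exists_between (max_lt hb.1 hab)
  obtain ⟨hkt, hat⟩ := max_lt_iff.1 ht
  exact (hlt t ⟨hat, htb⟩).not_gt <|
    h.strictAntiOn_angle hneg ⟨hkt.le, htb.le.trans hb.2⟩ (Ioc_subset_Icc_self hb) htb

end PolarView

/-- A chain between two consecutive visible critical vertices, in polar coordinates, together with
the parameters `a` and `b` between which it is visible. -/
structure ChainView (v : ZMod n → ℂ) (q : ℂ) (i : ZMod n) (m : ℕ) (θ ρ : ℝ → ℝ) (a b : ℝ) : Prop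
    extends PolarView v q i θ ρ,
      IsVisiblePart θ {t | Visible v q (loop v i t)} 0 ((m - 1 : ℕ) : ℝ) a b where
  isChain : IsVisibleCriticalChain v q i m

theorem exists_chainView (hs : IsSimplePolygon v) (hq : q ∈ inside v)
    (hw : ∀ k : ZMod n, cross (v k - q) (v (k + 1) - q) ≠ 0)
    (hc : IsVisibleCriticalChain v q i m) : ∃ θ ρ a b, ChainView v q i m θ ρ a b := by
  obtain ⟨θ, ρ, h⟩ := exists_polarView i hs hq hw
  obtain ⟨a, b, hab⟩ := (h.isVisibleWindow hc).exists_isVisiblePart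
  exact ⟨θ, ρ, a, b, h, hab, hc⟩

namespace ChainView

theorem left_mem (h : ChainView v q i m θ ρ a b) : a ∈ Icc 0 ((m - 1 : ℕ) : ℝ) :=
  ⟨h.left_le, h.lt.le.trans h.le_right⟩

theorem right_mem (h : ChainView v q i m θ ρ a b) : b ∈ Icc 0 ((m - 1 : ℕ) : ℝ) :=
  ⟨h.left_le.trans h.lt.le, h.le_right⟩

theorem angle_mem_Icc (h : ChainView v q i m θ ρ a b) (ht : t ∈ Icc 0 ((m - 1 : ℕ) : ℝ))
    (hvis : Visible v q (loop v i t)) : θ t ∈ Icc (θ 0) (θ ((m - 1 : ℕ) : ℝ)) :=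
  have hwin := h.isVisibleWindow h.isChain
  ⟨hwin.mono hwin.left_mem hvis ht.1, hwin.mono hvis hwin.right_mem ht.2⟩

theorem visible_and_angle_eq {x y c : ℝ} (h : ChainView v q i m θ ρ a b)
    (hx : Visible v q (loop v i x)) (hxy : θ x = θ y)
    (hy : θ y ∈ Icc (θ 0) (θ ((m - 1 : ℕ) : ℝ))) (ht : t ∈ Icc 0 ((m - 1 : ℕ) : ℝ))
    (hc : 0 < c) (hcs : c ≤ Real.exp (ρ x - ρ y)) (htc : loop v i t = q + c * (loop v i y - q)) :
    Visible v q (loop v i t) ∧ θ t = θ y := by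
  obtain ⟨hρ, j, hj⟩ := h.polar_eq_of_loop_eq hc htc
  have hvis : Visible v q (loop v i t) :=
    h.visible_of_angle_eq hx (j := j) (by rw [hxy, hj]) (by
      linarith [(Real.log_le_iff_le_exp hc).2 hcs])
  have hθ := h.angle_mem_Icc ht hvis
  have hwidth := (h.angle_mem_Ioo h.isChain).2
  have hpi := Real.two_pi_pos
  have hlow : (-1 : ℝ) < j := by nlinarith [hθ.1, hy.2]
  have hup : (j : ℝ) < 1 := by nlinarith [hθ.2, hy.1]
  obtain rfl : j = 0 := by
    have hlow' : -1 < j := by exact_mod_cast hlow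
    have hup' : j < 1 := by exact_mod_cast hup
    omega
  exact ⟨hvis, by simpa using hj⟩

theorem isFrontHit_left (h : ChainView v q i m θ ρ a b) :
    IsFrontHit v q i m 0 a (Real.exp (ρ a - ρ 0)) where
  mem := h.left_mem
  pos := Real.exp_pos _
  loop_eq := h.loop_eq_of_angle_eq (j := 0) (by simp [h.angle_left])
  eq_or_eq t ht c hc hcs htc := by
    have hlt := (h.angle_mem_Ioo h.isChain).1
    obtain ⟨hvis, hθ⟩ := h.visible_and_angle_eq (h.Icc_subset (left_mem_Icc.2 h.lt.le))
      h.angle_left ⟨le_rfl, hlt.le⟩ ht hc hcs htc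
    rcases h.eq_or_mem_or_eq t ⟨hvis, ht⟩ with rfl | htab | rfl
    · exact Or.inl rfl
    · refine Or.inr (htab.1.eq_of_not_lt' fun hat => ?_)
      rcases htab.2.eq_or_lt with rfl | htb
      · exact hlt.ne' (h.angle_right ▸ hθ)
      · exact (h.Ioo_subset ⟨hat, htb⟩).2.1.ne' hθ
    · exact absurd hθ hlt.ne'

theorem isFrontHit_right (h : ChainView v q i m θ ρ a b) :
    IsFrontHit v q i m ((m - 1 : ℕ) : ℝ) b (Real.exp (ρ b - ρ ((m - 1 : ℕ) : ℝ))) where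
  mem := h.right_mem
  pos := Real.exp_pos _
  loop_eq := h.loop_eq_of_angle_eq (j := 0) (by simp [h.angle_right])
  eq_or_eq t ht c hc hcs htc := by
    have hlt := (h.angle_mem_Ioo h.isChain).1
    obtain ⟨hvis, hθ⟩ := h.visible_and_angle_eq (h.Icc_subset (right_mem_Icc.2 h.lt.le))
      h.angle_right ⟨hlt.le, le_rfl⟩ ht hc hcs htc
    rcases h.eq_or_mem_or_eq t ⟨hvis, ht⟩ with rfl | htab | rfl
    · exact absurd hθ hlt.ne
    · refine Or.inr (htab.2.eq_of_not_lt fun htb => ?_)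
      rcases htab.1.eq_or_lt with rfl | hat
      · exact hlt.ne (h.angle_left ▸ hθ)
      · exact (h.Ioo_subset ⟨hat, htb⟩).2.2.ne hθ
    · exact Or.inl rfl

theorem edgeCross_pos_left (h : ChainView v q i m θ ρ a b) {k : ℤ}
    (ha : a ∈ Ico (k : ℝ) (k + 1)) : 0 < edgeCross v q i k :=
  h.edgeCross_pos_of_angle_gt ha h.lt fun _ ht => h.angle_left ▸ (h.Ioo_subset ht).2.1

theorem edgeCross_pos_right (h : ChainView v q i m θ ρ a b) {k : ℤ}
    (hb : b ∈ Ioc (k : ℝ) (k + 1)) : 0 < edgeCross v q i k :=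
  h.edgeCross_pos_of_angle_lt hb h.lt fun _ ht => h.angle_right ▸ (h.Ioo_subset ht).2.2

theorem left_eq_zero (h : ChainView v q i m θ ρ a b) (h0 : 0 < edgeCross v q i 0) : a = 0 := by
  refine h.left_eq ?_
  filter_upwards [Ioo_mem_nhdsGT one_pos] with t ht
  exact h.strictMonoOn_angle h0 (by simp) ⟨by simpa using ht.1.le, by simpa using ht.2.le⟩ ht.1

theorem right_eq_last (h : ChainView v q i m θ ρ a b)
    (hlast : 0 < edgeCross v q i ((m - 1 : ℕ) - 1)) : b = (m - 1 : ℕ) := by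
  refine h.right_eq ?_
  filter_upwards [Ioo_mem_nhdsLT (sub_one_lt _)] with t ht
  have hmono := h.strictMonoOn_angle_left hlast
  simp only [Int.cast_natCast] at hmono
  exact hmono (Ioo_subset_Icc_self ht) ⟨(sub_one_lt _).le, le_rfl⟩ ht.2

theorem isFirstCut (h : ChainView v q i m θ ρ a b) : IsFirstCut v q i m a := by
  have hcrit := h.isChain.2.2.1.1
  have hi : i = i + (0 : ℤ) := by simp
  rw [hi] at hcrit
  refine ⟨fun hmax => ?_, fun hmax => ?_⟩
  · rw [hi] at hmax
    rw [← loop_zero v i]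
    refine h.isFrontHit_left.isNearestHit (fun t => sub_ne_zero.1 (h.loop_ne t)) fun heq => ?_
    obtain rfl : a = 0 := loop_injOn h.simple i h.isChain.2.1 h.left_mem
      ⟨le_rfl, Nat.cast_nonneg _⟩ heq
    exact hmax.edgeCross_neg.not_gt (h.edgeCross_pos_left (by simp))
  · rw [hi] at hmax
    exact h.left_eq_zero (hcrit.resolve_left hmax).edgeCross_pos

theorem isLastCut (h : ChainView v q i m θ ρ a b) : IsLastCut v q i m b := by
  have hcrit := h.isChain.2.2.2.1.1
  have hi : chainEnd i m = i + ((m - 1 : ℕ) : ℤ) := by rw [chainEnd, Int.cast_natCast]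
  refine ⟨fun hmin => ?_, fun hmin => ?_⟩
  · rw [chainEnd, ← loop_natCast v i]
    refine h.isFrontHit_right.isNearestHit (fun t => sub_ne_zero.1 (h.loop_ne t)) fun heq => ?_
    obtain rfl := loop_injOn h.simple i h.isChain.2.1 h.right_mem
      ⟨Nat.cast_nonneg _, le_rfl⟩ heq
    rw [hi] at hmin
    exact hmin.edgeCross_sub_one_neg.not_gt (h.edgeCross_pos_right (by simp))
  · rw [hi] at hmin hcrit
    exact h.right_eq_last (hcrit.resolve_right hmin).edgeCross_sub_one_pos

theorem setOf_visible_eq (h : ChainView v q i m θ ρ a b) :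
    {x ∈ chain v i m | Visible v q x} = {v i} ∪ curve v i '' Icc a b ∪ {v (chainEnd i m)} := by
  have hfirst : curve v i 0 = v i := by rw [curve_eq_loop v i le_rfl, loop_zero]
  have hlast : curve v i (m - 1 : ℕ) = v (chainEnd i m) := by
    rw [curve_eq_loop v i (Nat.cast_nonneg _), loop_natCast, chainEnd]
  ext x
  constructor
  · rintro ⟨⟨t, ht, rfl⟩, hvis⟩
    rw [curve_eq_loop v i ht.1] at hvis
    rcases h.eq_or_mem_or_eq t ⟨hvis, ht⟩ with rfl | htab | rfl
    · exact Or.inl (Or.inl hfirst)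
    · exact Or.inl (Or.inr ⟨t, htab, rfl⟩)
    · exact Or.inr hlast
  · rintro ((rfl | ⟨t, ht, rfl⟩) | rfl)
    · exact ⟨⟨0, ⟨le_rfl, Nat.cast_nonneg _⟩, hfirst⟩, h.isChain.2.2.1.2⟩
    · have ht0 := h.left_le.trans ht.1
      refine ⟨⟨t, ⟨ht0, ht.2.trans h.le_right⟩, rfl⟩, ?_⟩
      rw [curve_eq_loop v i ht0]
      exact h.Icc_subset ht
    · exact ⟨⟨_, ⟨Nat.cast_nonneg _, le_rfl⟩, hlast⟩, h.isChain.2.2.2.1.2⟩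

end ChainView

/-- The point `A`, with parameter `a`, lies on the `k`-th edge of the chain, and this is the edge
that `LeavesRay` singles out, so that an algorithm can find it. -/
structure IsFirstCutEdge (v : ZMod n → ℂ) (q : ℂ) (i : ZMod n) (m : ℕ) (a : ℝ) (k : ℕ) :
    Prop where
  mem : a ∈ Ico (k : ℝ) (k + 1)
  isNearestEdge : IsNearestEdge (chainInput v q i m).read q (v i - q) m
    (LeavesRay (chainInput v q i m).read q (v i - q)) k
  curve_eq : curve v i a = q + (edgeNum (chainInput v q i m).read q k /
    edgeDen (chainInput v q i m).read q (v i - q) k : ℝ) * (v i - q)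

/-- The point `B`, with parameter `b`, lies on the `k`-th edge of the chain, and this is the edge
that `ReachesRay` singles out, so that an algorithm can find it. -/
structure IsLastCutEdge (v : ZMod n → ℂ) (q : ℂ) (i : ZMod n) (m : ℕ) (b : ℝ) (k : ℕ) :
    Prop where
  mem : b ∈ Ioc (k : ℝ) (k + 1)
  isNearestEdge : IsNearestEdge (chainInput v q i m).read q (v (chainEnd i m) - q) m
    (ReachesRay (chainInput v q i m).read q (v (chainEnd i m) - q)) k
  curve_eq : curve v i b = q + (edgeNum (chainInput v q i m).read q k /
    edgeDen (chainInput v q i m).read q (v (chainEnd i m) - q) k : ℝ) * (v (chainEnd i m) - q)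

namespace ChainView

theorem isFirstCutEdge (h : ChainView v q i m θ ρ a b) : IsFirstCutEdge v q i m a ⌊a⌋₊ := by
  have hmem : a ∈ Ico (⌊a⌋₊ : ℝ) (⌊a⌋₊ + 1) :=
    ⟨Nat.floor_le h.left_le, Nat.lt_floor_add_one a⟩
  have hk : ⌊a⌋₊ + 1 < m := by
    have := (Nat.floor_lt h.left_le).2 (h.lt.trans_le h.le_right)
    omega
  have hnum : 0 < edgeNum (chainInput v q i m).read q ⌊a⌋₊ := by
    rw [edgeNum_read_chainInput v q i hk]
    exact h.edgeCross_pos_left (by simpa using hmem)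
  have hnearest := h.isFrontHit_left.isNearestEdge_leavesRay hk hmem hnum fun j hj hpos hmem0 => by
    obtain rfl : j = 0 := by exact_mod_cast hmem0.1.antisymm (Nat.cast_nonneg j)
    rw [edgeNum_read_chainInput v q i hj] at hpos
    exact (h.left_eq_zero hpos).symm
  have hcurve := h.isFrontHit_left.loop_eq
  rw [h.isFrontHit_left.eq_div hk (Ico_subset_Icc_self hmem) hnearest.2.1.edgeDen_pos,
    ← curve_eq_loop v i h.left_le] at hcurve
  rw [loop_zero] at hcurve hnearest
  exact ⟨hmem, hnearest, hcurve⟩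

theorem isLastCutEdge (h : ChainView v q i m θ ρ a b) :
    IsLastCutEdge v q i m b (⌈b⌉₊ - 1) := by
  have hb : 0 < b := h.left_le.trans_lt h.lt
  obtain ⟨k, hceil⟩ := Nat.exists_eq_succ_of_ne_zero (Nat.ceil_pos.2 hb).ne'
  have hmem : b ∈ Ioc (k : ℝ) (k + 1) := by
    simpa using (Nat.ceil_eq_iff k.succ_ne_zero).1 hceil
  have hk : k + 1 < m := by
    have : k < m - 1 := by exact_mod_cast hmem.1.trans_le h.le_right
    omega
  have hnum : 0 < edgeNum (chainInput v q i m).read q k := by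
    rw [edgeNum_read_chainInput v q i hk]
    exact h.edgeCross_pos_right (by simpa using hmem)
  have hnearest := h.isFrontHit_right.isNearestEdge_reachesRay hk hmem hnum
    fun j hj hpos hmemR => by
      have hjR : m - 1 ≤ j + 1 := by exact_mod_cast hmemR.2
      rw [edgeNum_read_chainInput v q i hj] at hpos
      have hj1 : (j : ℤ) = (m - 1 : ℕ) - 1 := by omega
      exact (h.right_eq_last (hj1 ▸ hpos)).symm
  have hcurve := h.isFrontHit_right.loop_eq
  rw [h.isFrontHit_right.eq_div hk (Ioc_subset_Icc_self hmem) hnearest.2.1.edgeDen_pos,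
    ← curve_eq_loop v i hb.le] at hcurve
  rw [loop_natCast] at hcurve hnearest
  rw [hceil, Nat.succ_sub_one]
  exact ⟨hmem, hnearest, hcurve⟩

end ChainView

end Cuts

/-! ### Executing code -/

section Execution

variable {α β : ℕ} {prog l : List (Instr α β)} {I : Input} {b : ℕ} {c : Config α β}

/-- The code `l` is found in the program from line `b` on. -/
def CodeAt (prog : List (Instr α β)) (b : ℕ) (l : List (Instr α β)) : Prop :=
  ∀ j ins, l[j]? = some ins → prog[b + j]? = some ins

theorem codeAt_self (prog : List (Instr α β)) : CodeAt prog 0 prog := fun j ins hj => by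
  rwa [zero_add]

theorem CodeAt.append {l₁ l₂ : List (Instr α β)} (h : CodeAt prog b (l₁ ++ l₂)) :
    CodeAt prog b l₁ ∧ CodeAt prog (b + l₁.length) l₂ := by
  refine ⟨fun j ins hj => h j ins ?_, fun j ins hj => ?_⟩
  · rw [List.getElem?_append_left (List.getElem?_eq_some_iff.1 hj).1, hj]
  · rw [add_assoc]
    refine h _ ins ?_
    rw [List.getElem?_append_right (by lia), Nat.add_sub_cancel_left, hj]

/-- An instruction that is not a jump. -/
def Instr.isStraight : Instr α β → Bool
  | .jump _ => false
  | .jumpIdxLT _ _ _ => false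
  | .jumpNumLT _ _ _ => false
  | _ => true

theorem Instr.exec_pc {ins : Instr α β} (h : ins.isStraight = true) (c : Config α β) :
    (ins.exec I c).pc = c.pc + 1 := by
  cases ins <;> simp_all [Instr.isStraight, Instr.exec]

/-- The effect of jump-free code. -/
noncomputable def execList (I : Input) (c : Config α β) (l : List (Instr α β)) : Config α β :=
  l.foldl (fun c ins => ins.exec I c) c

theorem step_eq_exec {ins : Instr α β} (h : prog[c.pc]? = some ins) :
    step prog I c = ins.exec I c := by
  rw [step, h]

theorem iterate_step_eq_execList (hl : l.all Instr.isStraight = true) (h : CodeAt prog c.pc l) :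
    (step prog I)^[l.length] c = execList I c l := by
  induction l generalizing c with
  | nil => rfl
  | cons ins l ih =>
    simp only [List.all_cons, Bool.and_eq_true] at hl
    rw [List.length_cons, Function.iterate_succ_apply, step_eq_exec (h 0 ins rfl)]
    refine ih hl.2 fun j ins' hj => ?_
    rw [Instr.exec_pc hl.1, add_assoc, add_comm 1 j]
    exact h (j + 1) ins' (by simpa using hj)

/-- `c'` is reached from `c` in at most `t` steps. -/
def Reaches (prog : List (Instr α β)) (I : Input) (c : Config α β) (t : ℕ) (c' : Config α β) :
    Prop := ∃ s ≤ t, (step prog I)^[s] c = c'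

theorem Reaches.refl (c : Config α β) : Reaches prog I c 0 c := ⟨0, le_rfl, rfl⟩

theorem Reaches.trans {c c' c'' : Config α β} {s t : ℕ} (h : Reaches prog I c s c')
    (h' : Reaches prog I c' t c'') : Reaches prog I c (s + t) c'' := by
  obtain ⟨s', hs, rfl⟩ := h
  obtain ⟨t', ht, rfl⟩ := h'
  exact ⟨t' + s', by lia, Function.iterate_add_apply _ _ _ _⟩

theorem Reaches.mono {c c' : Config α β} {s t : ℕ} (h : Reaches prog I c s c') (hst : s ≤ t) :
    Reaches prog I c t c' := by
  obtain ⟨s', hs, h⟩ := h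
  exact ⟨s', hs.trans hst, h⟩

theorem CodeAt.reaches_execList (h : CodeAt prog b l) (hb : c.pc = b)
    (hl : l.all Instr.isStraight = true) : Reaches prog I c l.length (execList I c l) :=
  ⟨l.length, le_rfl, iterate_step_eq_execList hl (hb ▸ h)⟩

theorem CodeAt.reaches_exec (h : CodeAt prog b l) {j : ℕ} {ins : Instr α β}
    (hj : l[j]? = some ins) (hc : c.pc = b + j) : Reaches prog I c 1 (ins.exec I c) :=
  ⟨1, le_rfl, step_eq_exec (hc ▸ h j ins hj)⟩

/-- Code that continues at line `yes` if the index `x` is less than `y`, and at line `no`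
otherwise. -/
def idxBranch (x y : Fin α) (yes no : ℕ) : List (Instr α β) := [.jumpIdxLT x y yes, .jump no]

/-- Code that continues at line `yes` if the number `r` is less than `s`, and at line `no`
otherwise. -/
def numBranch (r s : Fin β) (yes no : ℕ) : List (Instr α β) := [.jumpNumLT r s yes, .jump no]

theorem CodeAt.reaches_idxBranch {x y : Fin α} {yes no : ℕ}
    (h : CodeAt prog b (idxBranch x y yes no)) (hc : c.pc = b) :
    Reaches prog I c 2 { c with pc := if c.idx x < c.idx y then yes else no } := by
  have hfirst := h.reaches_exec (I := I) (j := 0) rfl hc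
  split_ifs with hlt
  · simp only [Instr.exec, hlt, if_true] at hfirst
    exact hfirst.mono one_le_two
  · simp only [Instr.exec, hlt, if_false] at hfirst
    exact hfirst.trans (h.reaches_exec (j := 1) rfl (congrArg (· + 1) hc))

theorem CodeAt.reaches_numBranch {r s : Fin β} {yes no : ℕ}
    (h : CodeAt prog b (numBranch r s yes no)) (hc : c.pc = b) :
    Reaches prog I c 2 { c with pc := if c.num r < c.num s then yes else no } := by
  have hfirst := h.reaches_exec (I := I) (j := 0) rfl hc
  split_ifs with hlt
  · simp only [Instr.exec, hlt, if_true] at hfirst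
    exact hfirst.mono one_le_two
  · simp only [Instr.exec, hlt, if_false] at hfirst
    exact hfirst.trans (h.reaches_exec (j := 1) rfl (congrArg (· + 1) hc))

end Execution

/-! ### The scan for the nearest edge -/

/-- Among the first `k` edges with property `cand`, the `r`-th one meets the ray nearest to `q`, at
position `N / D`. If there is no such edge, then `N / D` is `1 / 0`, which loses every comparison by
cross multiplication. -/
def IsBest (p : ℕ → ℂ) (q d : ℂ) (cand : ℕ → Prop) (k : ℕ) (r : ℕ) (N D : ℝ) : Prop :=
  (N = 1 ∧ D = 0 ∧ ∀ j < k, ¬ cand j) ∨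
  (r < k ∧ cand r ∧ N = edgeNum p q r ∧ D = edgeDen p q d r ∧
    ∀ j < k, cand j → edgeNum p q r * edgeDen p q d j ≤ edgeNum p q j * edgeDen p q d r)

namespace IsBest

variable {p : ℕ → ℂ} {q d : ℂ} {cand : ℕ → Prop} {k r : ℕ} {N D : ℝ}

theorem skip (h : IsBest p q d cand k r N D) (hpos : ∀ j, cand j → 0 < edgeDen p q d j)
    (hk : ¬ (cand k ∧ edgeNum p q k * D < N * edgeDen p q d k)) :
    IsBest p q d cand (k + 1) r N D := by
  rcases h with ⟨rfl, rfl, h⟩ | ⟨hr, hcr, rfl, rfl, h⟩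
  · refine Or.inl ⟨rfl, rfl, fun j hj hcj => ?_⟩
    rcases Nat.lt_succ_iff_lt_or_eq.1 hj with hj | rfl
    · exact h j hj hcj
    · exact hk ⟨hcj, by simpa using hpos j hcj⟩
  · refine Or.inr ⟨by lia, hcr, rfl, rfl, fun j hj hcj => ?_⟩
    rcases Nat.lt_succ_iff_lt_or_eq.1 hj with hj | rfl
    · exact h j hj hcj
    · exact not_lt.1 fun hlt => hk ⟨hcj, hlt⟩

theorem update (h : IsBest p q d cand k r N D) (hpos : ∀ j, cand j → 0 < edgeDen p q d j)
    (hck : cand k) (hk : edgeNum p q k * D < N * edgeDen p q d k) :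
    IsBest p q d cand (k + 1) k (edgeNum p q k) (edgeDen p q d k) := by
  refine Or.inr ⟨by lia, hck, rfl, rfl, fun j hj hcj => ?_⟩
  rcases Nat.lt_succ_iff_lt_or_eq.1 hj with hj | rfl
  · rcases h with ⟨-, -, h⟩ | ⟨-, hcr, rfl, rfl, h⟩
    · exact absurd hcj (h j hj)
    · have hrj := h j hj hcj
      rw [← div_le_div_iff₀ (hpos r hcr) (hpos j hcj)] at hrj
      rw [← div_lt_div_iff₀ (hpos k hck) (hpos r hcr)] at hk
      rw [← div_le_div_iff₀ (hpos k hck) (hpos j hcj)]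
      exact hk.le.trans hrj
  · exact le_rfl

theorem eq_of_isNearestEdge {k₀ : ℕ} (h : IsBest p q d cand k r N D)
    (hk₀ : IsNearestEdge p q d (k + 1) cand k₀) :
    r = k₀ ∧ N = edgeNum p q k₀ ∧ D = edgeDen p q d k₀ := by
  obtain ⟨hlt, hcand, hmin⟩ := hk₀
  rcases h with ⟨-, -, h⟩ | ⟨hr, hcr, rfl, rfl, h⟩
  · exact absurd hcand (h k₀ (by lia))
  · obtain rfl : r = k₀ := by
      by_contra hne
      exact (h k₀ (by lia) hcand).not_gt (hmin r (by lia) hcr hne)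
    exact ⟨rfl, rfl, rfl⟩

end IsBest

/-- Number register `0` holds `0`, register `23` holds `1`, registers `1` and `2` the viewpoint,
registers `3` and `4` the direction `d` of a ray, and index register `2` the number of vertices. -/
structure Aimed (I : Input) (d : ℂ) (c : Config 6 24) : Prop where
  len : c.idx 2 = I.len
  zero : c.num 0 = 0
  one : c.num 23 = 1
  query_re : c.num 1 = I.query.re
  query_im : c.num 2 = I.query.im
  dir_re : c.num 3 = d.re
  dir_im : c.num 4 = d.im

/-- Number registers `11` to `14` hold the data of the `k`-th edge, and registers `17` and `18` the
two sides of the inequality that decides whether it beats the fraction in registers `15`, `16`. -/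
structure HoldsEdge (I : Input) (d : ℂ) (k : ℕ) (c : Config 6 24) : Prop where
  cross_left : c.num 11 = cross d (I.read k - I.query)
  cross_right : c.num 12 = cross d (I.read (k + 1) - I.query)
  edgeNum_eq : c.num 13 = edgeNum I.read I.query k
  edgeDen_eq : c.num 14 = edgeDen I.read I.query d k
  left_eq : c.num 17 = edgeNum I.read I.query k * c.num 16
  right_eq : c.num 18 = c.num 15 * edgeDen I.read I.query d k

/-- Number registers `15` and `16` hold the fraction that says where the `k`-th edge meets the
ray in direction `d`. -/
structure HoldsHit (I : Input) (d : ℂ) (k : ℕ) (c : Config 6 24) : Prop extends Aimed I d c where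
  hitNum : c.num 15 = edgeNum I.read I.query k
  hitDen : c.num 16 = edgeDen I.read I.query d k

/-- Aim at the vertex whose index is in register `5`, and set the best fraction to `1 / 0`
and the edge, whose ends have their indices in registers `0` and `1`, to the first one. -/
def scanSetup : List (Instr 6 24) :=
  [.readX 19 5, .readY 20 5, .sub 3 19 1, .sub 4 20 2, .numConst 15 1, .numConst 16 0,
    .idxConst 0 0, .idxConst 1 1]

/-- Compute the data of the current edge. -/
def scanBody : List (Instr 6 24) :=
  [.readX 19 0, .readY 20 0, .sub 5 19 1, .sub 6 20 2, .readX 19 1, .readY 20 1, .sub 7 19 1,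
    .sub 8 20 2, .mul 9 3 6, .mul 10 4 5, .sub 11 9 10, .mul 9 3 8, .mul 10 4 7, .sub 12 9 10,
    .mul 9 5 8, .mul 10 6 7, .sub 13 9 10, .sub 14 12 11, .mul 17 13 16, .mul 18 15 14]

/-- Continue at line `yes` if the current edge is a candidate that beats the best one, and at line
`no` otherwise. The registers `r₁`, `s₁`, `r₂`, `s₂` select the kind of candidates. -/
def scanTest (b yes no : ℕ) (r₁ s₁ r₂ s₂ : Fin 24) : List (Instr 6 24) :=
  numBranch r₁ s₁ no (b + 2) ++ (numBranch r₂ s₂ (b + 4) no ++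
    (numBranch 0 13 (b + 6) no ++ numBranch 17 18 yes no))

/-- Make the current edge the best one. -/
def scanUpdate (res : Fin 6) : List (Instr 6 24) := [.add 15 13 0, .add 16 14 0, .idxCopy res 0]

/-- Go to the next edge. -/
def scanNext : List (Instr 6 24) := [.idxSucc 0, .idxSucc 1]

/-- The scan, to be placed at line `b`: it leaves in the index register `res` the number of the
nearest candidate, and in the number registers `15`, `16` its fraction. -/
def scan (b : ℕ) (res : Fin 6) (r₁ s₁ r₂ s₂ : Fin 24) : List (Instr 6 24) :=
  scanSetup ++ (idxBranch 1 2 (b + 10) (b + 44) ++ (scanBody ++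
    (scanTest (b + 30) (b + 38) (b + 41) r₁ s₁ r₂ s₂ ++
      (scanUpdate res ++ (scanNext ++ [.jump (b + 8)])))))

/-- The edges with property `cand` pass the ray in direction `d` counterclockwise, and are the ones
that the comparisons of the registers `r₁`, `s₁` and `r₂`, `s₂` in `scanTest` let pass. -/
structure IsCandidateTest (I : Input) (d : ℂ) (cand : ℕ → Prop) (r₁ s₁ r₂ s₂ : Fin 24) : Prop where
  edgeDen_pos : ∀ k, cand k → 0 < edgeDen I.read I.query d k
  iff : ∀ k c, Aimed I d c → HoldsEdge I d k c →
    (cand k ↔ ¬ c.num r₁ < c.num s₁ ∧ c.num r₂ < c.num s₂ ∧ 0 < edgeNum I.read I.query k)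

theorem isCandidateTest_leavesRay (I : Input) (d : ℂ) :
    IsCandidateTest I d (LeavesRay I.read I.query d) 0 11 0 12 where
  edgeDen_pos _ h := h.edgeDen_pos
  iff k c ha he := by
    rw [ha.zero, he.cross_left, he.cross_right, LeavesRay, not_lt, and_rotate]

theorem isCandidateTest_reachesRay (I : Input) (d : ℂ) :
    IsCandidateTest I d (ReachesRay I.read I.query d) 12 0 11 0 where
  edgeDen_pos _ h := h.edgeDen_pos
  iff k c ha he := by
    rw [ha.zero, he.cross_left, he.cross_right, ReachesRay, not_lt]
    tauto

/-- The state of a scan that was started in `c₀`: the current edge is the `k`-th one, and the first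
`l` edges have been examined. -/
structure ScanInv (I : Input) (d : ℂ) (cand : ℕ → Prop) (res : Fin 6) (c₀ : Config 6 24)
    (k l : ℕ) (c : Config 6 24) : Prop extends Aimed I d c where
  out : c.out = c₀.out
  idx_left : c.idx 0 = k
  idx_right : c.idx 1 = k + 1
  idx_other : ∀ x, 1 < x → x ≠ res → c.idx x = c₀.idx x
  best : IsBest I.read I.query d cand l (c.idx res) (c.num 15) (c.num 16)

section Scan

variable {prog : List (Instr 6 24)} {I : Input} {d : ℂ} {cand : ℕ → Prop} {b : ℕ} {res : Fin 6}
  {r₁ s₁ r₂ s₂ : Fin 24} {c₀ c : Config 6 24} {k l : ℕ}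

theorem CodeAt.reaches_scanTest {yes no : ℕ} (hcode : CodeAt prog b (scanTest b yes no r₁ s₁ r₂ s₂))
    (hpc : c.pc = b) : Reaches prog I c 8 { c with
      pc := if ¬ c.num r₁ < c.num s₁ ∧ c.num r₂ < c.num s₂ ∧ c.num 0 < c.num 13 ∧
        c.num 17 < c.num 18 then yes else no } := by
  obtain ⟨hcode₁, hcode⟩ := hcode.append
  obtain ⟨hcode₂, hcode⟩ := hcode.append
  obtain ⟨hcode₃, hcode₄⟩ := hcode.append
  have reach₁ := hcode₁.reaches_numBranch (I := I) hpc
  by_cases h₁ : c.num r₁ < c.num s₁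
  · simpa only [h₁, if_true, not_true, false_and, if_false] using reach₁.mono (by decide)
  rw [if_neg h₁] at reach₁
  have reach₂ := reach₁.trans (hcode₂.reaches_numBranch rfl)
  by_cases h₂ : c.num r₂ < c.num s₂
  swap
  · simpa only [h₂, false_and, and_false, if_false] using reach₂.mono (by decide)
  simp only [h₂, if_true] at reach₂
  have reach₃ := reach₂.trans (hcode₃.reaches_numBranch rfl)
  by_cases h₃ : c.num 0 < c.num 13
  swap
  · simpa only [h₃, false_and, and_false, if_false] using reach₃.mono (by decide)
  simp only [h₃, if_true] at reach₃
  simpa only [h₁, h₂, h₃, not_false_eq_true, true_and] using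
    reach₃.trans (hcode₄.reaches_numBranch rfl)

namespace ScanInv

theorem setPc (h : ScanInv I d cand res c₀ k l c) (p : ℕ) :
    ScanInv I d cand res c₀ k l { c with pc := p } := { h with }

theorem scanSetup {d' : ℂ} (h : Aimed I d' c) :
    ScanInv I (I.read (c.idx 5) - I.query) cand res c 0 0 (execList I c scanSetup) where
  len := h.len
  zero := h.zero
  one := h.one
  query_re := h.query_re
  query_im := h.query_im
  dir_re := congrArg ((I.read (c.idx 5)).re - ·) h.query_re
  dir_im := congrArg ((I.read (c.idx 5)).im - ·) h.query_im
  out := rfl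
  idx_left := rfl
  idx_right := rfl
  idx_other x hx _ := by
    have hx0 : x ≠ 0 := ((Fin.zero_le 1).trans_lt hx).ne'
    simp [execList, ChainVisibility.scanSetup, Instr.exec, hx.ne', hx0]
  best := Or.inl ⟨Int.cast_one, Int.cast_zero, fun j hj => absurd hj j.not_lt_zero⟩

theorem scanBody (h : ScanInv I d cand res c₀ k l c) :
    ScanInv I d cand res c₀ k l (execList I c scanBody) :=
  { h with }

theorem scanNext (h : ScanInv I d cand res c₀ k l c) (hres : 2 < res) :
    ScanInv I d cand res c₀ (k + 1) l (execList I c scanNext) := by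
  have hidx : ∀ x, 1 < x → (execList I c ChainVisibility.scanNext).idx x = c.idx x := by
    intro x hx
    have hx0 : x ≠ 0 := ((Fin.zero_le 1).trans_lt hx).ne'
    simp [execList, ChainVisibility.scanNext, Instr.exec, hx.ne', hx0]
  exact { h with
    idx_left := congrArg (· + 1) h.idx_left
    idx_right := congrArg (· + 1) h.idx_right
    idx_other := fun x hx hxr => (hidx x hx).trans (h.idx_other x hx hxr)
    best := by rw [hidx res (lt_trans (by decide) hres)]; exact h.best }

theorem scanUpdate (h : ScanInv I d cand res c₀ k k c) (he : HoldsEdge I d k c) (hres : 2 < res)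
    (hpos : ∀ j, cand j → 0 < edgeDen I.read I.query d j) (hcand : cand k)
    (hlt : edgeNum I.read I.query k * c.num 16 < c.num 15 * edgeDen I.read I.query d k) :
    ScanInv I d cand res c₀ k (k + 1) (execList I c (scanUpdate res)) := by
  have hidx : ∀ x, x ≠ res → (execList I c (ChainVisibility.scanUpdate res)).idx x = c.idx x :=
    fun x hx => Function.update_of_ne hx _ _
  have hself : (execList I c (ChainVisibility.scanUpdate res)).idx res = k :=
    (Function.update_self res _ c.idx).trans h.idx_left
  have hnum : (execList I c (ChainVisibility.scanUpdate res)).num 15 = edgeNum I.read I.query k :=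
    (congrArg₂ (· + ·) he.edgeNum_eq h.zero).trans (add_zero _)
  have hden : (execList I c (ChainVisibility.scanUpdate res)).num 16 =
      edgeDen I.read I.query d k := (congrArg₂ (· + ·) he.edgeDen_eq h.zero).trans (add_zero _)
  exact { h with
    len := (hidx 2 hres.ne).trans h.len
    idx_left := (hidx 0 ((Fin.zero_le 2).trans_lt hres).ne).trans h.idx_left
    idx_right := (hidx 1 (lt_trans (by decide : (1 : Fin 6) < 2) hres).ne).trans h.idx_right
    idx_other := fun x hx hxr => (hidx x hxr).trans (h.idx_other x hx hxr)
    best := by rw [hself, hnum, hden]; exact h.best.update hpos hcand hlt }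

theorem skip (h : ScanInv I d cand res c₀ k k c)
    (hpos : ∀ j, cand j → 0 < edgeDen I.read I.query d j)
    (hk : ¬ (cand k ∧
      edgeNum I.read I.query k * c.num 16 < c.num 15 * edgeDen I.read I.query d k)) :
    ScanInv I d cand res c₀ k (k + 1) c :=
  { h with best := h.best.skip hpos hk }

theorem holdsEdge (h : ScanInv I d cand res c₀ k l c) :
    HoldsEdge I d k (execList I c ChainVisibility.scanBody) := by
  simp only [execList, ChainVisibility.scanBody, Instr.exec, List.foldl_cons, List.foldl_nil]
  constructor <;> simp [edgeNum, edgeDen, cross, h.query_re, h.query_im, h.dir_re, h.dir_im,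
    h.idx_left, h.idx_right]

end ScanInv

theorem IsCandidateTest.iff_lt (ht : IsCandidateTest I d cand r₁ s₁ r₂ s₂) (ha : Aimed I d c)
    (he : HoldsEdge I d k c) :
    (¬ c.num r₁ < c.num s₁ ∧ c.num r₂ < c.num s₂ ∧ c.num 0 < c.num 13 ∧ c.num 17 < c.num 18) ↔
      cand k ∧ edgeNum I.read I.query k * c.num 16 < c.num 15 * edgeDen I.read I.query d k := by
  rw [ht.iff k c ha he, ha.zero, he.edgeNum_eq, he.left_eq, he.right_eq, and_assoc, and_assoc]

theorem exists_reaches_scanUpdate (hupdate : CodeAt prog b (scanUpdate res)) (hres : 2 < res)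
    (ht : IsCandidateTest I d cand r₁ s₁ r₂ s₂) (h : ScanInv I d cand res c₀ k k c)
    (he : HoldsEdge I d k c) {p : ℕ}
    (hp : p = if ¬ c.num r₁ < c.num s₁ ∧ c.num r₂ < c.num s₂ ∧ c.num 0 < c.num 13 ∧
      c.num 17 < c.num 18 then b else b + 3) :
    ∃ c', Reaches prog I { c with pc := p } 3 c' ∧ c'.pc = b + 3 ∧
      ScanInv I d cand res c₀ k (k + 1) c' := by
  split_ifs at hp with hk <;> rw [ht.iff_lt h.toAimed he] at hk
  · exact ⟨_, hupdate.reaches_execList hp rfl, congrArg (· + 3) hp,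
      (h.setPc p).scanUpdate { he with } hres ht.edgeDen_pos hk.1 hk.2⟩
  · exact ⟨_, (Reaches.refl _).mono (Nat.zero_le 3), hp, (h.skip ht.edgeDen_pos hk).setPc p⟩

theorem exists_reaches_scanRound (hcode : CodeAt prog b (scan b res r₁ s₁ r₂ s₂)) (hres : 2 < res)
    (ht : IsCandidateTest I d cand r₁ s₁ r₂ s₂) (hk : k + 1 < I.len) (hpc : c.pc = b + 8)
    (h : ScanInv I d cand res c₀ k k c) :
    ∃ c', Reaches prog I c 36 c' ∧ c'.pc = b + 8 ∧
      ScanInv I d cand res c₀ (k + 1) (k + 1) c' := by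
  obtain ⟨-, hcode⟩ := hcode.append
  obtain ⟨hhead, hcode⟩ := hcode.append
  obtain ⟨hbody, hcode⟩ := hcode.append
  obtain ⟨htest, hcode⟩ := hcode.append
  obtain ⟨hupdate, hcode⟩ := hcode.append
  obtain ⟨hnext, hjump⟩ := hcode.append
  have reach_head := hhead.reaches_idxBranch (I := I) hpc
  rw [if_pos (by rw [h.idx_right, h.len]; exact hk)] at reach_head
  have reach_body := hbody.reaches_execList (I := I) (c := { c with pc := b + 10 }) rfl rfl
  have hinv := (h.setPc (b + 10)).scanBody
  have reach_test := htest.reaches_scanTest (I := I)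
    (c := execList I { c with pc := b + 10 } scanBody) rfl
  obtain ⟨c₁, reach_update, hpc₁, hinv₁⟩ :=
    exists_reaches_scanUpdate hupdate hres ht hinv (h.setPc (b + 10)).holdsEdge rfl
  have reach_next := hnext.reaches_execList (I := I) (c := c₁) hpc₁ rfl
  have reach_jump := hjump.reaches_exec (I := I) (c := execList I c₁ scanNext) (j := 0) rfl
    (congrArg (· + 2) hpc₁)
  exact ⟨_, ((((reach_head.trans reach_body).trans reach_test).trans reach_update).trans
    reach_next).trans reach_jump, rfl, (hinv₁.scanNext hres).setPc _⟩

theorem exists_reaches_scanRounds (hcode : CodeAt prog b (scan b res r₁ s₁ r₂ s₂)) (hres : 2 < res)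
    (ht : IsCandidateTest I d cand r₁ s₁ r₂ s₂) (hpc : c.pc = b + 8)
    (h : ScanInv I d cand res c₀ 0 0 c) (hk : k < I.len) :
    ∃ c', Reaches prog I c (36 * k) c' ∧ c'.pc = b + 8 ∧ ScanInv I d cand res c₀ k k c' := by
  induction k with
  | zero => exact ⟨c, Reaches.refl _, hpc, h⟩
  | succ k ih =>
    obtain ⟨c₁, reach₁, hpc₁, hinv₁⟩ := ih (Nat.lt_of_succ_lt hk)
    obtain ⟨c₂, reach₂, hpc₂, hinv₂⟩ := exists_reaches_scanRound hcode hres ht hk hpc₁ hinv₁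
    exact ⟨c₂, reach₁.trans reach₂, hpc₂, hinv₂⟩

theorem exists_reaches_scan {d' : ℂ} (hcode : CodeAt prog b (scan b res r₁ s₁ r₂ s₂))
    (hres : 2 < res) (ht : IsCandidateTest I d cand r₁ s₁ r₂ s₂) (ha : Aimed I d' c)
    (hd : I.read (c.idx 5) - I.query = d) (hk : IsNearestEdge I.read I.query d I.len cand k)
    (hpc : c.pc = b) :
    ∃ c', Reaches prog I c (36 * I.len) c' ∧ c'.pc = b + 44 ∧ HoldsHit I d k c' ∧
      c'.out = c.out ∧ c'.idx res = k ∧ ∀ x, 1 < x → x ≠ res → c'.idx x = c.idx x := by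
  subst hd
  obtain ⟨hsetup, hrest⟩ := hcode.append
  obtain ⟨hhead, -⟩ := hrest.append
  obtain ⟨len, hlen⟩ := Nat.exists_eq_succ_of_ne_zero (Nat.ne_zero_of_lt hk.1)
  have reach_setup := hsetup.reaches_execList (I := I) hpc rfl
  obtain ⟨c₁, reach_rounds, hpc₁, hinv⟩ := exists_reaches_scanRounds hcode hres ht
    (congrArg (· + 8) hpc) (ScanInv.scanSetup ha) (hlen ▸ len.lt_succ_self)
  have reach_head := hhead.reaches_idxBranch (I := I) hpc₁
  rw [if_neg (by rw [hinv.idx_right, hinv.len]; exact hlen.le.not_gt)] at reach_head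
  obtain ⟨hidx, hnum, hden⟩ := hinv.best.eq_of_isNearestEdge (hlen ▸ hk)
  refine ⟨_, ((reach_setup.trans reach_rounds).trans reach_head).mono ?_, rfl,
    { hinv.setPc (b + 44) with hitNum := hnum, hitDen := hden }, hinv.out, hidx, hinv.idx_other⟩
  simp only [scanSetup, List.length_cons, List.length_nil]
  lia

end Scan

/-! ### The program -/

/-- Read the viewpoint and the number of vertices, and select the first vertex in register `5`. -/
def selectFirst : List (Instr 6 24) :=
  [.queryX 1, .queryY 2, .numConst 23 1, .idxLen 2, .idxConst 5 0]

/-- Select the last vertex. -/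
def selectLast : List (Instr 6 24) := [.idxLen 5, .idxPred 5]

/-- Write the selected vertex. -/
def writeVertex : List (Instr 6 24) := [.readX 19 5, .readY 20 5, .write 19 20 23]

/-- Write the point in which the best edge of the last scan meets the ray. -/
def writeHit : List (Instr 6 24) :=
  [.mul 17 1 16, .mul 18 15 3, .add 21 17 18, .mul 17 2 16, .mul 18 15 4, .add 22 17 18,
    .write 21 22 16]

/-- Write the next vertex after the one whose index is in register `3`. -/
def writeNext : List (Instr 6 24) := [.idxSucc 3, .readX 19 3, .readY 20 3, .write 19 20 23]

/-- The loop, to be placed at line `b`, that writes the vertices after the result in register `3`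
up to the one in register `4`. -/
def vertexLoop (b : ℕ) : List (Instr 6 24) :=
  idxBranch 3 4 (b + 2) (b + 7) ++ (writeNext ++ [.jump b])

/-- The algorithm of the theorem: the first scan looks for the edge of `A` among those that leave
the ray through the first vertex, the second one for that of `B` among those that reach the ray
through the last vertex. The numbers `5`, `61` and `105` are the lines at which the two scans and
the loop begin. -/
def program : List (Instr 6 24) :=
  selectFirst ++ (scan 5 3 0 11 0 12 ++ ((writeVertex ++ writeHit ++ selectLast) ++
    (scan 61 4 12 0 11 0 ++ (vertexLoop 105 ++ (writeHit ++ writeVertex)))))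

/-- The words written for a point of the input. -/
noncomputable def affineWords (z : ℂ) : ℝ × ℝ × ℝ := (z.re, z.im, 1)

/-- The words written for the point in which the `k`-th edge meets the ray in direction `d`. -/
noncomputable def hitWords (I : Input) (d : ℂ) (k : ℕ) : ℝ × ℝ × ℝ :=
  (I.query.re * edgeDen I.read I.query d k + edgeNum I.read I.query k * d.re,
    I.query.im * edgeDen I.read I.query d k + edgeNum I.read I.query k * d.im,
    edgeDen I.read I.query d k)

/-- The words written by the program, where `kA` and `kB` are the edges on which the two cut points
lie, and `dA` and `dB` the directions in which they are seen. -/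
noncomputable def outputWords (I : Input) (dA dB : ℂ) (kA kB : ℕ) : List (ℝ × ℝ × ℝ) :=
  [affineWords (I.read 0), hitWords I dA kA] ++
    ((List.range' (kA + 1) (kB - kA)).map I.read).map affineWords ++
    [hitWords I dB kB, affineWords (I.read (I.len - 1))]

section Program

variable {prog : List (Instr 6 24)} {I : Input} {d dA dB : ℂ} {b k kA kB l : ℕ} {c : Config 6 24}

theorem aimed_selectFirst (I : Input) : Aimed I 0 (execList I (Config.init 6 24) selectFirst) where
  len := rfl
  zero := rfl
  one := Int.cast_one
  query_re := rfl
  query_im := rfl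
  dir_re := rfl
  dir_im := rfl

theorem Aimed.out_writeVertex (h : Aimed I d c) :
    (execList I c writeVertex).out = c.out ++ [affineWords (I.read (c.idx 5))] := by
  simp [execList, writeVertex, Instr.exec, affineWords, h.one]

theorem HoldsHit.out_writeHit (h : HoldsHit I d k c) :
    (execList I c writeHit).out = c.out ++ [hitWords I d k] := by
  simp [execList, writeHit, Instr.exec, hitWords, h.query_re, h.query_im, h.dir_re, h.dir_im,
    h.hitNum, h.hitDen]

theorem Aimed.out_writeNext (h : Aimed I d c) :
    (execList I c writeNext).out = c.out ++ [affineWords (I.read (c.idx 3 + 1))] := by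
  simp [execList, writeNext, Instr.exec, affineWords, h.one]

theorem CodeAt.exists_reaches_vertexLoop (hcode : CodeAt prog b (vertexLoop b)) (hpc : c.pc = b)
    (h : HoldsHit I d k c) (hidx : c.idx 4 = c.idx 3 + l) :
    ∃ c', Reaches prog I c (7 * l + 2) c' ∧ c'.pc = b + 7 ∧ HoldsHit I d k c' ∧
      c'.idx 5 = c.idx 5 ∧
      c'.out = c.out ++ ((List.range' (c.idx 3 + 1) l).map I.read).map affineWords := by
  obtain ⟨hhead, hrest⟩ := hcode.append
  obtain ⟨hbody, hjump⟩ := hrest.append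
  induction l generalizing c with
  | zero =>
    have reach_head := hhead.reaches_idxBranch (I := I) hpc
    rw [if_neg (by lia)] at reach_head
    exact ⟨_, reach_head, rfl, { h with }, rfl, (List.append_nil _).symm⟩
  | succ l ih =>
    have reach_head := hhead.reaches_idxBranch (I := I) hpc
    rw [if_pos (by lia)] at reach_head
    have reach_body := hbody.reaches_execList (I := I) (c := { c with pc := b + 2 }) rfl rfl
    have reach_jump := hjump.reaches_exec (I := I) (j := 0)
      (c := execList I { c with pc := b + 2 } writeNext) rfl rfl
    obtain ⟨c', reach_loop, hpc', hh, hidx', hout⟩ :=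
      ih (c := (Instr.jump b).exec I (execList I { c with pc := b + 2 } writeNext)) rfl { h with }
        (hidx.trans (by rw [← add_assoc, add_right_comm]; rfl))
    refine ⟨c', (((reach_head.trans reach_body).trans reach_jump).trans reach_loop).mono ?_, hpc',
      hh, hidx', hout.trans ?_⟩
    · simp only [writeNext, List.length_cons, List.length_nil]
      lia
    · have hnext := Aimed.out_writeNext (I := I) (c := { c with pc := b + 2 }) { h with }
      rw [List.range'_succ, List.map_cons, List.map_cons]
      exact (congrArg (· ++ _) hnext).trans (List.append_assoc _ _ _)

theorem exists_reaches_selectLast (hdA : I.read 0 - I.query = dA)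
    (hA : IsNearestEdge I.read I.query dA I.len (LeavesRay I.read I.query dA) kA) :
    ∃ c, Reaches program I (Config.init 6 24) (36 * I.len + 17) c ∧ c.pc = 61 ∧ Aimed I dA c ∧
      c.idx 3 = kA ∧ c.idx 5 = I.len - 1 ∧
      c.out = [affineWords (I.read 0), hitWords I dA kA] := by
  obtain ⟨hselect, hcode⟩ := CodeAt.append (l₁ := selectFirst) (codeAt_self program)
  obtain ⟨hscan, hcode⟩ := hcode.append
  obtain ⟨hwrite, -⟩ := hcode.append
  have reach_select := hselect.reaches_execList (I := I) (c := Config.init 6 24) rfl rfl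
  obtain ⟨c, reach_scan, hpc, hhit, hout, hidx, hother⟩ :=
    exists_reaches_scan (b := 5) hscan (by decide) (isCandidateTest_leavesRay I dA)
      (aimed_selectFirst I) hdA hA rfl
  have reach_write := hwrite.reaches_execList (I := I) hpc rfl
  have hc5 : c.idx 5 = 0 := hother 5 (by decide) (by decide)
  have hout_vertex := hhit.out_writeVertex
  have hhit' : HoldsHit I dA kA (execList I c writeVertex) := { hhit with }
  rw [hout, hc5] at hout_vertex
  refine ⟨_, ((reach_select.trans reach_scan).trans reach_write).mono ?_, congrArg (· + 12) hpc,
    { hhit with }, hidx, rfl, hhit'.out_writeHit.trans (congrArg (· ++ _) hout_vertex)⟩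
  simp only [selectFirst, writeVertex, writeHit, selectLast, List.length_append, List.length_cons,
    List.length_nil]
  lia

theorem exists_reaches_end (hpc : c.pc = 61) (h : Aimed I dA c) (hidx₃ : c.idx 3 = kA)
    (hidx₅ : c.idx 5 = I.len - 1) (hdB : I.read (I.len - 1) - I.query = dB)
    (hB : IsNearestEdge I.read I.query dB I.len (ReachesRay I.read I.query dB) kB)
    (hAB : kA ≤ kB) :
    ∃ c', Reaches program I c (43 * I.len + 14) c' ∧ c'.pc = 122 ∧
      c'.out = c.out ++ ((List.range' (kA + 1) (kB - kA)).map I.read).map affineWords ++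
        [hitWords I dB kB, affineWords (I.read (I.len - 1))] := by
  obtain ⟨-, hcode⟩ := CodeAt.append (l₁ := selectFirst) (codeAt_self program)
  obtain ⟨-, hcode⟩ := hcode.append
  obtain ⟨-, hcode⟩ := hcode.append
  obtain ⟨hscan, hcode⟩ := hcode.append
  obtain ⟨hloop, hwrite⟩ := hcode.append
  obtain ⟨c₁, reach_scan, hpc₁, hhit, hout₁, hres, hother⟩ :=
    exists_reaches_scan (b := 61) hscan (by decide) (isCandidateTest_reachesRay I dB) h
      (hidx₅ ▸ hdB) hB hpc
  have hidx₁ : c₁.idx 3 = kA := (hother 3 (by decide) (by decide)).trans hidx₃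
  obtain ⟨c₂, reach_loop, hpc₂, hhit₂, hidx₂, hout₂⟩ :=
    CodeAt.exists_reaches_vertexLoop (b := 105) (l := kB - kA) hloop hpc₁ hhit (by lia)
  have reach_write := hwrite.reaches_execList (I := I) hpc₂ rfl
  have hlast : c₂.idx 5 = I.len - 1 :=
    (hidx₂.trans (hother 5 (by decide) (by decide))).trans hidx₅
  have hhit₃ : HoldsHit I dB kB (execList I c₂ writeHit) := { hhit₂ with }
  refine ⟨_, ((reach_scan.trans reach_loop).trans reach_write).mono ?_, congrArg (· + 10) hpc₂,
    hhit₃.out_writeVertex.trans ?_⟩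
  · have hkB := hB.1
    simp only [writeVertex, writeHit, List.length_append, List.length_cons, List.length_nil]
    lia
  · rw [hhit₂.out_writeHit, hout₂, hout₁, hidx₁, ← hlast, List.append_assoc _ [_]]
    rfl

theorem program_correct (hdA : I.read 0 - I.query = dA)
    (hdB : I.read (I.len - 1) - I.query = dB)
    (hA : IsNearestEdge I.read I.query dA I.len (LeavesRay I.read I.query dA) kA)
    (hB : IsNearestEdge I.read I.query dB I.len (ReachesRay I.read I.query dB) kB)
    (hAB : kA ≤ kB) :
    ∃ T ≤ 100 * I.len, Halted program (run program I T) ∧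
      (run program I T).out = outputWords I dA dB kA kB := by
  obtain ⟨c, reach₁, hpc, haim, hidx₃, hidx₅, hout⟩ := exists_reaches_selectLast hdA hA
  obtain ⟨c', reach₂, hpc', hout'⟩ := exists_reaches_end hpc haim hidx₃ hidx₅ hdB hB hAB
  have hlen := hA.1
  obtain ⟨T, hT, rfl⟩ := reach₁.trans reach₂
  exact ⟨T, by lia, hpc'.ge, hout'.trans (by rw [hout]; rfl)⟩

end Program

/-! ### The size of the registers -/

namespace IsIntBounded

variable {U V : ℕ} {x y : ℝ}

theorem zero (U : ℕ) : IsIntBounded U 0 := ⟨0, by simp, by simp⟩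

theorem mono (h : IsIntBounded U x) (hUV : U ≤ V) : IsIntBounded V x := by
  obtain ⟨z, hz, hzU⟩ := h
  exact ⟨z, hz, hzU.trans (Nat.cast_le.2 hUV)⟩

theorem add (hx : IsIntBounded U x) (hy : IsIntBounded V y) : IsIntBounded (U + V) (x + y) := by
  obtain ⟨z, rfl, hz⟩ := hx
  obtain ⟨w, rfl, hw⟩ := hy
  refine ⟨z + w, (Int.cast_add z w).symm, (abs_add_le z w).trans ?_⟩
  rw [Nat.cast_add]
  exact add_le_add hz hw

theorem sub (hx : IsIntBounded U x) (hy : IsIntBounded V y) : IsIntBounded (U + V) (x - y) := by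
  obtain ⟨z, rfl, hz⟩ := hx
  obtain ⟨w, rfl, hw⟩ := hy
  refine ⟨z - w, (Int.cast_sub z w).symm, (abs_sub z w).trans ?_⟩
  rw [Nat.cast_add]
  exact add_le_add hz hw

theorem mul (hx : IsIntBounded U x) (hy : IsIntBounded V y) : IsIntBounded (U * V) (x * y) := by
  obtain ⟨z, rfl, hz⟩ := hx
  obtain ⟨w, rfl, hw⟩ := hy
  refine ⟨z * w, (Int.cast_mul z w).symm, (abs_mul z w).trans_le ?_⟩
  rw [Nat.cast_mul]
  exact mul_le_mul hz hw (abs_nonneg _) (Nat.cast_nonneg _)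

end IsIntBounded

theorem Input.IntBounded.read {I : Input} {U : ℕ} (h : I.IntBounded U) (k : ℕ) :
    IsIntBounded U (I.read k).re ∧ IsIntBounded U (I.read k).im := by
  unfold Input.read
  split_ifs
  · exact h.1 _
  · exact ⟨.zero U, .zero U⟩

section Registers

variable {α β : ℕ} {prog : List (Instr α β)} {I : Input} {ins : Instr α β} {c : Config α β}
  {a e : Fin β → ℕ} {U K T T' : ℕ}

/-- The monomial bound `a r * (U + 1) ^ e r` for the size of the number register `r`. -/
def numBound (a e : Fin β → ℕ) (U : ℕ) (r : Fin β) : ℕ := a r * (U + 1) ^ e r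

/-- If every number register `r` is bounded by `numBound a e U r`, where `U` bounds the input, then
this remains so when the instruction is executed. -/
def Instr.KeepsBound (a e : Fin β → ℕ) : Instr α β → Prop
  | .numConst r z => |z| ≤ a r
  | .readX r _ => 1 ≤ a r ∧ 1 ≤ e r
  | .readY r _ => 1 ≤ a r ∧ 1 ≤ e r
  | .queryX r => 1 ≤ a r ∧ 1 ≤ e r
  | .queryY r => 1 ≤ a r ∧ 1 ≤ e r
  | .add r s t => a s + a t ≤ a r ∧ e s ≤ e r ∧ e t ≤ e r
  | .sub r s t => a s + a t ≤ a r ∧ e s ≤ e r ∧ e t ≤ e r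
  | .mul r s t => a s * a t ≤ a r ∧ e s + e t ≤ e r
  | _ => True

instance (a e : Fin β → ℕ) : DecidablePred (Instr.KeepsBound (α := α) a e) := fun ins => by
  cases ins <;> unfold Instr.KeepsBound <;> infer_instance

theorem le_numBound {r : Fin β} (ha : 1 ≤ a r) (he : 1 ≤ e r) : U ≤ numBound a e U r :=
  calc U ≤ 1 * (U + 1) ^ 1 := by lia
    _ ≤ a r * (U + 1) ^ e r := Nat.mul_le_mul ha (Nat.pow_le_pow_right U.succ_pos he)

theorem numBound_add_le {r s t : Fin β} (ha : a s + a t ≤ a r) (hs : e s ≤ e r) (ht : e t ≤ e r) :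
    numBound a e U s + numBound a e U t ≤ numBound a e U r :=
  calc a s * (U + 1) ^ e s + a t * (U + 1) ^ e t
      ≤ a s * (U + 1) ^ e r + a t * (U + 1) ^ e r := by gcongr <;> lia
    _ = (a s + a t) * (U + 1) ^ e r := (add_mul _ _ _).symm
    _ ≤ a r * (U + 1) ^ e r := Nat.mul_le_mul_right _ ha

theorem numBound_mul_le {r s t : Fin β} (ha : a s * a t ≤ a r) (he : e s + e t ≤ e r) :
    numBound a e U s * numBound a e U t ≤ numBound a e U r :=
  calc a s * (U + 1) ^ e s * (a t * (U + 1) ^ e t)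
      = a s * a t * (U + 1) ^ (e s + e t) := by ring
    _ ≤ a r * (U + 1) ^ e r := Nat.mul_le_mul ha (Nat.pow_le_pow_right U.succ_pos he)

theorem Instr.KeepsBound.exec (h : ins.KeepsBound a e) (hI : I.IntBounded U)
    (hc : ∀ r, IsIntBounded (numBound a e U r) (c.num r)) :
    ∀ r, IsIntBounded (numBound a e U r) ((ins.exec I c).num r) := by
  have hupdate {s : Fin β} {x : ℝ} (hx : IsIntBounded (numBound a e U s) x) :=
    (Function.forall_update_iff c.num fun r y => IsIntBounded (numBound a e U r) y).2
      ⟨hx, fun r _ => hc r⟩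
  cases ins with
  | numConst s z =>
    refine hupdate ⟨z, rfl, h.trans ?_⟩
    exact_mod_cast Nat.le_mul_of_pos_right _ (Nat.pow_pos U.succ_pos)
  | readX s _ => exact hupdate ((hI.read _).1.mono (le_numBound h.1 h.2))
  | readY s _ => exact hupdate ((hI.read _).2.mono (le_numBound h.1 h.2))
  | queryX s => exact hupdate (hI.2.1.mono (le_numBound h.1 h.2))
  | queryY s => exact hupdate (hI.2.2.mono (le_numBound h.1 h.2))
  | add s t u => exact hupdate (((hc t).add (hc u)).mono (numBound_add_le h.1 h.2.1 h.2.2))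
  | sub s t u => exact hupdate (((hc t).sub (hc u)).mono (numBound_add_le h.1 h.2.1 h.2.2))
  | mul s t u => exact hupdate (((hc t).mul (hc u)).mono (numBound_mul_le h.1 h.2))
  | _ => exact hc

theorem run_succ (prog : List (Instr α β)) (I : Input) (T : ℕ) :
    run prog I (T + 1) = step prog I (run prog I T) := Function.iterate_succ_apply' _ _ _

theorem isIntBounded_run (h : ∀ ins ∈ prog, ins.KeepsBound a e) (hI : I.IntBounded U) (T : ℕ) :
    ∀ r, IsIntBounded (numBound a e U r) ((run prog I T).num r) := by
  induction T with
  | zero => exact fun _ => .zero _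
  | succ T ih =>
    rw [run_succ, step]
    split
    next ins hins => exact (h ins (List.mem_of_getElem? hins)).exec hI ih
    next => exact ih

/-- The instruction sets no index register to a constant above `1`. -/
def Instr.SmallConst : Instr α β → Prop
  | .idxConst _ k => k ≤ 1
  | _ => True

instance : DecidablePred (Instr.SmallConst (α := α) (β := β)) := fun ins => by
  cases ins <;> unfold Instr.SmallConst <;> infer_instance

theorem Instr.SmallConst.exec (h : ins.SmallConst) (hK : I.len ≤ K) (hc : ∀ x, c.idx x ≤ K) :
    ∀ x, (ins.exec I c).idx x ≤ K + 1 := by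
  have hupdate {y : Fin α} {k : ℕ} (hk : k ≤ K + 1) :=
    (Function.forall_update_iff (a := y) c.idx fun _ l => l ≤ K + 1).2
      ⟨hk, fun x _ => Nat.le_succ_of_le (hc x)⟩
  cases ins with
  | idxConst y k => exact hupdate (h.trans (Nat.le_add_left 1 K))
  | idxLen y => exact hupdate (Nat.le_succ_of_le hK)
  | idxCopy y z => exact hupdate (Nat.le_succ_of_le (hc z))
  | idxSucc y => exact hupdate (Nat.succ_le_succ (hc y))
  | idxPred y => exact hupdate ((Nat.sub_le _ 1).trans (Nat.le_succ_of_le (hc y)))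
  | _ => exact fun x => Nat.le_succ_of_le (hc x)

theorem idx_run_le (h : ∀ ins ∈ prog, ins.SmallConst) (T : ℕ) :
    ∀ x, (run prog I T).idx x ≤ I.len + T := by
  induction T with
  | zero => exact fun _ => Nat.zero_le _
  | succ T ih =>
    rw [run_succ, step]
    split
    next ins hins => exact (h ins (List.mem_of_getElem? hins)).exec (Nat.le_add_right _ _) ih
    next => exact fun x => Nat.le_succ_of_le (ih x)

theorem run_eq_of_halted (h : Halted prog (run prog I T)) (hT : T ≤ T') :
    run prog I T' = run prog I T := by
  have hfix : step prog I (run prog I T) = run prog I T := by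
    rw [step, List.getElem?_eq_none h]
  obtain ⟨s, rfl⟩ := Nat.exists_eq_add_of_le' hT
  exact (Function.iterate_add_apply _ s T _).trans (Function.iterate_fixed hfix s)

theorem idx_run_le_of_halted (h : ∀ ins ∈ prog, ins.SmallConst)
    (hT : Halted prog (run prog I T)) (T' : ℕ) (x : Fin α) :
    (run prog I T').idx x ≤ I.len + T := by
  rcases le_total T' T with hle | hle
  · exact (idx_run_le h T' x).trans (Nat.add_le_add_left hle _)
  · rw [run_eq_of_halted hT hle]
    exact idx_run_le h T x

end Registers

/-- The coefficients of the bounds for the number registers of the program. -/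
def numCoeff : Fin 24 → ℕ :=
  ![0, 1, 1, 2, 2, 2, 2, 2, 2, 4, 4, 8, 8, 8, 16, 8, 16, 128, 128, 1, 1, 256, 256, 1]

/-- The degrees of the bounds for the number registers of the program. -/
def numDegree : Fin 24 → ℕ :=
  ![0, 1, 1, 1, 1, 1, 1, 1, 1, 2, 2, 2, 2, 2, 2, 2, 2, 4, 4, 1, 1, 4, 4, 0]

theorem keepsBound_program : ∀ ins ∈ program, ins.KeepsBound numCoeff numDegree := by
  decide

theorem smallConst_program : ∀ ins ∈ program, ins.SmallConst := by
  decide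

theorem numCoeff_le : ∀ r, numCoeff r ≤ 256 := by
  decide

theorem numDegree_le : ∀ r, numDegree r ≤ 4 := by
  decide

theorem isIntBounded_program {I : Input} {U : ℕ} (hI : I.IntBounded U) (T : ℕ) (r : Fin 24) :
    IsIntBounded (256 * (U + 1) ^ 4) ((run program I T).num r) :=
  (isIntBounded_run keepsBound_program hI T r).mono
    (Nat.mul_le_mul (numCoeff_le r) (Nat.pow_le_pow_right U.succ_pos (numDegree_le r)))

/-! ### The output for a chain -/

theorem represents_map_affineWords (L : List ℂ) : Represents (L.map affineWords) L := by
  refine List.forall₂_map_left_iff.2 (List.forall₂_same.2 fun z _ => ?_)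
  simp [affineWords]

theorem represents_hitWords {I : Input} {d z : ℂ} {k : ℕ} (hD : 0 < edgeDen I.read I.query d k)
    (hz : z = I.query + (edgeNum I.read I.query k / edgeDen I.read I.query d k : ℝ) * d) :
    Represents [hitWords I d k] [z] := by
  have hne := hD.ne'
  refine .cons ⟨hne, ?_, ?_⟩ .nil
  · rw [hz, add_re, re_ofReal_mul, hitWords]
    field_simp
  · rw [hz, add_im, im_ofReal_mul, hitWords]
    field_simp

theorem filter_range_eq_range' {m kA kB : ℕ} {P : ℕ → Bool} (hm : kB < m) (hAB : kA ≤ kB)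
    (hP : ∀ k, P k = true ↔ kA < k ∧ k ≤ kB) :
    (List.range m).filter P = List.range' (kA + 1) (kB - kA) := by
  refine (List.pairwise_lt_range.filter P).eq_of_mem_iff List.pairwise_lt_range' fun k => ?_
  rw [List.mem_filter, List.mem_range, hP, List.mem_range'_1]
  lia

section Chain

variable {n : ℕ} {v : ZMod n → ℂ} {q : ℂ} {i : ZMod n} {m kA kB : ℕ} {a b : ℝ}

theorem IsFirstCutEdge.le_of_isLastCutEdge (hA : IsFirstCutEdge v q i m a kA)
    (hB : IsLastCutEdge v q i m b kB) (hab : a < b) : kA ≤ kB := by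
  have hlt : (kA : ℝ) < (kB + 1 : ℕ) := by
    push_cast
    exact hA.mem.1.trans_lt (hab.trans_le hB.mem.2)
  exact Nat.lt_succ_iff.1 (Nat.cast_lt.1 hlt)

theorem outputPoints_eq_of_mem (v : ZMod n → ℂ) (q : ℂ) (i : ZMod n)
    (ha : a ∈ Ico (kA : ℝ) (kA + 1)) (hb : b ∈ Ioc (kB : ℝ) (kB + 1)) (hAB : kA ≤ kB)
    (hm : kB + 1 < m) :
    outputPoints v i m a b = [v i, curve v i a] ++
      (List.range' (kA + 1) (kB - kA)).map (chainInput v q i m).read ++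
      [curve v i b, v (chainEnd i m)] := by
  have hmap : (List.range' (kA + 1) (kB - kA)).map (fun k : ℕ => v (i + k)) =
      (List.range' (kA + 1) (kB - kA)).map (chainInput v q i m).read := by
    refine List.map_congr_left fun k hk => (read_chainInput v q i ?_).symm
    rw [List.mem_range'_1] at hk
    lia
  rw [outputPoints, filter_range_eq_range' (Nat.lt_of_succ_lt hm) hAB, hmap]
  intro k
  rw [decide_eq_true_iff]
  refine and_congr ⟨fun h => ?_, fun h => ha.2.trans_le ?_⟩ ⟨fun h => ?_, fun h => ?_⟩
  · exact Nat.cast_lt.1 (ha.1.trans_lt h)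
  · exact_mod_cast h
  · exact Nat.lt_succ_iff.1 (by exact_mod_cast h.trans_le hb.2)
  · exact (Nat.cast_le.2 h).trans_lt hb.1

theorem read_chainInput_zero (v : ZMod n → ℂ) (q : ℂ) (i : ZMod n) (hm : 0 < m) :
    (chainInput v q i m).read 0 = v i := by
  simpa using read_chainInput v q i hm

theorem read_chainInput_last (v : ZMod n → ℂ) (q : ℂ) (i : ZMod n) (hm : 0 < m) :
    (chainInput v q i m).read (m - 1) = v (chainEnd i m) :=
  read_chainInput v q i (Nat.sub_one_lt_of_lt hm)

theorem represents_outputWords (hA : IsFirstCutEdge v q i m a kA)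
    (hB : IsLastCutEdge v q i m b kB) (hab : a < b) :
    Represents
      (outputWords (chainInput v q i m) (v i - q) (v (chainEnd i m) - q) kA kB)
      (outputPoints v i m a b) := by
  have hm := hB.isNearestEdge.1
  have first_vertex : Represents [affineWords ((chainInput v q i m).read 0)] [v i] := by
    rw [read_chainInput_zero v q i (by lia)]
    exact represents_map_affineWords [_]
  have last_vertex :
      Represents [affineWords ((chainInput v q i m).read (m - 1))] [v (chainEnd i m)] := by
    rw [read_chainInput_last v q i (by lia)]
    exact represents_map_affineWords [_]
  have first_cut := represents_hitWords (I := chainInput v q i m)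
    hA.isNearestEdge.2.1.edgeDen_pos hA.curve_eq
  have last_cut := represents_hitWords (I := chainInput v q i m)
    hB.isNearestEdge.2.1.edgeDen_pos hB.curve_eq
  rw [outputPoints_eq_of_mem v q i hA.mem hB.mem (hA.le_of_isLastCutEdge hB hab) hm]
  exact List.rel_append
    (List.rel_append (List.rel_append first_vertex first_cut) (represents_map_affineWords _))
    (List.rel_append last_cut last_vertex)

theorem exists_run_program (hA : IsFirstCutEdge v q i m a kA) (hB : IsLastCutEdge v q i m b kB)
    (hab : a < b) :
    ∃ T ≤ 100 * m, Halted program (run program (chainInput v q i m) T) ∧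
      Represents (run program (chainInput v q i m) T).out (outputPoints v i m a b) := by
  have hm := hA.isNearestEdge.1
  obtain ⟨T, hT, hhalt, hout⟩ := program_correct
    (congrArg (· - q) (read_chainInput_zero v q i (by lia)))
    (congrArg (· - q) (read_chainInput_last v q i (by lia)))
    hA.isNearestEdge hB.isNearestEdge (hA.le_of_isLastCutEdge hB hab)
  exact ⟨T, hT, hhalt, hout ▸ represents_outputWords hA hB hab⟩

end Chain

end ChainVisibility

theorem theorem2 :
    ∃ (α β : ℕ) (prog : List (Instr α β)) (C d : ℕ),
      ∀ (n : ℕ) [NeZero n] (v : ZMod n → ℂ) (q : ℂ) (i : ZMod n) (m : ℕ),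
        IsSimplePolygon v → q ∈ inside v →
        (∀ k : ZMod n, cross (v k - q) (v (k + 1) - q) ≠ 0) →
        IsVisibleCriticalChain v q i m →
        -- linear time, and correctness of the output
        (∃ T ≤ C * m, Halted prog (run prog (chainInput v q i m) T) ∧
          ∃ a b : ℝ, a < b ∧ IsFirstCut v q i m a ∧ IsLastCut v q i m b ∧
            Represents (run prog (chainInput v q i m) T).out (outputPoints v i m a b) ∧
            {x ∈ chain v i m | Visible v q x} =
              {v i} ∪ curve v i '' Set.Icc a b ∪ {v (chainEnd i m)}) ∧
        -- the `α + β` registers hold words of logarithmic size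
        (∀ T x, (run prog (chainInput v q i m) T).idx x ≤ C * m) ∧
        (∀ U : ℕ, (chainInput v q i m).IntBounded U →
          ∀ T r, IsIntBounded (C * (U + 1) ^ d) ((run prog (chainInput v q i m) T).num r)) := by
  refine ⟨6, 24, program, 256, 4, fun n _ v q i m hs hq hw hc => ?_⟩
  obtain ⟨θ, ρ, a, b, h⟩ := exists_chainView hs hq hw hc
  obtain ⟨T, hT, hhalt, hout⟩ := exists_run_program h.isFirstCutEdge h.isLastCutEdge h.lt
  refine ⟨⟨T, by lia, hhalt, a, b, h.lt, h.isFirstCut, h.isLastCut, hout, h.setOf_visible_eq⟩,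
    fun T' x => (idx_run_le_of_halted smallConst_program hhalt T' x).trans ?_,
    fun U hU => isIntBounded_program hU⟩
  calc m + T ≤ m + 100 * m := Nat.add_le_add_left hT m
    _ ≤ 256 * m := by lia
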